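/- **Setting.** For each $n\ge 1$ let $(\mu_i,\sigma_i,X_i)$, $1\le i\le n$, be independent triples with the same law: $\mu_i\sim G_{\mu}$ and $\sigma_i\sim G_{\sigma}$ are independent, and $X_i\mid\mu_i,\sigma_i\sim N(\mu_i,\sigma_i^2)$. The probability distributions $G_\mu=G_{\mu,n}$ and $G_\sigma=G_{\sigma,n}$ are arbitrary and may depend on $n$, subject to the following. 1. $|\mu_i|\le C_n$ almost surely, where $C_n=o(n^{\epsilon})$ for every $\epsilon>0$. 2. $\sigma_l\le\sigma_i\le\sigma_u$ almost surely, with constants $0<\sigma_l\le\sigma_u<\infty$ that do not depend on $n$. Let $\phi_h(z)=(\sqrt{2\pi}\,h)^{-1}e^{-z^2/(2h^2)}$. For bandwidths $h_x,h_\sigma>0$ put $w_j(\sigma)=\phi_{h_\sigma}(\sigma-\sigma_j)/\sum_{k=1}^n\phi_{h_\sigma}(\sigma-\sigma_k)$, $$\hat f_\sigma(x)=\sum_{j=1}^n w_j(\sigma)\,\phi_{h_x\sigma_j}(x-X_j),\qquad \hat\delta_i=X_i+\sigma_i^2\,\frac{\hat f^{(1)}_{\sigma_i}(X_i)}{\hat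 f_{\sigma_i}(X_i)},$$ where $\hat f^{(1)}_\sigma=\frac{d}{dx}\hat f_\sigma$; $\hat\delta_i$ is the NEST estimator of $\mu_i$. **Theorem.** Let $h_x=h_{x,n}$ and $h_\sigma=h_{\sigma,n}$ be positive bandwidths of exact orders $n^{-\eta_x}$ and $n^{-\eta_s}$ (bounded above and below by constant multiples of these for large $n$), where $\eta_x,\eta_s>0$ and $\eta_x+\eta_s<1$. Let $t\in\mathbb R$ be a fixed threshold such that, for every $\epsilon>0$, $P(X_1>t)\ge n^{-\epsilon}$ for all large $n$ (this holds automatically if $G_\mu$ and $G_\sigma$ do not depend on $n$). Then the conditional expectation below exists for all $n$ and $i$, and, as $n\to\infty$, uniformly in $1\le i\le n$, $$\mathbb E(\hat\delta_i-\mu_i\mid X_i>t)=o(1).$$ If moreover $3\eta_x+\eta_s<1$, then the same holds with $\hat\delta_i$ replaced by the truncated estimator $\min(\hat\delta_i,\tau_n)$, and also with $\hat\delta_i$ replaced by $\max\{-\tau_n,\min(\hat\delta_i,\tau_n)\}$, for every sequence of reals $\tau_n$ with $\tau_n\ge C_n$ for all large $n$. -/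

import Mathlib

open Filter MeasureTheory ProbabilityTheory Asymptotics

noncomputable section

namespace NEST

/-- The Gaussian kernel `φ_h(z) = (√(2π) h)⁻¹ exp(-z² / (2h²))`. -/
def phi (h z : ℝ) : ℝ :=
  (Real.sqrt (2 * Real.pi) * h)⁻¹ * Real.exp (-(z ^ 2) / (2 * h ^ 2))

/-- Weight of the `j`-th observation for estimating the density at standard deviation `s`:
`w_j = φ_{hσ}(s - σ_j) / ∑ k, φ_{hσ}(s - σ_k)`. -/
def weight {n : ℕ} (hσ : ℝ) (σ : Fin n → ℝ) (s : ℝ) (j : Fin n) : ℝ :=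
  phi hσ (s - σ j) / ∑ k, phi hσ (s - σ k)

/-- Weighted kernel density estimate of the marginal density `f_s` at `y`, with bandwidth
`hx * σ_j` at the `j`-th observation. -/
def fHat {n : ℕ} (hx hσ : ℝ) (x σ : Fin n → ℝ) (s y : ℝ) : ℝ :=
  ∑ j, weight hσ σ s j * phi (hx * σ j) (y - x j)

/-- The derivative of the density estimate in `y`, in closed form
(see `hasDerivAt_fHat`). -/
def fHatDeriv {n : ℕ} (hx hσ : ℝ) (x σ : Fin n → ℝ) (s y : ℝ) : ℝ :=
  ∑ j, weight hσ σ s j * phi (hx * σ j) (y - x j) * ((x j - y) / (hx * σ j) ^ 2)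

theorem hasDerivAt_fHat {n : ℕ} (hx hσ : ℝ) (x σ : Fin n → ℝ) (s y : ℝ) :
    HasDerivAt (fHat hx hσ x σ s) (fHatDeriv hx hσ x σ s y) y := by
  unfold fHat fHatDeriv
  refine HasDerivAt.fun_sum fun j _ => ?_
  have h1 : HasDerivAt (fun z : ℝ => -((z - x j) ^ 2) / (2 * (hx * σ j) ^ 2))
      ((x j - y) / (hx * σ j) ^ 2) y := by
    have h := ((((hasDerivAt_id y).sub_const (x j)).pow 2).neg).div_const (2 * (hx * σ j) ^ 2)
    refine h.congr_deriv ?_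
    by_cases h0 : hx * σ j = 0
    · simp [h0]
    · simp only [id]
      field_simp
      ring
  have h2 := (h1.exp.const_mul (Real.sqrt (2 * Real.pi) * (hx * σ j))⁻¹).const_mul
    (weight hσ σ s j)
  refine h2.congr_deriv ?_
  unfold phi
  ring

/-- The NEST estimate of the `i`-th mean from the observations `x` and the known standard
deviations `σ`. The density estimate uses all observations, including the `i`-th. -/
def nest {n : ℕ} (hx hσ : ℝ) (x σ : Fin n → ℝ) (i : Fin n) : ℝ :=
  x i + σ i ^ 2 * (fHatDeriv hx hσ x σ (σ i) (x i) / fHat hx hσ x σ (σ i) (x i))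

/-- Joint law of a triple `(μ, σ, X)` with `μ ∼ Gμ` and `σ ∼ Gσ` independent and
`X | μ, σ ∼ N(μ, σ²)`, that is `φ_σ(x - μ) dx dGσ(σ) dGμ(μ)`. -/
def tripleLaw (Gμ Gσ : Measure ℝ) : Measure (ℝ × ℝ × ℝ) :=
  (Gμ.prod (Gσ.prod volume)).withDensity
    fun p => ENNReal.ofReal (phi p.2.1 (p.2.2 - p.1))

/-- Joint law of `n` independent triples `(μ_i, σ_i, X_i)`. -/
def dataLaw (n : ℕ) (Gμ Gσ : Measure ℝ) : Measure (Fin n → ℝ × ℝ × ℝ) :=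
  Measure.pi fun _ => tripleLaw Gμ Gσ

/-- Error `est_i - μ_i` of an estimator, which sees the observations and the standard
deviations only. -/
def estError {n : ℕ} (est : (Fin n → ℝ) → (Fin n → ℝ) → Fin n → ℝ) (i : Fin n)
    (D : Fin n → ℝ × ℝ × ℝ) : ℝ :=
  est (fun j => (D j).2.2) (fun j => (D j).2.1) i - (D i).1

/-- Conditional law of the data given the selection event `X_i > t`. -/
def selectedLaw {n : ℕ} (Gμ Gσ : Measure ℝ) (t : ℝ) (i : Fin n) :
    Measure (Fin n → ℝ × ℝ × ℝ) :=
  ProbabilityTheory.cond (dataLaw n Gμ Gσ) {D | t < (D i).2.2}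

/-- `E(est_i - μ_i | X_i > t)` exists, and it is `o(1)` as `n → ∞`, uniformly in `i`. -/
def VanishingSelectionBias (Gμ Gσ : ℕ → Measure ℝ) (t : ℝ)
    (est : ∀ n : ℕ, (Fin n → ℝ) → (Fin n → ℝ) → Fin n → ℝ) : Prop :=
  (∀ (n : ℕ) (i : Fin n), Integrable (estError (est n) i) (selectedLaw (Gμ n) (Gσ n) t i)) ∧
  ∀ ε : ℝ, 0 < ε → ∀ᶠ n : ℕ in atTop, ∀ i : Fin n,
    |∫ D, estError (est n) i D ∂(selectedLaw (Gμ n) (Gσ n) t i)| < ε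

end NEST

end

/-! Fix the scales and all observations but the `i`-th, and let the `i`-th one take the value `x`.
With `s = σ i`, write `f = mix G s` for the marginal density of the `i`-th observation and `A(x)`
for the density estimate at `x` (`kde`). The posterior mean is `x + s² f'/f`, so integrating out the
mean shows that the unnormalised bias on the selected event is `s²` times the expectation of `∫_{x >
t} (A'/A · f - f') dx` (`integral_select`, `integral_indicator_estError_eq`).

The observation is itself a kernel centre. Its own kernel adds a constant to `A` and nothing to
`A'`, so the estimated score `A'/A` is exactly the derivative of `log A`. Moreover `A` is at least a
multiple of `1/(n h)`, so `log A` is of logarithmic size without any lower bound on `f`. Integration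
by parts turns the integral into boundary values and an integral of `f' log(A/f)`, and `f |log A -
log f|` is at most `|A - f|` up to slowly growing factors (`abs_integral_score_sub_le`,
`mul_abs_log_sub_log_le`). Hence only the error of the density estimate matters, not that of its
derivative.

The smoothing bias of the density is of order `b + h²`, up to slowly growing factors, for every law
of the scales. The stochastic error has variance of order `W/h`, where `W` is the weight that
observation `i` gives to itself. For particular scales `W` may be large, but the self-weights sum to
at most a multiple of the number of cells of width `b`, so by exchangeability `W` has mean of order
`1/(n b)` (`sum_weight_self_le`, `integral_weight_self_le`). The variance is thus of order `1/(n b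
h)`, which is where `ηx + ηs < 1` enters.

Truncation is 1-Lipschitz and fixes the posterior mean, which lies in `[-C, C]`. The bias is then
bounded by the integral of the absolute score difference. The cancellation used above is lost and
the error of `A'` enters, with variance of order `1/(n b h³)`; hence `3 ηx + ηs < 1`.

An auxiliary scale `N = n ^ ρ` with small `ρ` dominates `C`, `|t|`, all logarithms and the inverse
selection probability; beyond `2 N` the Gaussian tail of `f` is negligible. -/

namespace NEST

/-! ### Elementary bounds for polynomials times a Gaussian -/

/-- The quadratic Taylor bound for the exponential at `u² / 2`; the moment bounds below follow by
dominating each power of `|u|` by this quartic. -/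
theorem quad_mul_exp_neg_le (u : ℝ) :
    (1 + u ^ 2 / 2 + u ^ 4 / 8) * Real.exp (-(u ^ 2) / 2) ≤ 1 := by
  have h := Real.quadratic_le_exp_of_nonneg (x := u ^ 2 / 2) (by positivity)
  have h2 : Real.exp (-(u ^ 2) / 2) * Real.exp (u ^ 2 / 2) = 1 := by
    rw [← Real.exp_add]; simp; ring
  have h3 := Real.exp_pos (-(u ^ 2) / 2)
  nlinarith

theorem abs_mul_exp_neg_le (u : ℝ) : |u| * Real.exp (-(u ^ 2) / 2) ≤ 1 := by
  refine le_trans (mul_le_mul_of_nonneg_right ?_ (Real.exp_pos _).le) (quad_mul_exp_neg_le u)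
  nlinarith [sq_abs u, sq_nonneg (|u| - 1), sq_nonneg (u ^ 2)]

theorem sq_mul_exp_neg_le (u : ℝ) : u ^ 2 * Real.exp (-(u ^ 2) / 2) ≤ 1 := by
  refine le_trans (mul_le_mul_of_nonneg_right ?_ (Real.exp_pos _).le) (quad_mul_exp_neg_le u)
  nlinarith [sq_nonneg (u ^ 2 - 2)]

theorem abs_cube_mul_exp_neg_le (u : ℝ) : |u| ^ 3 * Real.exp (-(u ^ 2) / 2) ≤ 3 := by
  have h : |u| ^ 3 ≤ 3 * (1 + u ^ 2 / 2 + u ^ 4 / 8) := by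
    have : u ^ 4 = |u| ^ 4 := by rw [← abs_pow, abs_of_nonneg (by positivity)]
    rw [this, ← sq_abs u]
    nlinarith [sq_nonneg (|u| ^ 2 - |u|), sq_nonneg (|u|), abs_nonneg u, sq_nonneg (|u| ^ 2)]
  calc |u| ^ 3 * Real.exp (-(u ^ 2) / 2)
      ≤ 3 * (1 + u ^ 2 / 2 + u ^ 4 / 8) * Real.exp (-(u ^ 2) / 2) :=
        mul_le_mul_of_nonneg_right h (Real.exp_pos _).le
    _ ≤ 3 := by nlinarith [quad_mul_exp_neg_le u]

/-- Truncation at level `L` of the first absolute moment of an unnormalised Gaussian weight. -/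
theorem abs_mul_exp_neg_le_trunc (u : ℝ) {L : ℝ} (hL : 0 ≤ L) :
    |u| * Real.exp (-(u ^ 2) / 2) ≤
      L * Real.exp (-(u ^ 2) / 2) + 2 * Real.exp (-(L ^ 2) / 4) := by
  rcases le_total |u| L with h | h
  · have := Real.exp_pos (-(u ^ 2) / 2)
    have := Real.exp_pos (-(L ^ 2) / 4)
    nlinarith
  · have h1 : Real.exp (-(u ^ 2) / 2) = Real.exp (-(u ^ 2) / 4) * Real.exp (-(u ^ 2) / 4) := by
      rw [← Real.exp_add]; ring_nf
    have h2 : Real.exp (-(u ^ 2) / 4) ≤ Real.exp (-(L ^ 2) / 4) := by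
      apply Real.exp_le_exp.2
      have : L ^ 2 ≤ u ^ 2 := by rw [← sq_abs u]; gcongr
      linarith
    have h3 : |u| * Real.exp (-(u ^ 2) / 4) ≤ 2 := by
      have h := abs_mul_exp_neg_le (u / Real.sqrt 2)
      have h4 : -((u / Real.sqrt 2) ^ 2) / 2 = -(u ^ 2) / 4 := by
        rw [div_pow, Real.sq_sqrt (by norm_num)]; ring
      rw [h4, abs_div, abs_of_pos (Real.sqrt_pos.2 (by norm_num : (0 : ℝ) < 2))] at h
      have h5 : Real.sqrt 2 ≤ 2 := by
        rw [Real.sqrt_le_left (by norm_num)]; norm_num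
      rw [div_mul_eq_mul_div, div_le_one (by positivity)] at h
      linarith
    have h6 := Real.exp_pos (-(u ^ 2) / 4)
    have h7 := Real.exp_pos (-(u ^ 2) / 2)
    calc |u| * Real.exp (-(u ^ 2) / 2)
        = |u| * Real.exp (-(u ^ 2) / 4) * Real.exp (-(u ^ 2) / 4) := by rw [h1]; ring
      _ ≤ 2 * Real.exp (-(L ^ 2) / 4) := by gcongr
      _ ≤ _ := by nlinarith

/-! ### The Gaussian kernel: size, derivatives, dependence on the scale -/

theorem one_le_sqrt_two_pi : 1 ≤ Real.sqrt (2 * Real.pi) := by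
  rw [Real.one_le_sqrt]; nlinarith [Real.pi_gt_three]

theorem sqrt_two_pi_le : Real.sqrt (2 * Real.pi) ≤ 3 := by
  rw [Real.sqrt_le_left (by norm_num)]; nlinarith [Real.pi_lt_four]

theorem phi_eq (s z : ℝ) :
    phi s z = (Real.sqrt (2 * Real.pi) * s)⁻¹ * Real.exp (-((z / s) ^ 2) / 2) := by
  unfold phi
  congr 2
  rw [div_pow, neg_div, neg_div, div_div]
  ring_nf

theorem phi_pos {s : ℝ} (hs : 0 < s) (z : ℝ) : 0 < phi s z := by
  have := one_le_sqrt_two_pi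
  unfold phi; positivity

theorem inv_sqrt_le {s : ℝ} (hs : 0 < s) : (Real.sqrt (2 * Real.pi) * s)⁻¹ ≤ s⁻¹ := by
  have := one_le_sqrt_two_pi
  apply inv_anti₀ hs
  nlinarith

theorem phi_le_exp {s : ℝ} (hs : 0 < s) (z : ℝ) :
    phi s z ≤ s⁻¹ * Real.exp (-((z / s) ^ 2) / 2) := by
  rw [phi_eq]
  exact mul_le_mul_of_nonneg_right (inv_sqrt_le hs) (Real.exp_pos _).le

theorem phi_le_phi_zero {s : ℝ} (hs : 0 < s) (z : ℝ) : phi s z ≤ phi s 0 := by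
  have := one_le_sqrt_two_pi
  rw [phi_eq, phi_eq]
  gcongr _ * Real.exp ?_
  have : 0 ≤ (z / s) ^ 2 := by positivity
  simp; linarith

theorem phi_zero_le {s : ℝ} (hs : 0 < s) : phi s 0 ≤ s⁻¹ := by
  have := phi_le_exp hs 0
  simpa using this

theorem phi_le {s : ℝ} (hs : 0 < s) (z : ℝ) : phi s z ≤ s⁻¹ :=
  (phi_le_phi_zero hs z).trans (phi_zero_le hs)

theorem le_phi_zero {s : ℝ} (hs : 0 < s) : (3 * s)⁻¹ ≤ phi s 0 := by
  have := sqrt_two_pi_le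
  have := one_le_sqrt_two_pi
  rw [phi_eq]
  have e : Real.exp (-((0 / s) ^ 2) / 2) = 1 := by simp
  rw [e, mul_one]
  apply inv_anti₀ <;> nlinarith

@[fun_prop]
theorem continuous_phi (s : ℝ) : Continuous (phi s) := by
  unfold phi; fun_prop

@[fun_prop]
theorem measurable_phi {α : Type*} [MeasurableSpace α] {f g : α → ℝ} (hf : Measurable f)
    (hg : Measurable g) : Measurable fun a => phi (f a) (g a) := by
  unfold phi; fun_prop

/-- Derivative of the Gaussian kernel. -/
noncomputable def dphi (s z : ℝ) : ℝ := phi s z * (-z / s ^ 2)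

@[fun_prop]
theorem continuous_dphi (s : ℝ) : Continuous (dphi s) := by
  unfold dphi; fun_prop

@[fun_prop]
theorem measurable_dphi {α : Type*} [MeasurableSpace α] {f g : α → ℝ} (hf : Measurable f)
    (hg : Measurable g) : Measurable fun a => dphi (f a) (g a) := by
  unfold dphi; fun_prop

theorem hasDerivAt_phi (s z : ℝ) : HasDerivAt (phi s) (dphi s z) z := by
  have h1 : HasDerivAt (fun z : ℝ => -(z ^ 2) / (2 * s ^ 2)) (-z / s ^ 2) z := by
    have h := (((hasDerivAt_id z).pow 2).neg).div_const (2 * s ^ 2)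
    refine h.congr_deriv ?_
    by_cases h0 : s = 0
    · simp [h0]
    · simp only [id]; field_simp; simp
  refine (h1.exp.const_mul (Real.sqrt (2 * Real.pi) * s)⁻¹).congr_deriv ?_
  unfold dphi phi; ring

theorem abs_dphi_eq {s : ℝ} (hs : 0 < s) (z : ℝ) :
    |dphi s z| = (Real.sqrt (2 * Real.pi) * s)⁻¹ * s⁻¹ *
      (|z / s| * Real.exp (-((z / s) ^ 2) / 2)) := by
  have h : dphi s z = -((Real.sqrt (2 * Real.pi) * s)⁻¹ * s⁻¹ *
      ((z / s) * Real.exp (-((z / s) ^ 2) / 2))) := by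
    unfold dphi; rw [phi_eq]; field_simp
  have := one_le_sqrt_two_pi
  rw [h, abs_neg, abs_mul, abs_mul (z / s), Real.abs_exp, abs_of_nonneg (by positivity)]

theorem abs_dphi_le {s : ℝ} (hs : 0 < s) (z : ℝ) : |dphi s z| ≤ (s ^ 2)⁻¹ := by
  have := one_le_sqrt_two_pi
  rw [abs_dphi_eq hs]
  calc _ ≤ s⁻¹ * s⁻¹ * 1 := by
        refine mul_le_mul ?_ (abs_mul_exp_neg_le _) (by positivity) (by positivity)
        exact mul_le_mul_of_nonneg_right (inv_sqrt_le hs) (by positivity)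
    _ = _ := by rw [mul_one, pow_two, mul_inv]

/-- One factor `phi` is kept because its mean under the data is a bounded mixture density. The
variance of the derivative estimate then costs `s⁻³` instead of the `s⁻⁴` of the sup bound. -/
theorem dphi_sq_le {s : ℝ} (hs : 0 < s) (z : ℝ) : dphi s z ^ 2 ≤ (s ^ 3)⁻¹ * phi s z := by
  have h0 := phi_pos hs z
  have h1 : phi s z * (z / s) ^ 2 ≤ s⁻¹ := by
    calc phi s z * (z / s) ^ 2 ≤ s⁻¹ * Real.exp (-((z / s) ^ 2) / 2) * (z / s) ^ 2 := by
          gcongr; exact phi_le_exp hs z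
      _ = s⁻¹ * ((z / s) ^ 2 * Real.exp (-((z / s) ^ 2) / 2)) := by ring
      _ ≤ s⁻¹ * 1 := by gcongr; exact sq_mul_exp_neg_le _
      _ = s⁻¹ := mul_one _
  calc dphi s z ^ 2 = (phi s z * (z / s) ^ 2) * (s ^ 2)⁻¹ * phi s z := by
        unfold dphi; field_simp
    _ ≤ s⁻¹ * (s ^ 2)⁻¹ * phi s z := by gcongr
    _ = _ := by rw [← mul_inv]; ring_nf

theorem phi_sq_le {s : ℝ} (hs : 0 < s) (z : ℝ) : phi s z ^ 2 ≤ s⁻¹ * phi s z := by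
  have h0 := phi_pos hs z
  rw [pow_two]; gcongr; exact phi_le hs z

theorem hasDerivAt_phi_scale {s : ℝ} (hs : 0 < s) (z : ℝ) :
    HasDerivAt (fun s => phi s z) (phi s z * (z ^ 2 / s ^ 3 - s⁻¹)) s := by
  have hp := one_le_sqrt_two_pi
  have hp' : Real.sqrt (2 * Real.pi) ≠ 0 := by positivity
  have h1 : HasDerivAt (fun s : ℝ => -(z ^ 2) / (2 * s ^ 2)) (z ^ 2 / s ^ 3) s := by
    have h := (((hasDerivAt_id s).pow 2).const_mul 2).inv (by simp; positivity)
    refine (h.const_mul (-(z ^ 2))).congr_deriv ?_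
    simp only [id]
    field_simp
    simp
    ring
  have h2 : HasDerivAt (fun s : ℝ => (Real.sqrt (2 * Real.pi) * s)⁻¹)
      (-(Real.sqrt (2 * Real.pi) * s)⁻¹ * s⁻¹) s := by
    have h := ((hasDerivAt_id s).const_mul (Real.sqrt (2 * Real.pi))).inv
      (mul_ne_zero hp' hs.ne')
    refine h.congr_deriv ?_
    simp only [id]
    field_simp
  refine (h2.mul h1.exp).congr_deriv ?_
  unfold phi; ring

theorem hasDerivAt_dphi_scale {s : ℝ} (hs : 0 < s) (z : ℝ) :
    HasDerivAt (fun s => dphi s z) (phi s z * (3 * z / s ^ 3 - z ^ 3 / s ^ 5)) s := by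
  have h1 : HasDerivAt (fun s : ℝ => -z / s ^ 2) (2 * z / s ^ 3) s := by
    have h := ((hasDerivAt_id s).pow 2).inv (by simp; positivity)
    refine (h.const_mul (-z)).congr_deriv ?_
    simp only [id]
    field_simp
    simp
    ring
  refine ((hasDerivAt_phi_scale hs z).mul h1).congr_deriv ?_
  field_simp
  ring

/-- Mean value inequality in the scale: the derivative there is `s⁻²` times a quadratic in `z / s`
times a Gaussian, bounded uniformly in `z`. -/
theorem abs_phi_sub_le {σ s s' : ℝ} (hσ : 0 < σ) (hs : σ ≤ s) (hs' : σ ≤ s') (z : ℝ) :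
    |phi s z - phi s' z| ≤ (σ ^ 2)⁻¹ * |s - s'| := by
  refine (convex_Ici σ).norm_image_sub_le_of_norm_hasDerivWithin_le
    (f := fun s => phi s z) (f' := fun s => phi s z * (z ^ 2 / s ^ 3 - s⁻¹))
    (fun s hs => (hasDerivAt_phi_scale (hσ.trans_le hs) z).hasDerivWithinAt) ?_ hs' hs
  intro s hs
  have hs0 : 0 < s := hσ.trans_le hs
  have h1 : z ^ 2 / s ^ 3 - s⁻¹ = s⁻¹ * ((z / s) ^ 2 - 1) := by field_simp
  rw [h1, norm_mul, norm_mul, Real.norm_eq_abs, Real.norm_eq_abs, Real.norm_eq_abs,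
    abs_of_pos (phi_pos hs0 z), abs_of_pos (inv_pos.2 hs0)]
  have h2 : |(z / s) ^ 2 - 1| * Real.exp (-((z / s) ^ 2) / 2) ≤ 1 := by
    have a1 := sq_mul_exp_neg_le (z / s)
    have a2 : Real.exp (-((z / s) ^ 2) / 2) ≤ 1 := by
      apply Real.exp_le_one_iff.2; have : 0 ≤ (z / s) ^ 2 := by positivity
      linarith
    have a3 := Real.exp_pos (-((z / s) ^ 2) / 2)
    have a4 : 0 ≤ (z / s) ^ 2 := by positivity
    rcases abs_cases ((z / s) ^ 2 - 1) with h | h <;> rw [h.1] <;> nlinarith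
  calc phi s z * (s⁻¹ * |(z / s) ^ 2 - 1|)
      ≤ (s⁻¹ * Real.exp (-((z / s) ^ 2) / 2)) * (s⁻¹ * |(z / s) ^ 2 - 1|) := by
        gcongr; exact phi_le_exp hs0 z
    _ = s⁻¹ * s⁻¹ * (|(z / s) ^ 2 - 1| * Real.exp (-((z / s) ^ 2) / 2)) := by ring
    _ ≤ s⁻¹ * s⁻¹ * 1 := by gcongr
    _ = (s ^ 2)⁻¹ := by rw [mul_one, ← mul_inv, pow_two]
    _ ≤ (σ ^ 2)⁻¹ := by gcongr; exact hs

theorem abs_dphi_sub_le {σ s s' : ℝ} (hσ : 0 < σ) (hs : σ ≤ s) (hs' : σ ≤ s') (z : ℝ) :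
    |dphi s z - dphi s' z| ≤ 6 * (σ ^ 3)⁻¹ * |s - s'| := by
  refine (convex_Ici σ).norm_image_sub_le_of_norm_hasDerivWithin_le
    (f := fun s => dphi s z) (f' := fun s => phi s z * (3 * z / s ^ 3 - z ^ 3 / s ^ 5))
    (fun s hs => (hasDerivAt_dphi_scale (hσ.trans_le hs) z).hasDerivWithinAt) ?_ hs' hs
  intro s hs
  have hs0 : 0 < s := hσ.trans_le hs
  have h1 : 3 * z / s ^ 3 - z ^ 3 / s ^ 5 = (s ^ 2)⁻¹ * (3 * (z / s) - (z / s) ^ 3) := by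
    field_simp
  rw [h1, norm_mul, norm_mul, Real.norm_eq_abs, Real.norm_eq_abs, Real.norm_eq_abs,
    abs_of_pos (phi_pos hs0 z), abs_of_pos (inv_pos.2 (by positivity : 0 < s ^ 2))]
  have h2 : |3 * (z / s) - (z / s) ^ 3| * Real.exp (-((z / s) ^ 2) / 2) ≤ 6 := by
    have a1 := abs_mul_exp_neg_le (z / s)
    have a2 := abs_cube_mul_exp_neg_le (z / s)
    have a3 := Real.exp_pos (-((z / s) ^ 2) / 2)
    have a4 : |3 * (z / s) - (z / s) ^ 3| ≤ 3 * |z / s| + |z / s| ^ 3 := by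
      refine (abs_sub _ _).trans ?_
      rw [abs_mul, abs_pow]; norm_num
    nlinarith
  calc phi s z * ((s ^ 2)⁻¹ * |3 * (z / s) - (z / s) ^ 3|)
      ≤ (s⁻¹ * Real.exp (-((z / s) ^ 2) / 2)) * ((s ^ 2)⁻¹ * |3 * (z / s) - (z / s) ^ 3|) := by
        gcongr; exact phi_le_exp hs0 z
    _ = s⁻¹ * (s ^ 2)⁻¹ * (|3 * (z / s) - (z / s) ^ 3| * Real.exp (-((z / s) ^ 2) / 2)) := by
        ring
    _ ≤ s⁻¹ * (s ^ 2)⁻¹ * 6 := by gcongr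
    _ = 6 * (s ^ 3)⁻¹ := by rw [← mul_inv]; ring
    _ ≤ 6 * (σ ^ 3)⁻¹ := by gcongr; exact hs

/-! ### Gaussian integrals and convolutions -/

theorem phi_eq_gaussianPDFReal {s : ℝ} (hs : 0 < s) (m x : ℝ) :
    phi s (x - m) = gaussianPDFReal m (s ^ 2).toNNReal x := by
  unfold phi gaussianPDFReal
  rw [Real.coe_toNNReal _ (sq_nonneg s)]
  rw [Real.sqrt_mul (by positivity : (0 : ℝ) ≤ 2 * Real.pi), Real.sqrt_sq hs.le]

theorem integrable_phi {s : ℝ} (hs : 0 < s) (m : ℝ) : Integrable fun x => phi s (x - m) := by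
  simp_rw [phi_eq_gaussianPDFReal hs]
  exact integrable_gaussianPDFReal _ _

theorem integral_phi {s : ℝ} (hs : 0 < s) (m : ℝ) : ∫ x, phi s (x - m) = 1 := by
  simp_rw [phi_eq_gaussianPDFReal hs]
  exact integral_gaussianPDFReal_eq_one _ (by simp [hs.ne'])

theorem integral_mul_phi {s : ℝ} (hs : 0 < s) (m : ℝ) : ∫ x, x * phi s (x - m) = m := by
  have hv : (s ^ 2).toNNReal ≠ 0 := by simp [hs.ne']
  have h := integral_id_gaussianReal (μ := m) (v := (s ^ 2).toNNReal)
  rw [integral_gaussianReal_eq_integral_smul hv] at h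
  simp_rw [phi_eq_gaussianPDFReal hs]
  simpa [mul_comm] using h

/-- Completing the square in the product of two Gaussian kernels. -/
theorem phi_mul_phi {h s : ℝ} (hh : 0 < h) (hs : 0 < s) (x y m : ℝ) :
    phi (h * s) (x - y) * phi s (y - m) =
      phi (s * Real.sqrt (1 + h ^ 2)) (x - m) *
        phi (h * s / Real.sqrt (1 + h ^ 2)) (y - (x + h ^ 2 * m) / (1 + h ^ 2)) := by
  have hk : 0 < 1 + h ^ 2 := by positivity
  have hk' := Real.sqrt_pos.2 hk
  have hp := one_le_sqrt_two_pi
  have hp' : Real.sqrt (2 * Real.pi) ≠ 0 := by positivity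
  unfold phi
  have e1 : ∀ a b c d : ℝ, a * Real.exp b * (c * Real.exp d) = a * c * Real.exp (b + d) := by
    intros; rw [Real.exp_add]; ring
  rw [e1, e1]
  congr 1
  · field_simp
  · congr 1
    rw [div_pow, mul_pow s, Real.sq_sqrt hk.le]
    field_simp
    ring

/-- After completing the square one factor does not depend on `y` and the other integrates to 1.
Since the bandwidth `h * s` is proportional to the scale, smoothing only multiplies the scale by
`√(1 + h²)`. -/
theorem integral_phi_mul_phi {h s : ℝ} (hh : 0 < h) (hs : 0 < s) (x m : ℝ) :
    ∫ y, phi (h * s) (x - y) * phi s (y - m) = phi (s * Real.sqrt (1 + h ^ 2)) (x - m) := by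
  have hk : 0 < 1 + h ^ 2 := by positivity
  have hk' := Real.sqrt_pos.2 hk
  simp_rw [phi_mul_phi hh hs]
  rw [integral_const_mul, integral_phi (by positivity), mul_one]

/-- The value of the integral forces integrability: a non-integrable function has integral 0, so `m
= 0`; by translation the case `m = 1` would also fail, yet its integral is 1. -/
theorem integrable_mul_phi {s : ℝ} (hs : 0 < s) (m : ℝ) :
    Integrable fun x => x * phi s (x - m) := by
  by_contra hc
  have h := integral_mul_phi hs m
  have h1 := integral_mul_phi hs 1
  rw [integral_undef hc] at h
  subst h
  have hc' : ¬ Integrable fun x => x * phi s (x - 1) := by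
    intro hi
    apply hc
    have := (hi.comp_add_right 1).sub (integrable_phi hs 0)
    refine this.congr (ae_of_all _ fun x => ?_)
    simp
    ring
  rw [integral_undef hc'] at h1
  norm_num at h1

/-- The derivative brings down a factor linear in `y`, so the integral is a first moment of the
Gaussian left by completing the square. -/
theorem integral_dphi_mul_phi {h s : ℝ} (hh : 0 < h) (hs : 0 < s) (x m : ℝ) :
    ∫ y, dphi (h * s) (x - y) * phi s (y - m) = dphi (s * Real.sqrt (1 + h ^ 2)) (x - m) := by
  have hk : 0 < 1 + h ^ 2 := by positivity
  have hk' := Real.sqrt_pos.2 hk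
  have e : ∀ y, dphi (h * s) (x - y) * phi s (y - m) =
      phi (s * Real.sqrt (1 + h ^ 2)) (x - m) * ((h * s) ^ 2)⁻¹ *
      (y * phi (h * s / Real.sqrt (1 + h ^ 2)) (y - (x + h ^ 2 * m) / (1 + h ^ 2)) -
       x * phi (h * s / Real.sqrt (1 + h ^ 2)) (y - (x + h ^ 2 * m) / (1 + h ^ 2))) := by
    intro y
    have := phi_mul_phi hh hs x y m
    calc _ = (phi (h * s) (x - y) * phi s (y - m)) * ((h * s) ^ 2)⁻¹ * (y - x) := by
          unfold dphi; field_simp; ring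
      _ = _ := by rw [this]; ring
  simp_rw [e]
  rw [integral_const_mul, integral_sub (integrable_mul_phi (by positivity) _)
    ((integrable_phi (by positivity) _).const_mul _), integral_mul_phi (by positivity),
    integral_const_mul, integral_phi (by positivity)]
  unfold dphi
  rw [mul_pow s, Real.sq_sqrt hk.le]
  field_simp
  ring

/-! ### Kernel weights in the scale variable -/

section Weights

variable {n : ℕ} {b : ℝ} (σ : Fin n → ℝ) (i : Fin n)

include i in
theorem sum_phi_pos (hb : 0 < b) (s : ℝ) : 0 < ∑ k, phi b (s - σ k) :=
  Finset.sum_pos (fun _ _ => phi_pos hb _) ⟨i, Finset.mem_univ _⟩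

theorem weight_nonneg (hb : 0 < b) (s : ℝ) (j : Fin n) : 0 ≤ weight b σ s j :=
  div_nonneg (phi_pos hb _).le (Finset.sum_nonneg fun _ _ => (phi_pos hb _).le)

include i in
theorem sum_weight (hb : 0 < b) (s : ℝ) : ∑ j, weight b σ s j = 1 := by
  unfold weight
  rw [← Finset.sum_div, div_self (sum_phi_pos σ i hb s).ne']

theorem weight_le_self (hb : 0 < b) (j : Fin n) : weight b σ (σ i) j ≤ weight b σ (σ i) i := by
  unfold weight
  rw [sub_self]
  exact div_le_div_of_nonneg_right (phi_le_phi_zero hb _) (sum_phi_pos σ i hb _).le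

/-- The self-weight is the largest of `n` weights that sum to 1. -/
theorem inv_le_weight_self (hb : 0 < b) : (n : ℝ)⁻¹ ≤ weight b σ (σ i) i := by
  have hn : 0 < (n : ℝ) := by exact_mod_cast i.pos
  have h : (1 : ℝ) ≤ n * weight b σ (σ i) i := by
    rw [← sum_weight σ i hb (σ i)]
    refine (Finset.sum_le_sum fun j _ => weight_le_self σ i hb j).trans ?_
    simp
  rwa [inv_le_iff_one_le_mul₀' hn]

theorem weight_le_one (hb : 0 < b) (s : ℝ) (j : Fin n) : weight b σ s j ≤ 1 := by
  rw [← sum_weight σ j hb s]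
  exact Finset.single_le_sum (fun k _ => weight_nonneg σ hb s k) (Finset.mem_univ j)

theorem weight_eq_mul_exp (j : Fin n) :
    weight b σ (σ i) j =
      weight b σ (σ i) i * Real.exp (-(((σ i - σ j) / b) ^ 2) / 2) := by
  unfold weight
  rw [phi_eq b (σ i - σ j), phi_eq b (σ i - σ i)]
  simp
  ring

/-- Scales within `L * b` contribute at most `L * b` in total, and the Gaussian decay makes each
farther one negligible. Nothing is assumed on how the scales are spread, so atoms and gaps in their
law are allowed. -/
theorem sum_weight_mul_abs_le (hb : 0 < b) {L : ℝ} (hL : 0 ≤ L) :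
    ∑ j, weight b σ (σ i) j * |σ j - σ i| ≤ b * (L + 2 * (n * Real.exp (-(L ^ 2) / 4))) := by
  have h : ∀ j, weight b σ (σ i) j * |σ j - σ i| ≤
      b * (L * weight b σ (σ i) j + 2 * Real.exp (-(L ^ 2) / 4)) := by
    intro j
    have h0 : |σ j - σ i| = b * |(σ i - σ j) / b| := by
      rw [abs_div, abs_of_pos hb, abs_sub_comm]; field_simp
    have h1 := abs_mul_exp_neg_le_trunc ((σ i - σ j) / b) hL
    have h2 := weight_nonneg σ hb (σ i) i
    have h3 := weight_le_one σ hb (σ i) i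
    have h4 := Real.exp_pos (-(L ^ 2) / 4)
    rw [h0, weight_eq_mul_exp σ i j]
    calc _ = b * (weight b σ (σ i) i * (|(σ i - σ j) / b| *
            Real.exp (-(((σ i - σ j) / b) ^ 2) / 2))) := by ring
      _ ≤ b * (weight b σ (σ i) i * (L * Real.exp (-(((σ i - σ j) / b) ^ 2) / 2) +
            2 * Real.exp (-(L ^ 2) / 4))) := by gcongr
      _ ≤ _ := by
        have : weight b σ (σ i) i * (2 * Real.exp (-(L ^ 2) / 4)) ≤
          1 * (2 * Real.exp (-(L ^ 2) / 4)) := by gcongr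
        refine mul_le_mul_of_nonneg_left ?_ hb.le
        linarith
  refine (Finset.sum_le_sum fun j _ => h j).trans ?_
  rw [← Finset.mul_sum, Finset.sum_add_distrib, ← Finset.mul_sum, sum_weight σ i hb]
  simp
  gcongr b * (L + ?_)
  exact le_of_eq (by ring)

/-- The largest weight times the total weight: the self-weight plays the role of an inverse
effective sample size. -/
theorem sum_weight_sq_mul_le (hb : 0 < b) (S : Finset (Fin n)) :
    ∑ j ∈ S, weight b σ (σ i) j ^ 2 ≤ weight b σ (σ i) i := by
  calc ∑ j ∈ S, weight b σ (σ i) j ^ 2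
      ≤ ∑ j, weight b σ (σ i) j ^ 2 :=
        Finset.sum_le_sum_of_subset_of_nonneg (Finset.subset_univ _) fun _ _ _ => sq_nonneg _
    _ ≤ ∑ j, weight b σ (σ i) i * weight b σ (σ i) j := by
        refine Finset.sum_le_sum fun j _ => ?_
        rw [pow_two]
        exact mul_le_mul_of_nonneg_right (weight_le_self σ i hb j) (weight_nonneg σ hb _ j)
    _ = _ := by rw [← Finset.mul_sum, sum_weight σ i hb, mul_one]

/-- The self-weights add up to at most a multiple of the number of cells of width `b`. -/
theorem sum_weight_self_le (hb : 0 < b) {l u : ℝ} (hlu : l ≤ u)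
    (hσ : ∀ j, σ j ∈ Set.Icc l u) :
    ∑ i, weight b σ (σ i) i ≤ 2 * ((u - l) / b + 1) := by
  classical
  have hlu : 0 ≤ (u - l) / b := div_nonneg (by linarith) hb.le
  set c : Fin n → ℕ := fun j => ⌊(σ j - l) / b⌋₊ with hc
  have hmem : ∀ j ∈ (Finset.univ : Finset (Fin n)),
      c j ∈ Finset.range (⌊(u - l) / b⌋₊ + 1) := by
    intro j _
    rw [Finset.mem_range, Nat.lt_succ_iff]
    apply Nat.floor_le_floor
    gcongr
    exact (hσ j).2
  rw [← Finset.sum_fiberwise_of_maps_to hmem]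
  have hcell : ∀ k, ∑ j ∈ Finset.univ.filter (fun j => c j = k), weight b σ (σ j) j ≤ 2 := by
    intro k
    set T := Finset.univ.filter (fun j => c j = k) with hT
    rcases T.eq_empty_or_nonempty with hE | hE
    · rw [hE]; simp
    have hcard : 0 < (T.card : ℝ) := by exact_mod_cast hE.card_pos
    -- Two scales in one cell differ by at most `b`, and `exp(-1/2) ≥ 1/2`; so every member of the
    -- cell has weight at least half the self-weight of `j`. As the weights sum to 1, that
    -- self-weight is at most `2 / T.card`.
    have hw : ∀ j ∈ T, weight b σ (σ j) j ≤ 2 / T.card := by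
      intro j hj
      have h1 : ∀ k' ∈ T, weight b σ (σ j) j / 2 ≤ weight b σ (σ j) k' := by
        intro k' hk'
        rw [weight_eq_mul_exp σ j k', div_eq_mul_inv]
        refine mul_le_mul_of_nonneg_left ?_ (weight_nonneg σ hb _ _)
        have e1 : c j = c k' := by
          rw [(Finset.mem_filter.1 hj).2, (Finset.mem_filter.1 hk').2]
        have hx : ∀ j, 0 ≤ (σ j - l) / b := fun j =>
          div_nonneg (by linarith [(hσ j).1]) hb.le
        have f1 := Nat.floor_le (hx j)
        have f2 := Nat.lt_floor_add_one ((σ j - l) / b)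
        have f3 := Nat.floor_le (hx k')
        have f4 := Nat.lt_floor_add_one ((σ k' - l) / b)
        have e2 : (⌊(σ j - l) / b⌋₊ : ℝ) = ⌊(σ k' - l) / b⌋₊ := by exact_mod_cast e1
        have e3 : (σ j - σ k') / b = (σ j - l) / b - (σ k' - l) / b := by ring
        have e4 : ((σ j - σ k') / b) ^ 2 ≤ 1 := by
          rw [e3, sq_le_one_iff_abs_le_one, abs_le]; constructor <;> linarith
        have e5 := Real.add_one_le_exp (-(((σ j - σ k') / b) ^ 2) / 2)
        linarith
      have h2 : T.card * (weight b σ (σ j) j / 2) ≤ 1 := by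
        rw [← sum_weight σ j hb (σ j), ← nsmul_eq_mul, ← Finset.sum_const]
        refine (Finset.sum_le_sum h1).trans ?_
        exact Finset.sum_le_sum_of_subset_of_nonneg (Finset.subset_univ _)
          fun _ _ _ => weight_nonneg σ hb _ _
      rw [le_div_iff₀ hcard]
      linarith
    refine (Finset.sum_le_sum hw).trans ?_
    rw [Finset.sum_const, nsmul_eq_mul]
    field_simp
    rfl
  refine (Finset.sum_le_sum fun k _ => hcell k).trans ?_
  rw [Finset.sum_const, Finset.card_range, nsmul_eq_mul]
  have := Nat.floor_le hlu
  push_cast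
  linarith

end Weights

/-! ### The density estimate as a function of the selected observation -/

section LeaveOneOut

variable {n : ℕ} (h b : ℝ) (σ : Fin n → ℝ) (i : Fin n)

/-- The density estimate at scale `σ i` and at the `i`-th observation, as a function of the
other observations `y` and of the value `x` of the `i`-th one. -/
noncomputable def kde (y : Fin n → ℝ) (x : ℝ) : ℝ :=
  weight b σ (σ i) i * phi (h * σ i) 0 +
    ∑ j ∈ Finset.univ.erase i, weight b σ (σ i) j * phi (h * σ j) (x - y j)

/-- The derivative of `kde` in `x`. -/
noncomputable def dkde (y : Fin n → ℝ) (x : ℝ) : ℝ :=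
  ∑ j ∈ Finset.univ.erase i, weight b σ (σ i) j * dphi (h * σ j) (x - y j)

theorem fHat_update (y : Fin n → ℝ) (x : ℝ) :
    fHat h b (Function.update y i x) σ (σ i) x = kde h b σ i y x := by
  unfold fHat kde
  rw [← Finset.add_sum_erase _ _ (Finset.mem_univ i)]
  congr 1
  · simp
  · refine Finset.sum_congr rfl fun j hj => ?_
    rw [Function.update_of_ne (Finset.ne_of_mem_erase hj)]

theorem fHatDeriv_update (y : Fin n → ℝ) (x : ℝ) :
    fHatDeriv h b (Function.update y i x) σ (σ i) x = dkde h b σ i y x := by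
  unfold fHatDeriv dkde
  rw [← Finset.add_sum_erase _ _ (Finset.mem_univ i)]
  simp only [Function.update_self, sub_self, zero_div, mul_zero, zero_add]
  refine Finset.sum_congr rfl fun j hj => ?_
  rw [Function.update_of_ne (Finset.ne_of_mem_erase hj), dphi, neg_sub, mul_assoc]

theorem nest_update (y : Fin n → ℝ) (x : ℝ) :
    nest h b (Function.update y i x) σ i =
      x + σ i ^ 2 * (dkde h b σ i y x / kde h b σ i y x) := by
  unfold nest
  rw [Function.update_self, fHat_update, fHatDeriv_update]

/-- When the `i`-th observation moves, its own kernel moves with it and contributes a constant,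
matching the vanishing own term of the derivative estimate. So the estimated score at the `i`-th
observation is the logarithmic derivative of `kde` in `x`. -/
theorem hasDerivAt_kde (y : Fin n → ℝ) (x : ℝ) :
    HasDerivAt (kde h b σ i y) (dkde h b σ i y x) x := by
  unfold kde dkde
  refine HasDerivAt.const_add _ (HasDerivAt.fun_sum fun j _ => ?_)
  exact ((hasDerivAt_phi _ _).comp_sub_const x (y j)).const_mul _

@[fun_prop]
theorem continuous_kde {α : Type*} [TopologicalSpace α] {f : α → Fin n → ℝ} {g : α → ℝ}
    (hf : Continuous f) (hg : Continuous g) : Continuous fun a => kde h b σ i (f a) (g a) := by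
  unfold kde; fun_prop

@[fun_prop]
theorem continuous_dkde {α : Type*} [TopologicalSpace α] {f : α → Fin n → ℝ} {g : α → ℝ}
    (hf : Continuous f) (hg : Continuous g) : Continuous fun a => dkde h b σ i (f a) (g a) := by
  unfold dkde; fun_prop

variable {h b σ} {l u : ℝ}

theorem sum_weight_mul_le (hb : 0 < b) (S : Finset (Fin n)) {c : Fin n → ℝ} {K : ℝ} (hK : 0 ≤ K)
    (hc : ∀ j ∈ S, c j ≤ K) : ∑ j ∈ S, weight b σ (σ i) j * c j ≤ K := by
  calc _ ≤ ∑ j ∈ S, weight b σ (σ i) j * K :=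
        Finset.sum_le_sum fun j hj => mul_le_mul_of_nonneg_left (hc j hj) (weight_nonneg σ hb _ _)
    _ = (∑ j ∈ S, weight b σ (σ i) j) * K := by rw [Finset.sum_mul]
    _ ≤ 1 * K := by
        gcongr
        rw [← sum_weight σ i hb (σ i)]
        exact Finset.sum_le_sum_of_subset_of_nonneg (Finset.subset_univ _)
          fun _ _ _ => weight_nonneg σ hb _ _
    _ = K := one_mul K

variable (hh : 0 < h) (hb : 0 < b) (hl : 0 < l) (hσ : ∀ j, σ j ∈ Set.Icc l u)
include hh hb hl hσ

/-- Only the own kernel is kept, so the bound holds for all data and far out in the tails. -/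
theorem weight_le_kde (y : Fin n → ℝ) (x : ℝ) :
    weight b σ (σ i) i * (3 * (h * u))⁻¹ ≤ kde h b σ i y x := by
  have hs : ∀ j, 0 < σ j := fun j => hl.trans_le (hσ j).1
  have h1 : (3 * (h * u))⁻¹ ≤ phi (h * σ i) 0 := by
    refine le_trans ?_ (le_phi_zero (mul_pos hh (hs i)))
    have := hs i
    gcongr
    exact (hσ i).2
  have h2 : 0 ≤ ∑ j ∈ Finset.univ.erase i, weight b σ (σ i) j * phi (h * σ j) (x - y j) :=
    Finset.sum_nonneg fun j _ => mul_nonneg (weight_nonneg σ hb _ _)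
      (phi_pos (mul_pos hh (hs j)) _).le
  have h3 := mul_le_mul_of_nonneg_left h1 (weight_nonneg σ hb (σ i) i)
  unfold kde
  linarith

theorem inv_le_kde (y : Fin n → ℝ) (x : ℝ) : (3 * n * (h * u))⁻¹ ≤ kde h b σ i y x := by
  have hu : 0 < u := hl.trans_le ((hσ i).1.trans (hσ i).2)
  refine le_trans ?_ (weight_le_kde i hh hb hl hσ y x)
  calc (3 * n * (h * u))⁻¹ = (n : ℝ)⁻¹ * (3 * (h * u))⁻¹ := by rw [← mul_inv]; ring
    _ ≤ _ := mul_le_mul_of_nonneg_right (inv_le_weight_self σ i hb) (by positivity)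

theorem kde_pos (y : Fin n → ℝ) (x : ℝ) : 0 < kde h b σ i y x := by
  have hn : 0 < (n : ℝ) := by exact_mod_cast i.pos
  have hu : 0 < u := hl.trans_le ((hσ i).1.trans (hσ i).2)
  exact lt_of_lt_of_le (by positivity) (inv_le_kde i hh hb hl hσ y x)

theorem kde_le (y : Fin n → ℝ) (x : ℝ) : kde h b σ i y x ≤ (h * l)⁻¹ := by
  have hs : ∀ j, 0 < σ j := fun j => hl.trans_le (hσ j).1
  rw [← fHat_update, fHat]
  refine sum_weight_mul_le i hb _ (by positivity) fun j _ => ?_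
  refine (phi_le (mul_pos hh (hs j)) _).trans ?_
  gcongr
  exact (hσ j).1

theorem abs_dkde_le (y : Fin n → ℝ) (x : ℝ) : |dkde h b σ i y x| ≤ ((h * l) ^ 2)⁻¹ := by
  have hs : ∀ j, 0 < σ j := fun j => hl.trans_le (hσ j).1
  unfold dkde
  refine (Finset.abs_sum_le_sum_abs _ _).trans ?_
  simp_rw [abs_mul, abs_of_nonneg (weight_nonneg σ hb _ _)]
  refine sum_weight_mul_le i hb _ (by positivity) fun j _ => ?_
  refine (abs_dphi_le (mul_pos hh (hs j)) _).trans ?_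
  gcongr
  exact (hσ j).1

/-- The score of the density estimate grows no faster than `1 / h` up to logarithms, because the
observation itself is one of the kernel centres. -/
theorem abs_dkde_div_kde_le {L : ℝ} (hL : 0 ≤ L) (y : Fin n → ℝ) (x : ℝ) :
    |dkde h b σ i y x / kde h b σ i y x| ≤
      (h * l)⁻¹ * (L + 6 * (u / l) * (n * Real.exp (-(L ^ 2) / 4))) := by
  have hn : 0 < (n : ℝ) := by exact_mod_cast i.pos
  have hu : 0 < u := hl.trans_le ((hσ i).1.trans (hσ i).2)
  have hs : ∀ j, 0 < σ j := fun j => hl.trans_le (hσ j).1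
  have hk := kde_pos i hh hb hl hσ y x
  have hE := Real.exp_pos (-(L ^ 2) / 4)
  have h1 : ∀ j, |dphi (h * σ j) (x - y j)| ≤
      (h * l)⁻¹ * (L * phi (h * σ j) (x - y j) + (h * l)⁻¹ * (2 * Real.exp (-(L ^ 2) / 4))) := by
    intro j
    have hp := one_le_sqrt_two_pi
    have hsj := mul_pos hh (hs j)
    have hle : (h * σ j)⁻¹ ≤ (h * l)⁻¹ := by gcongr; exact (hσ j).1
    have h2 := abs_mul_exp_neg_le_trunc ((x - y j) / (h * σ j)) hL
    rw [abs_dphi_eq hsj]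
    calc _ ≤ (Real.sqrt (2 * Real.pi) * (h * σ j))⁻¹ * (h * σ j)⁻¹ *
          (L * Real.exp (-(((x - y j) / (h * σ j)) ^ 2) / 2) + 2 * Real.exp (-(L ^ 2) / 4)) := by
          gcongr
      _ = (h * σ j)⁻¹ * (L * phi (h * σ j) (x - y j) +
          (Real.sqrt (2 * Real.pi) * (h * σ j))⁻¹ * (2 * Real.exp (-(L ^ 2) / 4))) := by
          rw [phi_eq]; ring
      _ ≤ _ := by
          have := (phi_pos hsj (x - y j)).le
          have := (inv_sqrt_le hsj).trans hle
          refine mul_le_mul hle ?_ (by positivity) (by positivity)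
          exact add_le_add le_rfl (mul_le_mul_of_nonneg_right this (by positivity))
  have h2 : |dkde h b σ i y x| ≤ (h * l)⁻¹ *
      (L * kde h b σ i y x + (h * l)⁻¹ * (2 * Real.exp (-(L ^ 2) / 4))) := by
    -- Kernelwise, the derivative is at most `L / (h l)` times the kernel plus a remainder;
    -- averaging over the weights gives the same for `dkde` and `kde`.
    unfold dkde
    refine (Finset.abs_sum_le_sum_abs _ _).trans ?_
    simp_rw [abs_mul, abs_of_nonneg (weight_nonneg σ hb _ _)]
    refine (Finset.sum_le_sum fun j _ => mul_le_mul_of_nonneg_left (h1 j)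
      (weight_nonneg σ hb _ _)).trans ?_
    have h3 : ∑ j ∈ Finset.univ.erase i, weight b σ (σ i) j *
        ((h * l)⁻¹ * (2 * Real.exp (-(L ^ 2) / 4))) ≤
        (h * l)⁻¹ * (2 * Real.exp (-(L ^ 2) / 4)) :=
      sum_weight_mul_le i hb _ (by positivity) fun j _ => le_rfl
    have h4 : ∑ j ∈ Finset.univ.erase i, weight b σ (σ i) j * phi (h * σ j) (x - y j) ≤
        kde h b σ i y x := by
      have := mul_nonneg (weight_nonneg σ hb (σ i) i) (phi_pos (mul_pos hh (hs i)) 0).le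
      unfold kde; linarith
    calc _ = (h * l)⁻¹ * (L * ∑ j ∈ Finset.univ.erase i,
          weight b σ (σ i) j * phi (h * σ j) (x - y j) + ∑ j ∈ Finset.univ.erase i,
          weight b σ (σ i) j * ((h * l)⁻¹ * (2 * Real.exp (-(L ^ 2) / 4)))) := by
          rw [Finset.mul_sum, ← Finset.sum_add_distrib, Finset.mul_sum]
          refine Finset.sum_congr rfl fun j _ => ?_
          ring
      _ ≤ _ := by gcongr
  rw [abs_div, abs_of_pos hk, div_le_iff₀ hk]
  refine h2.trans ?_
  rw [mul_assoc]
  refine mul_le_mul_of_nonneg_left ?_ (by positivity)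
  rw [add_mul]
  refine add_le_add le_rfl ?_
  -- The remainder is made relative to `kde` through the lower bound `1 / (3 n h u)`, which produces
  -- the factor `6 (u / l) n`.
  have h5 := inv_le_kde i hh hb hl hσ y x
  calc (h * l)⁻¹ * (2 * Real.exp (-(L ^ 2) / 4)) =
      6 * (u / l) * (n * Real.exp (-(L ^ 2) / 4)) * (3 * n * (h * u))⁻¹ := by field_simp; norm_num
    _ ≤ _ := by gcongr

end LeaveOneOut

/-- Lower comparison of Gaussian kernels of nearby scales. -/
theorem mul_phi_le_phi {l u s s' k z : ℝ} (hl : 0 < l) (hs : s ∈ Set.Icc l u)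
    (hs' : s' ∈ Set.Icc l u) (hk : 1 ≤ k) (hk' : k ≤ 2) :
    l / (2 * u) * (1 - z ^ 2 * (u / l ^ 4) * |s' - s|) * phi s z ≤ phi (s' * k) z := by
  have hs0 : 0 < s := hl.trans_le hs.1
  have hs0' : 0 < s' := hl.trans_le hs'.1
  have hu : 0 < u := hs0.trans_le hs.2
  have hp := one_le_sqrt_two_pi
  have hk0 : 0 < k := by linarith
  have e1 : -(z ^ 2 * (u / l ^ 4) * |s' - s|) + -(z ^ 2) / (2 * s ^ 2) ≤
      -(z ^ 2) / (2 * (s' * k) ^ 2) := by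
    have a1 : 1 / s' ^ 2 - 1 / s ^ 2 ≤ 2 * (u / l ^ 4) * |s' - s| := by
      have : 1 / s' ^ 2 - 1 / s ^ 2 = (s + s') / (s ^ 2 * s' ^ 2) * (s - s') := by
        field_simp; ring
      rw [this]
      have b1 : (s + s') / (s ^ 2 * s' ^ 2) ≤ 2 * (u / l ^ 4) := by
        have : l ^ 4 ≤ s ^ 2 * s' ^ 2 := by
          calc l ^ 4 = l ^ 2 * l ^ 2 := by ring
            _ ≤ _ := by gcongr; exacts [hs.1, hs'.1]
        calc (s + s') / (s ^ 2 * s' ^ 2) ≤ (u + u) / l ^ 4 := by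
              gcongr; exacts [hs.2, hs'.2]
          _ = _ := by ring
      have b2 : s - s' ≤ |s' - s| := by rw [abs_sub_comm]; exact le_abs_self _
      calc _ ≤ (s + s') / (s ^ 2 * s' ^ 2) * |s' - s| := by gcongr
        _ ≤ _ := by gcongr
    -- Inflating the scale by `k ≥ 1` only helps in the exponent; its cost is in the normalising
    -- constant, bounded in `e3` by means of `k ≤ 2`.
    have a2 : 1 / (s' * k) ^ 2 ≤ 1 / s' ^ 2 := by
      apply one_div_le_one_div_of_le (by positivity)
      rw [mul_pow]
      have : 1 ≤ k ^ 2 := one_le_pow₀ hk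
      have : 0 < s' ^ 2 := by positivity
      nlinarith
    have a3 : 0 ≤ z ^ 2 := sq_nonneg z
    have c1 : -(z ^ 2) / (2 * s ^ 2) = -(z ^ 2 / 2 * (1 / s ^ 2)) := by field_simp
    have c2 : -(z ^ 2) / (2 * (s' * k) ^ 2) = -(z ^ 2 / 2 * (1 / (s' * k) ^ 2)) := by field_simp
    rw [c1, c2]
    nlinarith [mul_le_mul_of_nonneg_left (a2.trans (sub_le_iff_le_add.1 a1))
      (by positivity : 0 ≤ z ^ 2 / 2)]
  -- Linearising the exponential makes the lower bound affine in `|s' - s|`, so that it can be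
  -- averaged over the weights. It remains true, though trivial, when the affine factor is negative.
  have e2 := Real.add_one_le_exp (-(z ^ 2 * (u / l ^ 4) * |s' - s|))
  have e3 : l / (2 * u) * (Real.sqrt (2 * Real.pi) * s)⁻¹ ≤
      (Real.sqrt (2 * Real.pi) * (s' * k))⁻¹ := by
    have : l / (2 * u) * (Real.sqrt (2 * Real.pi) * s)⁻¹ =
        (Real.sqrt (2 * Real.pi) * (s * (2 * u) / l))⁻¹ := by field_simp
    rw [this]
    apply inv_anti₀ (by positivity)
    gcongr
    rw [le_div_iff₀ hl]
    calc s' * k * l ≤ u * 2 * s := by gcongr; exacts [hs'.2, hs.1]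
      _ = _ := by ring
  unfold phi
  calc _ ≤ l / (2 * u) * Real.exp (-(z ^ 2 * (u / l ^ 4) * |s' - s|)) *
        ((Real.sqrt (2 * Real.pi) * s)⁻¹ * Real.exp (-(z ^ 2) / (2 * s ^ 2))) := by
        gcongr; linarith
    _ = l / (2 * u) * (Real.sqrt (2 * Real.pi) * s)⁻¹ *
        Real.exp (-(z ^ 2 * (u / l ^ 4) * |s' - s|) + -(z ^ 2) / (2 * s ^ 2)) := by
        rw [Real.exp_add]; ring
    _ ≤ _ := by gcongr

/-! ### Gaussian mixtures with bounded means -/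

section Mixture

variable (G : Measure ℝ)

/-- Density of `m + s Z` with `m ∼ G` and `Z` standard normal. -/
noncomputable def mix (s x : ℝ) : ℝ := ∫ m, phi s (x - m) ∂G

/-- Derivative of the mixture density. -/
noncomputable def dmix (s x : ℝ) : ℝ := ∫ m, dphi s (x - m) ∂G

variable [IsProbabilityMeasure G]

theorem integrable_phi_sub {s : ℝ} (hs : 0 < s) (x : ℝ) : Integrable (fun m => phi s (x - m)) G :=
  Integrable.of_bound (by fun_prop) s⁻¹ (ae_of_all _ fun m => by
    rw [Real.norm_eq_abs, abs_of_pos (phi_pos hs _)]; exact phi_le hs _)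

theorem integrable_dphi_sub {s : ℝ} (hs : 0 < s) (x : ℝ) :
    Integrable (fun m => dphi s (x - m)) G :=
  Integrable.of_bound (by fun_prop) (s ^ 2)⁻¹ (ae_of_all _ fun m => abs_dphi_le hs _)

theorem mix_le {s : ℝ} (hs : 0 < s) (x : ℝ) : mix G s x ≤ s⁻¹ := by
  have := integral_mono (integrable_phi_sub G hs x) (integrable_const s⁻¹) fun m => phi_le hs _
  simpa [mix] using this

theorem abs_dmix_le {s : ℝ} (hs : 0 < s) (x : ℝ) : |dmix G s x| ≤ (s ^ 2)⁻¹ := by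
  have := norm_integral_le_of_norm_le_const (μ := G) (f := fun m => dphi s (x - m))
    (C := (s ^ 2)⁻¹) (ae_of_all _ fun m => abs_dphi_le hs _)
  simpa [dmix] using this

theorem hasDerivAt_mix {s : ℝ} (hs : 0 < s) (x : ℝ) : HasDerivAt (mix G s) (dmix G s x) x := by
  refine (hasDerivAt_integral_of_dominated_loc_of_deriv_le (μ := G)
    (F := fun x m => phi s (x - m)) (F' := fun x m => dphi s (x - m))
    (bound := fun _ => (s ^ 2)⁻¹) (x₀ := x) (s := Set.univ) univ_mem ?_
    (integrable_phi_sub G hs x) ?_ ?_ (integrable_const _) ?_).2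
  · exact Eventually.of_forall fun x => by fun_prop
  · fun_prop
  · exact ae_of_all _ fun m x _ => abs_dphi_le hs _
  · exact ae_of_all _ fun m x _ => (hasDerivAt_phi s (x - m)).comp_sub_const x m

theorem continuous_mix {s : ℝ} (hs : 0 < s) : Continuous (mix G s) :=
  continuous_iff_continuousAt.2 fun x => (hasDerivAt_mix G hs x).continuousAt

theorem continuous_dmix {s : ℝ} (hs : 0 < s) : Continuous (dmix G s) := by
  refine continuous_of_dominated (F := fun x m => dphi s (x - m)) (bound := fun _ => (s ^ 2)⁻¹)
    (fun x => by fun_prop) (fun x => ae_of_all _ fun m => abs_dphi_le hs _) (integrable_const _)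
    (ae_of_all _ fun m => by fun_prop)

theorem abs_mix_sub_le {σ s s' : ℝ} (hσ : 0 < σ) (hs : σ ≤ s) (hs' : σ ≤ s') (x : ℝ) :
    |mix G s x - mix G s' x| ≤ (σ ^ 2)⁻¹ * |s - s'| := by
  unfold mix
  rw [← integral_sub (integrable_phi_sub G (hσ.trans_le hs) x)
    (integrable_phi_sub G (hσ.trans_le hs') x)]
  have := norm_integral_le_of_norm_le_const (μ := G)
    (f := fun m => phi s (x - m) - phi s' (x - m))
    (ae_of_all _ fun m => abs_phi_sub_le hσ hs hs' (x - m))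
  simpa using this

theorem abs_dmix_sub_le {σ s s' : ℝ} (hσ : 0 < σ) (hs : σ ≤ s) (hs' : σ ≤ s') (x : ℝ) :
    |dmix G s x - dmix G s' x| ≤ 6 * (σ ^ 3)⁻¹ * |s - s'| := by
  unfold dmix
  rw [← integral_sub (integrable_dphi_sub G (hσ.trans_le hs) x)
    (integrable_dphi_sub G (hσ.trans_le hs') x)]
  have := norm_integral_le_of_norm_le_const (μ := G)
    (f := fun m => dphi s (x - m) - dphi s' (x - m))
    (ae_of_all _ fun m => abs_dphi_sub_le hσ hs hs' (x - m))
  simpa using this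

variable {G} {C : ℝ} (hG : ∀ᵐ m ∂G, |m| ≤ C)
include hG

theorem bound_nonneg : 0 ≤ C := by
  obtain ⟨m, hm⟩ := hG.exists
  exact (abs_nonneg m).trans hm

/-- Bounded means make the score of the mixture grow at most linearly. -/
theorem abs_dmix_le_mul_mix {s : ℝ} (hs : 0 < s) (x : ℝ) :
    |dmix G s x| ≤ (|x| + C) / s ^ 2 * mix G s x := by
  unfold dmix mix
  rw [← integral_const_mul, ← Real.norm_eq_abs]
  refine norm_integral_le_of_norm_le ((integrable_phi_sub G hs x).const_mul _) ?_
  filter_upwards [hG] with m hm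
  have := phi_pos hs (x - m)
  rw [dphi, norm_mul, Real.norm_eq_abs, abs_of_pos this, mul_comm, Real.norm_eq_abs, abs_div,
    abs_neg, abs_of_pos (by positivity : 0 < s ^ 2)]
  gcongr
  exact (abs_sub _ _).trans (by gcongr)

theorem integrable_mul_phi_sub {s : ℝ} (hs : 0 < s) (x : ℝ) :
    Integrable (fun m => m * phi s (x - m)) G := by
  refine Integrable.mono' ((integrable_phi_sub G hs x).const_mul C)
    (by fun_prop) ?_
  filter_upwards [hG] with m hm
  have := phi_pos hs (x - m)
  rw [norm_mul, Real.norm_eq_abs, Real.norm_eq_abs, abs_of_pos this]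
  gcongr

omit hG in
/-- The posterior mean formula `E(m | x) = x + s² f'(x) / f(x)`, before division by `f(x)`. -/
theorem integral_mul_phi_sub {s : ℝ} (hs : 0 < s) (x : ℝ) :
    ∫ m, m * phi s (x - m) ∂G = x * mix G s x + s ^ 2 * dmix G s x := by
  unfold mix dmix
  rw [← integral_const_mul, ← integral_const_mul, ← integral_add
    ((integrable_phi_sub G hs x).const_mul _) ((integrable_dphi_sub G hs x).const_mul _)]
  refine integral_congr_ae (ae_of_all _ fun m => ?_)
  simp only [dphi]
  field_simp
  ring

/-- After division by `mix G s x` this says that the posterior mean lies in `[-C, C]`; truncation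
therefore leaves it unchanged. -/
theorem abs_mul_mix_add_le {s : ℝ} (hs : 0 < s) (x : ℝ) :
    |x * mix G s x + s ^ 2 * dmix G s x| ≤ C * mix G s x := by
  rw [← integral_mul_phi_sub hs, mix, ← integral_const_mul,
    ← Real.norm_eq_abs]
  refine norm_integral_le_of_norm_le ((integrable_phi_sub G hs x).const_mul _) ?_
  filter_upwards [hG] with m hm
  have := phi_pos hs (x - m)
  rw [norm_mul, Real.norm_eq_abs, Real.norm_eq_abs, abs_of_pos this]
  gcongr

theorem le_mix {s : ℝ} (hs : 0 < s) (x : ℝ) :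
    (3 * s)⁻¹ * Real.exp (-(((|x| + C) / s) ^ 2) / 2) ≤ mix G s x := by
  have h : ∫ _, (3 * s)⁻¹ * Real.exp (-(((|x| + C) / s) ^ 2) / 2) ∂G ≤ mix G s x := by
    refine integral_mono_ae (integrable_const _) (integrable_phi_sub G hs x) ?_
    filter_upwards [hG] with m hm
    have hp := one_le_sqrt_two_pi
    have := sqrt_two_pi_le
    rw [phi_eq]
    have h2 : (3 * s)⁻¹ ≤ (Real.sqrt (2 * Real.pi) * s)⁻¹ := by gcongr
    have h3 : ((x - m) / s) ^ 2 ≤ ((|x| + C) / s) ^ 2 := by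
      rw [← sq_abs, abs_div, abs_of_pos hs]
      gcongr
      exact (abs_sub _ _).trans (by gcongr)
    refine mul_le_mul h2 (Real.exp_le_exp.2 (by linarith)) (by positivity) (by positivity)
  simpa using h

theorem mix_pos {s : ℝ} (hs : 0 < s) (x : ℝ) : 0 < mix G s x :=
  lt_of_lt_of_le (by positivity) (le_mix hG hs x)

/-- For `|x| ≥ 2 C` almost every mean is at distance at least `|x| / 2` from `x`. -/
theorem mix_le_exp {s : ℝ} (hs : 0 < s) {x : ℝ} (hx : 2 * C ≤ |x|) :
    mix G s x ≤ s⁻¹ * Real.exp (-(x ^ 2) / (8 * s ^ 2)) := by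
  have h : mix G s x ≤ ∫ _, s⁻¹ * Real.exp (-(x ^ 2) / (8 * s ^ 2)) ∂G := by
    refine integral_mono_ae (integrable_phi_sub G hs x) (integrable_const _) ?_
    filter_upwards [hG] with m hm
    refine (phi_le_exp hs _).trans ?_
    refine mul_le_mul_of_nonneg_left (Real.exp_le_exp.2 ?_) (by positivity)
    have h1 : |x| / 2 ≤ |x - m| := by
      have := abs_sub_abs_le_abs_sub x m
      linarith
    have h2 : (x / 2) ^ 2 ≤ (x - m) ^ 2 := by
      rw [← sq_abs (x - m), ← sq_abs (x / 2), abs_div, abs_of_pos (two_pos : (0 : ℝ) < 2)]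
      gcongr
    rw [div_pow, neg_div, neg_div, neg_le_neg_iff, div_div, div_le_div_iff₀ (by positivity)
      (by positivity)]
    have : 0 < s ^ 2 := by positivity
    nlinarith
  simpa using h

theorem abs_log_mix_le {l u s : ℝ} (hl : 0 < l) (hs : s ∈ Set.Icc l u) (x : ℝ) :
    |Real.log (mix G s x)| ≤ |Real.log l| + Real.log 3 + |Real.log u| + (|x| + C) ^ 2 / (2 * l ^ 2) := by
  have hs0 : 0 < s := hl.trans_le hs.1
  have h1 := Real.log_le_log (mix_pos hG hs0 x) (mix_le G hs0 x)
  have h2 := Real.log_le_log (by positivity) (le_mix hG hs0 x)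
  rw [Real.log_inv] at h1
  rw [Real.log_mul (by positivity) (by positivity), Real.log_exp, Real.log_inv,
    Real.log_mul (by norm_num) hs0.ne'] at h2
  have h3 := Real.log_le_log hl hs.1
  have h4 := Real.log_le_log hs0 hs.2
  have h5 : ((|x| + C) / s) ^ 2 / 2 ≤ (|x| + C) ^ 2 / (2 * l ^ 2) := by
    rw [div_pow, div_div, mul_comm]
    gcongr
    exact hs.1
  have h6 : 0 ≤ (|x| + C) ^ 2 / (2 * l ^ 2) := by positivity
  have h7 := Real.log_pos (by norm_num : (1 : ℝ) < 3)
  have h8 := neg_abs_le (Real.log l)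
  have h9 := le_abs_self (Real.log u)
  have h10 := abs_nonneg (Real.log l)
  have h11 := abs_nonneg (Real.log u)
  rw [abs_le]
  constructor <;> linarith

end Mixture

/-! ### The smoothed density and its bias -/

section Smoothed

variable (G : Measure ℝ) {n : ℕ} (h b : ℝ) (σ : Fin n → ℝ) (i : Fin n)

/-- Expectation of the density estimate given the scales. -/
noncomputable def smix (x : ℝ) : ℝ :=
  ∑ j, weight b σ (σ i) j * mix G (σ j * Real.sqrt (1 + h ^ 2)) x

/-- Derivative of `smix`. -/
noncomputable def dsmix (x : ℝ) : ℝ :=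
  ∑ j, weight b σ (σ i) j * dmix G (σ j * Real.sqrt (1 + h ^ 2)) x

variable [IsProbabilityMeasure G] {h b σ} {l u : ℝ}

theorem one_le_sqrt_one_add_sq (h : ℝ) : 1 ≤ Real.sqrt (1 + h ^ 2) := by
  rw [Real.one_le_sqrt]; nlinarith [sq_nonneg h]

theorem sqrt_one_add_sq_le (h : ℝ) : Real.sqrt (1 + h ^ 2) ≤ 1 + h ^ 2 := by
  rw [Real.sqrt_le_left (by positivity)]; nlinarith [sq_nonneg h]

theorem le_mul_sqrt_one_add_sq {s : ℝ} (hl : 0 < l) (hs : l ≤ s) :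
    l ≤ s * Real.sqrt (1 + h ^ 2) := by
  have := one_le_sqrt_one_add_sq h
  nlinarith

variable (hb : 0 < b) (hl : 0 < l) (hσ : ∀ j, σ j ∈ Set.Icc l u)
include hb hl hσ

omit [IsProbabilityMeasure G] in
-- There are two sources of bias for a function Lipschitz in the scale: the other scales differ from
-- `σ i`, and the bandwidth inflates each scale by `√(1 + h²) ≤ 1 + h²`.
theorem abs_sum_weight_sub_le {F : ℝ → ℝ} {K : ℝ} (hK : 0 ≤ K)
    (hF : ∀ s s', l ≤ s → l ≤ s' → |F s - F s'| ≤ K * |s - s'|) :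
    |∑ j, weight b σ (σ i) j * F (σ j * Real.sqrt (1 + h ^ 2)) - F (σ i)| ≤
      K * (∑ j, weight b σ (σ i) j * |σ j - σ i| + u * h ^ 2) := by
  have h0 : F (σ i) = ∑ j, weight b σ (σ i) j * F (σ i) := by
    rw [← Finset.sum_mul, sum_weight σ i hb, one_mul]
  have h1 : ∑ j, weight b σ (σ i) j * (u * h ^ 2) = u * h ^ 2 := by
    rw [← Finset.sum_mul, sum_weight σ i hb, one_mul]
  rw [h0, ← Finset.sum_sub_distrib]
  refine (Finset.abs_sum_le_sum_abs _ _).trans ?_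
  rw [← h1]
  rw [← Finset.sum_add_distrib, Finset.mul_sum]
  refine Finset.sum_le_sum fun j _ => ?_
  rw [← mul_sub, abs_mul, abs_of_nonneg (weight_nonneg σ hb _ _), ← mul_add, mul_left_comm]
  refine mul_le_mul_of_nonneg_left ?_ (weight_nonneg σ hb _ _)
  refine (hF _ _ (le_mul_sqrt_one_add_sq hl (hσ j).1) (hσ i).1).trans ?_
  refine mul_le_mul_of_nonneg_left ?_ hK
  have e : σ j * Real.sqrt (1 + h ^ 2) - σ i =
      (σ j - σ i) + σ j * (Real.sqrt (1 + h ^ 2) - 1) := by ring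
  rw [e]
  refine (abs_add_le _ _).trans (add_le_add le_rfl ?_)
  have h2 := one_le_sqrt_one_add_sq h
  have h3 := sqrt_one_add_sq_le h
  have h4 : 0 < σ j := hl.trans_le (hσ j).1
  rw [abs_of_nonneg (mul_nonneg h4.le (by linarith))]
  refine mul_le_mul (hσ j).2 (by linarith) (by linarith) (h4.le.trans (hσ j).2)

theorem abs_smix_sub_le (x : ℝ) :
    |smix G h b σ i x - mix G (σ i) x| ≤
      (l ^ 2)⁻¹ * (∑ j, weight b σ (σ i) j * |σ j - σ i| + u * h ^ 2) :=
  abs_sum_weight_sub_le i hb hl hσ (F := fun s => mix G s x) (by positivity)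
    fun _ _ hs hs' => abs_mix_sub_le G hl hs hs' x

theorem abs_dsmix_sub_le (x : ℝ) :
    |dsmix G h b σ i x - dmix G (σ i) x| ≤
      6 * (l ^ 3)⁻¹ * (∑ j, weight b σ (σ i) j * |σ j - σ i| + u * h ^ 2) :=
  abs_sum_weight_sub_le i hb hl hσ (F := fun s => dmix G s x) (by positivity)
    fun _ _ hs hs' => abs_dmix_sub_le G hl hs hs' x

variable {G} {C : ℝ} (hG : ∀ᵐ m ∂G, |m| ≤ C)
include hG

theorem abs_dsmix_le_mul_smix (x : ℝ) :
    |dsmix G h b σ i x| ≤ (|x| + C) / l ^ 2 * smix G h b σ i x := by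
  have hC := bound_nonneg hG
  unfold dsmix smix
  refine (Finset.abs_sum_le_sum_abs _ _).trans ?_
  rw [Finset.mul_sum]
  refine Finset.sum_le_sum fun j _ => ?_
  rw [abs_mul, abs_of_nonneg (weight_nonneg σ hb _ _), mul_left_comm]
  refine mul_le_mul_of_nonneg_left ?_ (weight_nonneg σ hb _ _)
  have hle := le_mul_sqrt_one_add_sq (h := h) hl (hσ j).1
  have hpos := hl.trans_le hle
  refine (abs_dmix_le_mul_mix hG hpos x).trans ?_
  have := (mix_pos hG hpos x).le
  gcongr

theorem smix_pos (x : ℝ) : 0 < smix G h b σ i x := by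
  have hn : 0 < (n : ℝ) := by exact_mod_cast i.pos
  have hpos : ∀ j, 0 < mix G (σ j * Real.sqrt (1 + h ^ 2)) x := fun j =>
    mix_pos hG (hl.trans_le (le_mul_sqrt_one_add_sq (h := h) hl (hσ j).1)) x
  refine Finset.sum_pos' (fun j _ => mul_nonneg (weight_nonneg σ hb _ _) (hpos j).le)
    ⟨i, Finset.mem_univ _, mul_pos ?_ (hpos i)⟩
  exact lt_of_lt_of_le (by positivity) (inv_le_weight_self σ i hb)

/-- A relative comparison, needed where the density is so small that the additive bias bound says
nothing. The kernels are compared pointwise by `mul_phi_le_phi` and averaged over the weights; `hZ`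
keeps the averaged affine factor at least `1/2`. -/
theorem mix_le_mul_smix {x Z : ℝ} (hh : |h| ≤ 1) (hx : |x| + C ≤ Z)
    (hZ : Z ^ 2 * (u / l ^ 4) * ∑ j, weight b σ (σ i) j * |σ j - σ i| ≤ 1 / 2) :
    mix G (σ i) x ≤ 4 * (u / l) * smix G h b σ i x := by
  have hu : 0 < u := hl.trans_le ((hσ i).1.trans (hσ i).2)
  have hi : 0 < σ i := hl.trans_le (hσ i).1
  have hk := one_le_sqrt_one_add_sq h
  have hk' : Real.sqrt (1 + h ^ 2) ≤ 2 := by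
    have := sqrt_one_add_sq_le h
    have : h ^ 2 ≤ 1 := by rwa [sq_le_one_iff_abs_le_one]
    linarith
  have h1 : ∀ j, l / (2 * u) * (1 - Z ^ 2 * (u / l ^ 4) * |σ j - σ i|) * mix G (σ i) x ≤
      mix G (σ j * Real.sqrt (1 + h ^ 2)) x := by
    intro j
    unfold mix
    rw [← integral_const_mul]
    refine integral_mono_ae ((integrable_phi_sub G hi x).const_mul _)
      (integrable_phi_sub G (hl.trans_le (le_mul_sqrt_one_add_sq hl (hσ j).1)) x) ?_
    filter_upwards [hG] with m hm
    refine le_trans ?_ (mul_phi_le_phi hl (hσ i) (hσ j) hk hk')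
    have := (phi_pos hi (x - m)).le
    have hz : (x - m) ^ 2 ≤ Z ^ 2 := by
      rw [← sq_abs]
      gcongr
      exact (abs_sub _ _).trans (by linarith)
    gcongr
  have h2 : l / (2 * u) * (1 - Z ^ 2 * (u / l ^ 4) * ∑ j, weight b σ (σ i) j * |σ j - σ i|) *
      mix G (σ i) x ≤ smix G h b σ i x := by
    unfold smix
    refine le_trans (le_of_eq ?_) (Finset.sum_le_sum fun j _ =>
      mul_le_mul_of_nonneg_left (h1 j) (weight_nonneg σ hb (σ i) j))
    have e : ∀ j, weight b σ (σ i) j * (l / (2 * u) * (1 - Z ^ 2 * (u / l ^ 4) * |σ j - σ i|) *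
        mix G (σ i) x) = l / (2 * u) * mix G (σ i) x * (weight b σ (σ i) j -
          Z ^ 2 * (u / l ^ 4) * (weight b σ (σ i) j * |σ j - σ i|)) := fun j => by ring
    simp_rw [e]
    rw [← Finset.mul_sum, Finset.sum_sub_distrib, ← Finset.mul_sum, sum_weight σ i hb]
    ring
  have h3 : l / (2 * u) * (1 / 2) * mix G (σ i) x ≤ smix G h b σ i x := by
    refine le_trans ?_ h2
    have := (mix_pos hG hi x).le
    gcongr
    linarith
  calc mix G (σ i) x = 4 * (u / l) * (l / (2 * u) * (1 / 2) * mix G (σ i) x) := by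
        field_simp; norm_num
    _ ≤ _ := by gcongr

end Smoothed

/-! ### Representing the data by scales, means and standard normal noise -/

section Representation

theorem map_affine_gaussianReal {s : ℝ} (m : ℝ) :
    (gaussianReal 0 1).map (fun z => m + s * z) = gaussianReal m (s ^ 2).toNNReal := by
  have h1 : (gaussianReal 0 1).map (fun z => m + s * z) =
      ((gaussianReal 0 1).map (s * ·)).map (m + ·) := by
    rw [Measure.map_map (by fun_prop) (by fun_prop)]; rfl
  rw [h1, gaussianReal_map_const_mul, gaussianReal_map_const_add]
  congr 1
  · simp
  · ext; simp [sq_nonneg]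

theorem lintegral_affine_gaussianReal {s : ℝ} (hs : 0 < s) (m : ℝ) {F : ℝ → ENNReal}
    (hF : Measurable F) :
    ∫⁻ z, F (m + s * z) ∂(gaussianReal 0 1) = ∫⁻ x, ENNReal.ofReal (phi s (x - m)) * F x := by
  have hv : (s ^ 2).toNNReal ≠ 0 := by simp [hs.ne']
  rw [← lintegral_map (f := F) hF (by fun_prop : Measurable fun z => m + s * z),
    map_affine_gaussianReal, gaussianReal_of_var_ne_zero _ hv,
    lintegral_withDensity_eq_lintegral_mul _ (measurable_gaussianPDF _ _) hF]
  refine lintegral_congr fun x => ?_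
  rw [Pi.mul_apply, gaussianPDF, phi_eq_gaussianPDFReal hs]

theorem integral_affine_gaussianReal {s : ℝ} (hs : 0 < s) (m : ℝ) {F : ℝ → ℝ}
    (hF : Measurable F) :
    ∫ z, F (m + s * z) ∂(gaussianReal 0 1) = ∫ x, F x * phi s (x - m) := by
  have hv : (s ^ 2).toNNReal ≠ 0 := by simp [hs.ne']
  rw [← integral_map (f := F) (φ := fun z => m + s * z) (by fun_prop) hF.aestronglyMeasurable,
    map_affine_gaussianReal, integral_gaussianReal_eq_integral_smul hv]
  refine integral_congr_ae (ae_of_all _ fun x => ?_)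
  simp only [smul_eq_mul]
  rw [phi_eq_gaussianPDFReal hs, mul_comm]

/-- Joint law of a mean and an independent standard normal noise variable. -/
noncomputable def noiseLaw (G : Measure ℝ) : Measure (ℝ × ℝ) := G.prod (gaussianReal 0 1)

variable (G Gσ : Measure ℝ) [IsProbabilityMeasure G] [IsProbabilityMeasure Gσ]

instance : IsProbabilityMeasure (noiseLaw G) := by unfold noiseLaw; infer_instance

omit [IsProbabilityMeasure G] in
theorem map_noiseLaw {s : ℝ} (hs : 0 < s) :
    (noiseLaw G).map (fun p => (p.1, p.1 + s * p.2)) =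
      (G.prod volume).withDensity fun p => ENNReal.ofReal (phi s (p.2 - p.1)) := by
  refine Measure.ext_of_lintegral _ fun F hF => ?_
  rw [lintegral_map hF (by fun_prop), noiseLaw, lintegral_prod _ (by fun_prop),
    lintegral_withDensity_eq_lintegral_mul _ (by fun_prop) hF, lintegral_prod _ (by fun_prop)]
  refine lintegral_congr fun m => ?_
  exact lintegral_affine_gaussianReal hs m (F := fun x => F (m, x)) (by fun_prop)

theorem integral_noiseLaw_comp {s : ℝ} (hs : 0 < s) {F : ℝ → ℝ} (hF : Measurable F)
    {K : ℝ} (hK : ∀ x, |F x| ≤ K) :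
    ∫ p, F (p.1 + s * p.2) ∂(noiseLaw G) = ∫ m, (∫ x, F x * phi s (x - m)) ∂G := by
  have hi : Integrable (fun p : ℝ × ℝ => F (p.1 + s * p.2)) (noiseLaw G) :=
    Integrable.of_bound (Measurable.aestronglyMeasurable (by fun_prop)) K
      (ae_of_all _ fun p => hK _)
  rw [noiseLaw] at hi ⊢
  rw [integral_prod _ hi]
  exact integral_congr_ae (ae_of_all _ fun m => integral_affine_gaussianReal hs m hF)

theorem integral_phi_noiseLaw {h s : ℝ} (hh : 0 < h) (hs : 0 < s) (x : ℝ) :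
    ∫ p, phi (h * s) (x - (p.1 + s * p.2)) ∂(noiseLaw G) =
      mix G (s * Real.sqrt (1 + h ^ 2)) x := by
  have hp := mul_pos hh hs
  rw [integral_noiseLaw_comp G hs (F := fun y => phi (h * s) (x - y)) (by fun_prop)
    (K := (h * s)⁻¹) fun y => by rw [abs_of_pos (phi_pos hp _)]; exact phi_le hp _]
  simp_rw [integral_phi_mul_phi hh hs]
  rfl

theorem integral_dphi_noiseLaw {h s : ℝ} (hh : 0 < h) (hs : 0 < s) (x : ℝ) :
    ∫ p, dphi (h * s) (x - (p.1 + s * p.2)) ∂(noiseLaw G) =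
      dmix G (s * Real.sqrt (1 + h ^ 2)) x := by
  have hp := mul_pos hh hs
  rw [integral_noiseLaw_comp G hs (F := fun y => dphi (h * s) (x - y)) (by fun_prop)
    (K := ((h * s) ^ 2)⁻¹) fun y => abs_dphi_le hp _]
  simp_rw [integral_dphi_mul_phi hh hs]
  rfl

variable {Gσ} in
-- For fixed `m` and `s > 0` the density integrates out `x = m + s z`; the rest is an exchange of
-- the integrals over `m` and `s`. The scale comes first so that conditioning on the scales becomes
-- Fubini.
theorem measurePreserving_tripleLaw (hpos : ∀ᵐ s ∂Gσ, 0 < s) :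
    MeasurePreserving (fun p : ℝ × ℝ × ℝ => (p.2.1, p.1, p.2.1 + p.1 * p.2.2))
      (Gσ.prod (noiseLaw G)) (tripleLaw G Gσ) := by
  refine ⟨by fun_prop, ?_⟩
  refine Measure.ext_of_lintegral _ fun F hF => ?_
  rw [lintegral_map hF (by fun_prop), tripleLaw,
    lintegral_withDensity_eq_lintegral_mul _ (by fun_prop) hF, lintegral_prod _ (by fun_prop),
    lintegral_prod _ (by fun_prop)]
  have h1 : ∀ m, ∫⁻ q : ℝ × ℝ, ENNReal.ofReal (phi q.1 (q.2 - m)) * F (m, q) ∂(Gσ.prod volume) =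
      ∫⁻ s, (∫⁻ x, ENNReal.ofReal (phi s (x - m)) * F (m, s, x)) ∂Gσ := fun m =>
    lintegral_prod _ (by fun_prop)
  simp only [Pi.mul_apply]
  simp_rw [h1]
  rw [lintegral_lintegral_swap (μ := G) (ν := Gσ)]
  · refine lintegral_congr_ae ?_
    filter_upwards [hpos] with s hs
    rw [noiseLaw, lintegral_prod _ (by fun_prop)]
    refine lintegral_congr fun m => ?_
    exact lintegral_affine_gaussianReal hs m (F := fun x => F (m, s, x)) (by fun_prop)
  · refine Measurable.aemeasurable ?_
    refine Measurable.lintegral_prod_right' (f := fun q : (ℝ × ℝ) × ℝ =>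
      ENNReal.ofReal (phi q.1.2 (q.2 - q.1.1)) * F (q.1.1, q.1.2, q.2)) ?_
    fun_prop

variable {Gσ} in
theorem isProbabilityMeasure_tripleLaw (hpos : ∀ᵐ s ∂Gσ, 0 < s) :
    IsProbabilityMeasure (tripleLaw G Gσ) := by
  have h := measurePreserving_tripleLaw G hpos
  rw [← h.map_eq]
  exact Measure.isProbabilityMeasure_map h.measurable.aemeasurable

/-- The data built from the scales `s` and from the pairs `e` of means and standard normals. -/
def assemble {n : ℕ} (p : (Fin n → ℝ) × (Fin n → ℝ × ℝ)) : Fin n → ℝ × ℝ × ℝ :=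
  fun j => ((p.2 j).1, p.1 j, (p.2 j).1 + p.1 j * (p.2 j).2)

variable {Gσ} in
theorem measurePreserving_assemble (n : ℕ) (hpos : ∀ᵐ s ∂Gσ, 0 < s) :
    MeasurePreserving assemble
      ((Measure.pi fun _ : Fin n => Gσ).prod (Measure.pi fun _ : Fin n => noiseLaw G))
      (dataLaw n G Gσ) := by
  have := isProbabilityMeasure_tripleLaw G hpos
  have h1 := (measurePreserving_arrowProdEquivProdArrow ℝ (ℝ × ℝ) (Fin n) (fun _ => Gσ)
    (fun _ => noiseLaw G)).symm
  have h2 := measurePreserving_pi (fun _ : Fin n => Gσ.prod (noiseLaw G))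
    (fun _ => tripleLaw G Gσ) (fun _ => measurePreserving_tripleLaw G hpos)
  exact h2.comp h1

end Representation

/-! ### Product measures: resampling and permuting coordinates -/

section Product

variable {α : Type*} [MeasurableSpace α] (P : Measure α) [IsProbabilityMeasure P]

/-- Replacing one coordinate of an i.i.d. sample by an independent copy. -/
theorem measurePreserving_update {n : ℕ} (i : Fin n) :
    MeasurePreserving (fun p : α × (Fin n → α) => Function.update p.2 i p.1)
      (P.prod (Measure.pi fun _ => P)) (Measure.pi fun _ => P) := by
  classical
  have hm : Measurable fun p : α × (Fin n → α) => Function.update p.2 i p.1 := by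
    refine measurable_pi_iff.2 fun j => ?_
    by_cases hj : j = i
    · subst hj; simpa using measurable_fst
    · simp only [Function.update_of_ne hj]; fun_prop
  refine ⟨hm, (Measure.pi_eq fun S hS => ?_).symm⟩
  rw [Measure.map_apply hm (MeasurableSet.univ_pi hS)]
  have : (fun p : α × (Fin n → α) => Function.update p.2 i p.1) ⁻¹' Set.univ.pi S =
      S i ×ˢ Set.univ.pi (Function.update S i Set.univ) := by
    ext p
    simp only [Set.mem_preimage, Set.mem_pi, Set.mem_univ, true_implies, Set.mem_prod]
    constructor
    · intro h
      refine ⟨by simpa using h i, fun j => ?_⟩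
      by_cases hj : j = i
      · subst hj; simp
      · simpa [Function.update_of_ne hj] using h j
    · rintro ⟨h1, h2⟩ j
      by_cases hj : j = i
      · subst hj; simpa using h1
      · simpa [Function.update_of_ne hj] using h2 j
  rw [this, Measure.prod_prod, Measure.pi_pi, ← Finset.mul_prod_erase _ _ (Finset.mem_univ i),
    ← Finset.mul_prod_erase _ _ (Finset.mem_univ i)]
  simp only [Function.update_self, measure_univ, one_mul]
  congr 1
  refine Finset.prod_congr rfl fun j hj => ?_
  rw [Function.update_of_ne (Finset.ne_of_mem_erase hj)]

/-- This allows the selected observation to be integrated first, with the other observations frozen.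
-/
theorem integral_pi_eq_integral_update {n : ℕ} (i : Fin n) {F : (Fin n → α) → ℝ}
    (hF : Integrable F (Measure.pi fun _ => P)) :
    ∫ D, F D ∂(Measure.pi fun _ => P) =
      ∫ D, ∫ d, F (Function.update D i d) ∂P ∂(Measure.pi fun _ => P) := by
  have h := measurePreserving_update P i
  have hi := h.integrable_comp_of_integrable hF
  have h1 := integral_map h.measurable.aemeasurable (f := F)
    (by rw [h.map_eq]; exact hF.aestronglyMeasurable)
  rw [h.map_eq] at h1
  rw [h1]
  exact integral_prod_symm _ hi

theorem measurePreserving_comp_equiv {n : ℕ} (e : Equiv.Perm (Fin n)) :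
    MeasurePreserving (fun D : Fin n → α => D ∘ e) (Measure.pi fun _ => P)
      (Measure.pi fun _ => P) := by
  have h := measurePreserving_piCongrLeft (fun _ : Fin n => P) e.symm
  convert! h using 1
  ext D j
  simp [MeasurableEquiv.coe_piCongrLeft, Equiv.piCongrLeft_apply]

end Product

/-! ### The mean of the self-weight -/

theorem weight_comp_perm {n : ℕ} (b : ℝ) (σ : Fin n → ℝ) (e : Equiv.Perm (Fin n)) (i : Fin n) :
    weight b (σ ∘ e) ((σ ∘ e) i) i = weight b σ (σ (e i)) (e i) := by
  unfold weight
  simp only [Function.comp]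
  rw [Equiv.sum_comp e fun k => phi b (σ (e i) - σ k)]

@[fun_prop]
theorem measurable_weight_self {n : ℕ} (b : ℝ) (i : Fin n) :
    Measurable fun σ : Fin n → ℝ => weight b σ (σ i) i := by
  unfold weight; fun_prop

theorem integrable_weight_self {n : ℕ} {b : ℝ} (hb : 0 < b) (i : Fin n)
    (ν : Measure (Fin n → ℝ)) [IsProbabilityMeasure ν] :
    Integrable (fun σ : Fin n → ℝ => weight b σ (σ i) i) ν :=
  Integrable.of_bound (measurable_weight_self b i).aestronglyMeasurable 1 (ae_of_all _ fun σ => by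
    rw [Real.norm_eq_abs, abs_of_nonneg (weight_nonneg σ hb _ _)]
    exact weight_le_one σ hb _ _)

theorem ae_pi_mem {Gσ : Measure ℝ} [IsProbabilityMeasure Gσ] {n : ℕ} {l u : ℝ}
    (hσ : ∀ᵐ s ∂Gσ, s ∈ Set.Icc l u) :
    ∀ᵐ σ ∂(Measure.pi fun _ : Fin n => Gσ), ∀ j, σ j ∈ Set.Icc l u := by
  rw [ae_all_iff]
  intro j
  exact (Measure.tendsto_eval_ae_ae (μ := fun _ : Fin n => Gσ) (i := j)).eventually hσ

/-- By exchangeability all `n` self-weights have the same mean, and their sum is bounded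
deterministically by counting cells. This replaces any regularity assumption on the law of the
scales. -/
theorem integral_weight_self_le (Gσ : Measure ℝ) [IsProbabilityMeasure Gσ] {n : ℕ} {b l u : ℝ}
    (hb : 0 < b) (hσ : ∀ᵐ s ∂Gσ, s ∈ Set.Icc l u) (i : Fin n) :
    ∫ σ, weight b σ (σ i) i ∂(Measure.pi fun _ : Fin n => Gσ) ≤
      2 * ((u - l) / b + 1) / n := by
  have hn : 0 < (n : ℝ) := by exact_mod_cast i.pos
  have hlu : l ≤ u := by
    obtain ⟨s, hs⟩ := hσ.exists
    exact hs.1.trans hs.2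
  have h1 : ∀ j, ∫ σ, weight b σ (σ j) j ∂(Measure.pi fun _ : Fin n => Gσ) =
      ∫ σ, weight b σ (σ i) i ∂(Measure.pi fun _ : Fin n => Gσ) := by
    intro j
    have h := measurePreserving_comp_equiv Gσ (Equiv.swap i j)
    nth_rewrite 2 [← h.map_eq]
    rw [integral_map h.measurable.aemeasurable
      (measurable_weight_self b i).aestronglyMeasurable]
    simp_rw [weight_comp_perm, Equiv.swap_apply_left]
  have h2 : n * ∫ σ, weight b σ (σ i) i ∂(Measure.pi fun _ : Fin n => Gσ) =
      ∫ σ, ∑ j, weight b σ (σ j) j ∂(Measure.pi fun _ : Fin n => Gσ) := by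
    rw [integral_finsetSum _ fun j _ => integrable_weight_self hb j _]
    simp [h1]
  have h3 : ∫ σ, ∑ j, weight b σ (σ j) j ∂(Measure.pi fun _ : Fin n => Gσ) ≤
      ∫ _, 2 * ((u - l) / b + 1) ∂(Measure.pi fun _ : Fin n => Gσ) := by
    refine integral_mono_ae (integrable_finsetSum _ fun j _ => integrable_weight_self hb j _)
      (integrable_const _) ?_
    filter_upwards [ae_pi_mem hσ] with σ h
    exact sum_weight_self_le σ hb hlu h
  rw [integral_const] at h3
  simp only [probReal_univ, smul_eq_mul, one_mul] at h3
  rw [le_div_iff₀ hn]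
  linarith

/-- Mean absolute deviation of a sum of independent bounded variables, through the variance. -/
theorem integral_abs_sum_sub_le {α : Type*} [MeasurableSpace α] (P : Measure α)
    [IsProbabilityMeasure P] {n : ℕ} (S : Finset (Fin n)) {k : Fin n → α → ℝ} {K : ℝ}
    (hk : ∀ j, Measurable (k j)) (hK : ∀ j a, |k j a| ≤ K) {θ : ℝ} (hθ : 0 < θ) :
    ∫ e, |∑ j ∈ S, (k j (e j) - ∫ a, k j a ∂P)| ∂(Measure.pi fun _ : Fin n => P) ≤
      θ + θ⁻¹ * ∑ j ∈ S, ∫ a, k j a ^ 2 ∂P := by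
  set ν := Measure.pi fun _ : Fin n => P with hν
  set X : Fin n → (Fin n → α) → ℝ := fun j e => k j (e j) with hX
  have hXm : ∀ j, Measurable (X j) := fun j => (hk j).comp (measurable_pi_apply j)
  have hmem : ∀ j, MemLp (X j) 2 ν := fun j =>
    MemLp.of_bound (hXm j).aestronglyMeasurable K (ae_of_all _ fun e => hK j _)
  have hint : ∀ j, Integrable (X j) ν := fun j => (hmem j).integrable (by norm_num)
  have heval : ∀ (j : Fin n) (g : α → ℝ), Measurable g →
      ∫ e, g (e j) ∂ν = ∫ a, g a ∂P := by
    intro j g hg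
    have h := measurePreserving_eval (fun _ : Fin n => P) j
    rw [← h.map_eq, integral_map h.measurable.aemeasurable hg.aestronglyMeasurable]
  have hmean : ∫ e, (∑ j ∈ S, X j) e ∂ν = ∑ j ∈ S, ∫ a, k j a ∂P := by
    simp_rw [Finset.sum_apply]
    rw [integral_finsetSum _ fun j _ => hint j]
    exact Finset.sum_congr rfl fun j _ => heval j _ (hk j)
  have hvar : Var[∑ j ∈ S, X j; ν] ≤ ∑ j ∈ S, ∫ a, k j a ^ 2 ∂P := by
    rw [IndepFun.variance_sum (fun j _ => hmem j) fun j _ j' _ hjj' =>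
      (iIndepFun_pi (μ := fun _ : Fin n => P) (X := k)
        fun j => (hk j).aemeasurable).indepFun hjj']
    refine Finset.sum_le_sum fun j _ => ?_
    refine (variance_le_expectation_sq (hmem j).aestronglyMeasurable).trans ?_
    exact (heval j (fun a => k j a ^ 2) ((hk j).pow_const 2)).le
  have hS : MemLp (∑ j ∈ S, X j) 2 ν := memLp_finsetSum' _ fun j _ => hmem j
  rw [variance_eq_integral hS.aestronglyMeasurable.aemeasurable, hmean] at hvar
  have hsq : Integrable (fun e => ((∑ j ∈ S, X j) e - ∑ j ∈ S, ∫ a, k j a ∂P) ^ 2) ν :=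
    (hS.sub (memLp_const _)).integrable_sq
  calc ∫ e, |∑ j ∈ S, (k j (e j) - ∫ a, k j a ∂P)| ∂ν
      ≤ ∫ e, (θ + θ⁻¹ * ((∑ j ∈ S, X j) e - ∑ j ∈ S, ∫ a, k j a ∂P) ^ 2) ∂ν := by
        refine integral_mono_of_nonneg (ae_of_all _ fun e => abs_nonneg _)
          ((integrable_const _).add (hsq.const_mul _)) (ae_of_all _ fun e => ?_)
        simp only [Finset.sum_sub_distrib, Finset.sum_apply, hX]
        generalize ∑ j ∈ S, k j (e j) - ∑ j ∈ S, ∫ a, k j a ∂P = v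
        -- From `2 |v| ≤ θ + v² / θ`. Unlike a square root of the variance, this bound is linear in
        -- the variance, hence in the self-weight, so that only the mean self-weight is needed
        -- later.
        have h1 : 0 ≤ θ⁻¹ * (|v| - θ) ^ 2 := by positivity
        have h2 : θ⁻¹ * (|v| - θ) ^ 2 = θ⁻¹ * v ^ 2 - 2 * |v| + θ := by
          rw [← sq_abs v]; field_simp; ring
        have h3 := abs_nonneg v
        linarith
    _ = θ + θ⁻¹ * ∫ e, ((∑ j ∈ S, X j) e - ∑ j ∈ S, ∫ a, k j a ∂P) ^ 2 ∂ν := by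
        rw [integral_add (integrable_const _) (hsq.const_mul _), integral_const_mul]
        simp
    _ ≤ _ := by gcongr

/-- The observations `m_j + s_j z_j`. -/
def obs {n : ℕ} (σ : Fin n → ℝ) (e : Fin n → ℝ × ℝ) : Fin n → ℝ :=
  fun j => (e j).1 + σ j * (e j).2

@[fun_prop]
theorem continuous_obs {n : ℕ} (σ : Fin n → ℝ) : Continuous (obs σ) := by
  unfold obs; fun_prop

/-! ### Stochastic error of the density estimate given the scales -/

section Noise

variable (G : Measure ℝ) [IsProbabilityMeasure G] {n : ℕ} {h b : ℝ} {σ : Fin n → ℝ} (i : Fin n)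
  {l u : ℝ} (hh : 0 < h) (hb : 0 < b) (hl : 0 < l)
  (hσ : ∀ j, σ j ∈ Set.Icc l u)
include hh hb hl hσ

theorem integrable_kde_obs (x : ℝ) :
    Integrable (fun e => kde h b σ i (obs σ e) x) (Measure.pi fun _ : Fin n => noiseLaw G) :=
  Integrable.of_bound (Continuous.aestronglyMeasurable (by fun_prop)) (h * l)⁻¹
    (ae_of_all _ fun e => by
      rw [Real.norm_eq_abs, abs_of_pos (kde_pos i hh hb hl hσ _ _)]
      exact kde_le i hh hb hl hσ _ _)

theorem integrable_dkde_obs (x : ℝ) :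
    Integrable (fun e => dkde h b σ i (obs σ e) x) (Measure.pi fun _ : Fin n => noiseLaw G) :=
  Integrable.of_bound (Continuous.aestronglyMeasurable (by fun_prop)) ((h * l) ^ 2)⁻¹
    (ae_of_all _ fun e => abs_dkde_le i hh hb hl hσ _ _)

/-- The hypothesis on `f ^ 2` reduces each second moment to the mean of `phi`, a mixture density
bounded by `l⁻¹`; the squared weights sum to at most the self-weight. It serves both `phi`, with `K
= (h l)⁻¹`, and `dphi`, with `K = ((h l) ^ 3)⁻¹`. -/
theorem sum_weighted_second_moment_le {f : ℝ → ℝ → ℝ} {K : ℝ} (hK : 0 ≤ K)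
    (hfK : ∀ j z, f (h * σ j) z ^ 2 ≤ K * phi (h * σ j) z) (S : Finset (Fin n)) (x : ℝ) :
    ∑ j ∈ S, ∫ p : ℝ × ℝ, (weight b σ (σ i) j * f (h * σ j) (x - (p.1 + σ j * p.2))) ^ 2
      ∂(noiseLaw G) ≤ weight b σ (σ i) i * (K * l⁻¹) := by
  have hs : ∀ j, 0 < σ j := fun j => hl.trans_le (hσ j).1
  have h1 : ∀ j, ∫ p : ℝ × ℝ, (weight b σ (σ i) j * f (h * σ j) (x - (p.1 + σ j * p.2))) ^ 2
      ∂(noiseLaw G) ≤ weight b σ (σ i) j ^ 2 * (K * l⁻¹) := by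
    intro j
    have hle := le_mul_sqrt_one_add_sq (h := h) hl (hσ j).1
    have hi : Integrable (fun p : ℝ × ℝ => phi (h * σ j) (x - (p.1 + σ j * p.2))) (noiseLaw G) :=
      Integrable.of_bound (Continuous.aestronglyMeasurable (by fun_prop)) (h * σ j)⁻¹
        (ae_of_all _ fun p => by
          rw [Real.norm_eq_abs, abs_of_pos (phi_pos (mul_pos hh (hs j)) _)]
          exact phi_le (mul_pos hh (hs j)) _)
    simp_rw [mul_pow]
    rw [integral_const_mul]
    refine mul_le_mul_of_nonneg_left ?_ (sq_nonneg _)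
    calc _ ≤ ∫ p : ℝ × ℝ, K * phi (h * σ j) (x - (p.1 + σ j * p.2)) ∂(noiseLaw G) :=
          integral_mono_of_nonneg (ae_of_all _ fun p => sq_nonneg _) (hi.const_mul _)
            (ae_of_all _ fun p => hfK j _)
      _ = K * mix G (σ j * Real.sqrt (1 + h ^ 2)) x := by
          rw [integral_const_mul, integral_phi_noiseLaw G hh (hs j)]
      _ ≤ K * l⁻¹ := by
          refine mul_le_mul_of_nonneg_left ?_ hK
          refine (mix_le G (hl.trans_le hle) x).trans ?_
          gcongr
  refine (Finset.sum_le_sum fun j _ => h1 j).trans ?_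
  rw [← Finset.sum_mul]
  refine mul_le_mul_of_nonneg_right (sum_weight_sq_mul_le σ i hb S) (by positivity)

theorem integral_abs_kde_sub_smix_le (hh1 : h ≤ 1) {θ : ℝ} (hθ : 0 < θ) (x : ℝ) :
    ∫ e, |kde h b σ i (obs σ e) x - smix G h b σ i x|
      ∂(Measure.pi fun _ : Fin n => noiseLaw G) ≤
      weight b σ (σ i) i * (h * l)⁻¹ + (θ + θ⁻¹ * (weight b σ (σ i) i * (h * l ^ 2)⁻¹)) := by
  have hs : ∀ j, 0 < σ j := fun j => hl.trans_le (hσ j).1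
  have hw := weight_nonneg σ hb (σ i)
  have hle : ∀ j, (h * σ j)⁻¹ ≤ (h * l)⁻¹ := fun j => by gcongr; exact (hσ j).1
  set k : Fin n → ℝ × ℝ → ℝ := fun j p =>
    weight b σ (σ i) j * phi (h * σ j) (x - (p.1 + σ j * p.2)) with hk
  have hkm : ∀ j, Measurable (k j) := fun j => by simp only [hk]; fun_prop
  have hkK : ∀ j p, |k j p| ≤ (h * l)⁻¹ := by
    intro j p
    have hp := phi_pos (mul_pos hh (hs j)) (x - (p.1 + σ j * p.2))
    simp only [hk]
    rw [abs_of_nonneg (mul_nonneg (hw j) hp.le)]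
    calc _ ≤ 1 * (h * l)⁻¹ := mul_le_mul (weight_le_one σ hb _ j)
          ((phi_le (mul_pos hh (hs j)) _).trans (hle j)) hp.le zero_le_one
      _ = _ := one_mul _
  have hkint : ∀ j, ∫ p, k j p ∂(noiseLaw G) =
      weight b σ (σ i) j * mix G (σ j * Real.sqrt (1 + h ^ 2)) x := fun j => by
    simp only [hk]; rw [integral_const_mul, integral_phi_noiseLaw G hh (hs j)]
  -- The own kernel is deterministic and not centred at its mean in `smix`; it is split off, and the
  -- rest is a centred sum of independent terms.
  have hdec : ∀ e : Fin n → ℝ × ℝ, kde h b σ i (obs σ e) x - smix G h b σ i x =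
      weight b σ (σ i) i * (phi (h * σ i) 0 - mix G (σ i * Real.sqrt (1 + h ^ 2)) x) +
      ∑ j ∈ Finset.univ.erase i, (k j (e j) - ∫ p, k j p ∂(noiseLaw G)) := by
    intro e
    simp_rw [hkint]
    rw [Finset.sum_sub_distrib, kde, smix, ← Finset.add_sum_erase _ _ (Finset.mem_univ i)]
    simp only [hk, obs]
    ring
  have hself : |weight b σ (σ i) i * (phi (h * σ i) 0 -
      mix G (σ i * Real.sqrt (1 + h ^ 2)) x)| ≤ weight b σ (σ i) i * (h * l)⁻¹ := by
    rw [abs_mul, abs_of_nonneg (hw i)]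
    refine mul_le_mul_of_nonneg_left ?_ (hw i)
    have hpos := hl.trans_le (le_mul_sqrt_one_add_sq (h := h) hl (hσ i).1)
    have a1 : 0 ≤ mix G (σ i * Real.sqrt (1 + h ^ 2)) x :=
      integral_nonneg fun m => (phi_pos hpos _).le
    have a2 : mix G (σ i * Real.sqrt (1 + h ^ 2)) x ≤ (h * l)⁻¹ := by
      refine (mix_le G hpos x).trans ?_
      refine inv_anti₀ (by positivity) ?_
      refine le_trans ?_ (le_mul_sqrt_one_add_sq (h := h) hl (hσ i).1)
      nlinarith
    have a3 := (phi_pos (mul_pos hh (hs i)) 0).le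
    have a4 := (phi_zero_le (mul_pos hh (hs i))).trans (hle i)
    rw [abs_le]; constructor <;> linarith
  have hsum := integral_abs_sum_sub_le (noiseLaw G) (Finset.univ.erase i) hkm hkK hθ
  have hmom := sum_weighted_second_moment_le G i hh hb hl hσ (f := phi) (K := (h * l)⁻¹)
    (by positivity) (fun j z => (phi_sq_le (mul_pos hh (hs j)) z).trans
      (mul_le_mul_of_nonneg_right (hle j) (phi_pos (mul_pos hh (hs j)) z).le))
    (Finset.univ.erase i) x
  have hi : Integrable (fun e : Fin n → ℝ × ℝ => |∑ j ∈ Finset.univ.erase i,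
      (k j (e j) - ∫ p, k j p ∂(noiseLaw G))|) (Measure.pi fun _ : Fin n => noiseLaw G) := by
    refine (integrable_finsetSum _ fun j _ => Integrable.sub ?_ (integrable_const _)).abs
    exact Integrable.of_bound ((hkm j).comp (measurable_pi_apply j)).aestronglyMeasurable
      (h * l)⁻¹ (ae_of_all _ fun e => hkK j _)
  calc _ ≤ ∫ e : Fin n → ℝ × ℝ, (weight b σ (σ i) i * (h * l)⁻¹ + |∑ j ∈ Finset.univ.erase i,
        (k j (e j) - ∫ p, k j p ∂(noiseLaw G))|) ∂(Measure.pi fun _ : Fin n => noiseLaw G) := by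
        refine integral_mono_of_nonneg (ae_of_all _ fun e => abs_nonneg _)
          ((integrable_const _).add hi) (ae_of_all _ fun e => ?_)
        simp only [hdec e]
        exact (abs_add_le _ _).trans (add_le_add hself le_rfl)
    _ = weight b σ (σ i) i * (h * l)⁻¹ + ∫ e : Fin n → ℝ × ℝ, |∑ j ∈ Finset.univ.erase i,
        (k j (e j) - ∫ p, k j p ∂(noiseLaw G))| ∂(Measure.pi fun _ : Fin n => noiseLaw G) := by
        rw [integral_add (integrable_const _) hi]; simp
    _ ≤ _ := by
        refine add_le_add le_rfl (hsum.trans (add_le_add le_rfl ?_))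
        refine mul_le_mul_of_nonneg_left (hmom.trans (le_of_eq ?_)) (by positivity)
        rw [← mul_inv]; ring_nf

theorem integral_abs_dkde_sub_dsmix_le {θ : ℝ} (hθ : 0 < θ) (x : ℝ) :
    ∫ e, |dkde h b σ i (obs σ e) x - dsmix G h b σ i x|
      ∂(Measure.pi fun _ : Fin n => noiseLaw G) ≤
      weight b σ (σ i) i * (l ^ 2)⁻¹ + (θ + θ⁻¹ * (weight b σ (σ i) i * (h ^ 3 * l ^ 4)⁻¹)) := by
  have hs : ∀ j, 0 < σ j := fun j => hl.trans_le (hσ j).1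
  have hw := weight_nonneg σ hb (σ i)
  have hle : ∀ j (q : ℕ), ((h * σ j) ^ q)⁻¹ ≤ ((h * l) ^ q)⁻¹ := fun j q => by
    gcongr; exact (hσ j).1
  set k : Fin n → ℝ × ℝ → ℝ := fun j p =>
    weight b σ (σ i) j * dphi (h * σ j) (x - (p.1 + σ j * p.2)) with hk
  have hkm : ∀ j, Measurable (k j) := fun j => by simp only [hk]; fun_prop
  have hkK : ∀ j p, |k j p| ≤ ((h * l) ^ 2)⁻¹ := by
    intro j p
    simp only [hk]
    rw [abs_mul, abs_of_nonneg (hw j)]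
    calc _ ≤ 1 * ((h * l) ^ 2)⁻¹ := mul_le_mul (weight_le_one σ hb _ j)
          ((abs_dphi_le (mul_pos hh (hs j)) _).trans (hle j 2)) (abs_nonneg _) zero_le_one
      _ = _ := one_mul _
  have hkint : ∀ j, ∫ p, k j p ∂(noiseLaw G) =
      weight b σ (σ i) j * dmix G (σ j * Real.sqrt (1 + h ^ 2)) x := fun j => by
    simp only [hk]; rw [integral_const_mul, integral_dphi_noiseLaw G hh (hs j)]
  -- Here the own term of `dkde` is absent, so only its counterpart in `dsmix` is left, without any
  -- inverse power of `h`.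
  have hdec : ∀ e : Fin n → ℝ × ℝ, dkde h b σ i (obs σ e) x - dsmix G h b σ i x =
      -(weight b σ (σ i) i * dmix G (σ i * Real.sqrt (1 + h ^ 2)) x) +
      ∑ j ∈ Finset.univ.erase i, (k j (e j) - ∫ p, k j p ∂(noiseLaw G)) := by
    intro e
    simp_rw [hkint]
    rw [Finset.sum_sub_distrib, dkde, dsmix, ← Finset.add_sum_erase _ _ (Finset.mem_univ i)]
    simp only [hk, obs]
    ring
  have hself : |-(weight b σ (σ i) i * dmix G (σ i * Real.sqrt (1 + h ^ 2)) x)| ≤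
      weight b σ (σ i) i * (l ^ 2)⁻¹ := by
    have hle' := le_mul_sqrt_one_add_sq (h := h) hl (hσ i).1
    rw [abs_neg, abs_mul, abs_of_nonneg (hw i)]
    refine mul_le_mul_of_nonneg_left ?_ (hw i)
    refine (abs_dmix_le G (hl.trans_le hle') x).trans ?_
    gcongr
  have hsum := integral_abs_sum_sub_le (noiseLaw G) (Finset.univ.erase i) hkm hkK hθ
  have hmom := sum_weighted_second_moment_le G i hh hb hl hσ (f := dphi) (K := ((h * l) ^ 3)⁻¹)
    (by positivity) (fun j z => (dphi_sq_le (mul_pos hh (hs j)) z).trans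
      (mul_le_mul_of_nonneg_right (hle j 3) (phi_pos (mul_pos hh (hs j)) z).le))
    (Finset.univ.erase i) x
  have hi : Integrable (fun e : Fin n → ℝ × ℝ => |∑ j ∈ Finset.univ.erase i,
      (k j (e j) - ∫ p, k j p ∂(noiseLaw G))|) (Measure.pi fun _ : Fin n => noiseLaw G) := by
    refine (integrable_finsetSum _ fun j _ => Integrable.sub ?_ (integrable_const _)).abs
    exact Integrable.of_bound ((hkm j).comp (measurable_pi_apply j)).aestronglyMeasurable
      ((h * l) ^ 2)⁻¹ (ae_of_all _ fun e => hkK j _)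
  calc _ ≤ ∫ e : Fin n → ℝ × ℝ, (weight b σ (σ i) i * (l ^ 2)⁻¹ + |∑ j ∈ Finset.univ.erase i,
        (k j (e j) - ∫ p, k j p ∂(noiseLaw G))|) ∂(Measure.pi fun _ : Fin n => noiseLaw G) := by
        refine integral_mono_of_nonneg (ae_of_all _ fun e => abs_nonneg _)
          ((integrable_const _).add hi) (ae_of_all _ fun e => ?_)
        simp only [hdec e]
        exact (abs_add_le _ _).trans (add_le_add hself le_rfl)
    _ = weight b σ (σ i) i * (l ^ 2)⁻¹ + ∫ e : Fin n → ℝ × ℝ, |∑ j ∈ Finset.univ.erase i,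
        (k j (e j) - ∫ p, k j p ∂(noiseLaw G))| ∂(Measure.pi fun _ : Fin n => noiseLaw G) := by
        rw [integral_add (integrable_const _) hi]; simp
    _ ≤ _ := by
        refine add_le_add le_rfl (hsum.trans (add_le_add le_rfl ?_))
        refine mul_le_mul_of_nonneg_left (hmom.trans (le_of_eq ?_)) (by positivity)
        rw [← mul_inv]; ring_nf

end Noise

/-! ### Comparison of scores by integration by parts -/

/-- If `a ≥ f / 2`, the logarithm is Lipschitz at scale `1 / f`, which the factor `f` cancels. If `a
< f / 2`, then `f ≤ 2 |a - f|` and the crude bound `c` suffices. No lower bound on `f` enters except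
through `c`. -/
theorem mul_abs_log_sub_log_le {a f c : ℝ} (ha : 0 < a) (hf : 0 < f)
    (hc : |Real.log a - Real.log f| ≤ c) :
    f * |Real.log a - Real.log f| ≤ 2 * (1 + c) * |a - f| := by
  have hc0 : 0 ≤ c := (abs_nonneg _).trans hc
  rcases le_or_gt (f / 2) a with h | h
  · have h1 : Real.log a - Real.log f ≤ a / f - 1 := by
      rw [← Real.log_div ha.ne' hf.ne']; exact Real.log_le_sub_one_of_pos (by positivity)
    have h2 : Real.log f - Real.log a ≤ f / a - 1 := by
      rw [← Real.log_div hf.ne' ha.ne']; exact Real.log_le_sub_one_of_pos (by positivity)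
    have h3 : f * |Real.log a - Real.log f| ≤ 2 * |a - f| := by
      rcases le_total f a with hfa | hfa
      · have : 0 ≤ Real.log a - Real.log f := sub_nonneg.2 (Real.log_le_log hf hfa)
        rw [abs_of_nonneg this, abs_of_nonneg (sub_nonneg.2 hfa)]
        calc _ ≤ f * (a / f - 1) := by gcongr
          _ = a - f := by field_simp
          _ ≤ _ := by linarith
      · have : Real.log a - Real.log f ≤ 0 := sub_nonpos.2 (Real.log_le_log ha hfa)
        rw [abs_of_nonpos this, abs_of_nonpos (sub_nonpos.2 hfa)]
        calc f * -(Real.log a - Real.log f) ≤ f * (f / a - 1) := by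
              gcongr; linarith
          _ = f / a * (f - a) := by field_simp
          _ ≤ 2 * (f - a) := by
              refine mul_le_mul_of_nonneg_right ?_ (by linarith)
              rw [div_le_iff₀ ha]; linarith
          _ = _ := by ring
    have := mul_nonneg hc0 (abs_nonneg (a - f))
    nlinarith
  · have h1 : f / 2 ≤ |a - f| := by
      rw [abs_of_neg (by linarith)]; linarith
    calc f * |Real.log a - Real.log f| ≤ f * c := by gcongr
      _ = 2 * c * (f / 2) := by ring
      _ ≤ 2 * c * |a - f| := by gcongr
      _ ≤ _ := by
        have := abs_nonneg (a - f)
        nlinarith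

/-- Integration by parts: the integral of `f` times a difference of scores is controlled by the
difference of the densities. -/
theorem abs_integral_score_sub_le {A A' f f' : ℝ → ℝ} {t R c M : ℝ} (htR : t ≤ R)
    (hA : ∀ x, 0 < A x) (hf : ∀ x, 0 < f x) (hA' : ∀ x, HasDerivAt A (A' x) x)
    (hf' : ∀ x, HasDerivAt f (f' x) x) (hAc : Continuous A') (hfc : Continuous f')
    (hM : 0 ≤ M)
    (hc : ∀ x ∈ Set.Icc t R, |Real.log (A x) - Real.log (f x)| ≤ c)
    (hfM : ∀ x ∈ Set.Icc t R, |f' x| ≤ M * f x) :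
    |∫ x in Set.Ioc t R, (A' x / A x * f x - f' x)| ≤
      2 * (1 + c) * (|A t - f t| + |A R - f R| + M * ∫ x in Set.Ioc t R, |A x - f x|) := by
  have hAct : Continuous A := continuous_iff_continuousAt.2 fun x => (hA' x).continuousAt
  have hfct : Continuous f := continuous_iff_continuousAt.2 fun x => (hf' x).continuousAt
  set g : ℝ → ℝ := fun x => Real.log (A x) - Real.log (f x) with hg
  have hgct : Continuous g :=
    (hAct.log fun x => (hA x).ne').sub (hfct.log fun x => (hf x).ne')
  have hsc : Continuous fun x => A' x / A x * f x - f' x :=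
    ((hAc.div hAct fun x => (hA x).ne').mul hfct).sub hfc
  -- The primitive is `f * log (A / f)`: differentiating the logarithm yields the score difference,
  -- and differentiating `f` yields a term without derivatives of `A`.
  have hfg : ∀ x, HasDerivAt (fun x => f x * g x)
      (f' x * g x + (A' x / A x * f x - f' x)) x := by
    intro x
    refine ((hf' x).mul (((hA' x).log (hA x).ne').sub ((hf' x).log (hf x).ne'))).congr_deriv ?_
    have := (hf x).ne'
    simp only [hg, Pi.sub_apply]
    field_simp
  have hfg' : Continuous fun x => f' x * g x := hfc.mul hgct
  have h1 : ∫ x in t..R, (f' x * g x + (A' x / A x * f x - f' x)) = f R * g R - f t * g t :=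
    intervalIntegral.integral_eq_sub_of_hasDerivAt (fun x _ => hfg x)
      ((hfg'.add hsc).intervalIntegrable _ _)
  rw [intervalIntegral.integral_add (hfg'.intervalIntegrable _ _)
    (hsc.intervalIntegrable _ _), intervalIntegral.integral_of_le htR,
    intervalIntegral.integral_of_le htR] at h1
  have hpt : ∀ x ∈ Set.Icc t R, f x * |g x| ≤ 2 * (1 + c) * |A x - f x| := fun x hx =>
    mul_abs_log_sub_log_le (hA x) (hf x) (hc x hx)
  have h2 : |∫ x in Set.Ioc t R, f' x * g x| ≤
      ∫ x in Set.Ioc t R, M * (2 * (1 + c)) * |A x - f x| := by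
    rw [← Real.norm_eq_abs]
    refine norm_integral_le_of_norm_le ?_ ?_
    · exact ((continuous_const.mul (hAct.sub hfct).abs).integrableOn_Icc).mono_set
        Set.Ioc_subset_Icc_self
    · refine (ae_restrict_iff' measurableSet_Ioc).2 (ae_of_all _ fun x hx => ?_)
      have hx' := Set.Ioc_subset_Icc_self hx
      rw [norm_mul, Real.norm_eq_abs, Real.norm_eq_abs]
      calc |f' x| * |g x| ≤ M * f x * |g x| := by gcongr; exact hfM x hx'
        _ = M * (f x * |g x|) := by ring
        _ ≤ M * (2 * (1 + c) * |A x - f x|) := mul_le_mul_of_nonneg_left (hpt x hx') hM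
        _ = _ := by ring
  rw [integral_const_mul] at h2
  have h3 : |f R * g R| ≤ 2 * (1 + c) * |A R - f R| := by
    rw [abs_mul, abs_of_pos (hf R)]; exact hpt R ⟨htR, le_rfl⟩
  have h4 : |f t * g t| ≤ 2 * (1 + c) * |A t - f t| := by
    rw [abs_mul, abs_of_pos (hf t)]; exact hpt t ⟨le_rfl, htR⟩
  have h5 : ∫ x in Set.Ioc t R, (A' x / A x * f x - f' x) =
      f R * g R - f t * g t - ∫ x in Set.Ioc t R, f' x * g x := by linarith
  rw [h5]
  have h6 := abs_sub (f R * g R - f t * g t) (∫ x in Set.Ioc t R, f' x * g x)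
  have h7 := abs_sub (f R * g R) (f t * g t)
  linarith

/-- Exchange of an expectation with an integral over a bounded interval. -/
theorem integral_setIntegral_le {E : Type*} [TopologicalSpace E] [SecondCountableTopology E]
    [MeasurableSpace E] [BorelSpace E] (ν : Measure E) [IsProbabilityMeasure ν]
    {F : E → ℝ → ℝ} (hF : Continuous (Function.uncurry F)) {K B t R : ℝ} (htR : t ≤ R)
    (hK : ∀ e, ∀ x ∈ Set.Ioc t R, |F e x| ≤ K)
    (hB : ∀ x ∈ Set.Ioc t R, ∫ e, F e x ∂ν ≤ B) :
    Integrable (fun e => ∫ x in Set.Ioc t R, F e x) ν ∧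
      ∫ e, (∫ x in Set.Ioc t R, F e x) ∂ν ≤ (R - t) * B := by
  have hi : Integrable (Function.uncurry F) (ν.prod (volume.restrict (Set.Ioc t R))) := by
    refine Integrable.of_bound hF.aestronglyMeasurable K ?_
    have : ∀ᵐ p ∂(ν.prod (volume.restrict (Set.Ioc t R))), p.2 ∈ Set.Ioc t R :=
      Measure.quasiMeasurePreserving_snd.ae (ae_restrict_mem measurableSet_Ioc)
    filter_upwards [this] with p hp
    exact hK p.1 p.2 hp
  refine ⟨hi.integral_prod_left, ?_⟩
  rw [integral_integral_swap hi]
  calc _ ≤ ∫ _ in Set.Ioc t R, B := by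
        refine setIntegral_mono_on hi.integral_prod_right
          (integrableOn_const (by simp)) measurableSet_Ioc fun x hx => hB x hx
    _ = _ := by simp [htR]

/-! ### Tail integrals of the mixture density -/

section Tail

variable {G : Measure ℝ} [IsProbabilityMeasure G] {C : ℝ} (hG : ∀ᵐ m ∂G, |m| ≤ C)
include hG

theorem integrable_mix_linear {s : ℝ} (hs : 0 < s) (a : ℝ) :
    Integrable fun x => (a + |x|) * mix G s x := by
  set c := (8 * s ^ 2)⁻¹ with hc
  have hcpos : 0 < c := by positivity
  have hC := bound_nonneg hG
  have h1 : Integrable fun x : ℝ => Real.exp (-c * x ^ 2) := integrable_exp_neg_mul_sq hcpos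
  have h2 : Integrable fun x : ℝ => |x| * Real.exp (-c * x ^ 2) := by
    have := (integrable_mul_exp_neg_mul_sq hcpos).abs
    simpa [abs_mul] using this
  have h3 : ∀ x, mix G s x ≤ s⁻¹ * Real.exp (c * (2 * C) ^ 2) * Real.exp (-c * x ^ 2) := by
    intro x
    rw [mul_assoc, ← Real.exp_add]
    rcases le_total (2 * C) |x| with hx | hx
    · refine (mix_le_exp hG hs hx).trans ?_
      gcongr
      have : 0 ≤ c * (2 * C) ^ 2 := by positivity
      have e : -x ^ 2 / (8 * s ^ 2) = -c * x ^ 2 := by rw [hc]; field_simp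
      linarith
    · refine (mix_le G hs x).trans ?_
      have : x ^ 2 ≤ (2 * C) ^ 2 := by rw [← sq_abs x]; gcongr
      have : 0 ≤ c * (2 * C) ^ 2 + -c * x ^ 2 := by nlinarith
      have := Real.one_le_exp this
      have : 0 < s⁻¹ := by positivity
      nlinarith
  refine Integrable.mono' (((h1.const_mul |a|).add h2).const_mul
    (s⁻¹ * Real.exp (c * (2 * C) ^ 2))) ?_ (ae_of_all _ fun x => ?_)
  · have := continuous_mix G hs
    exact Continuous.aestronglyMeasurable (by fun_prop)
  · rw [norm_mul, Real.norm_eq_abs, Real.norm_eq_abs, abs_of_pos (mix_pos hG hs x)]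
    calc |a + (|x|)| * mix G s x ≤ (|a| + |x|) *
          (s⁻¹ * Real.exp (c * (2 * C) ^ 2) * Real.exp (-c * x ^ 2)) := by
          gcongr
          · exact (mix_pos hG hs x).le
          · exact (abs_add_le _ _).trans (by rw [abs_abs])
          · exact h3 x
      _ = _ := by simp only [Pi.add_apply]; ring

/-- Half of the Gaussian exponent gives the decay in `R`; the other half keeps an integral that
depends on `u` alone. As `x > R ≥ 1`, the linear factor `a + x` is at most `(a + 1) * x`. -/
theorem setIntegral_mix_linear_le {s l u : ℝ} (hl : 0 < l) (hs : s ∈ Set.Icc l u) {a R : ℝ}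
    (ha : 0 ≤ a) (hR : 1 ≤ R) (hRC : 2 * C ≤ R) :
    ∫ x in Set.Ioi R, (a + |x|) * mix G s x ≤
      (∫ x : ℝ, |x| * Real.exp (-(16 * u ^ 2)⁻¹ * x ^ 2)) * l⁻¹ * (a + 1) *
        Real.exp (-(R ^ 2) / (16 * u ^ 2)) := by
  have hs0 : 0 < s := hl.trans_le hs.1
  have hu : 0 < u := hs0.trans_le hs.2
  have hi : Integrable fun x : ℝ => |x| * Real.exp (-(16 * u ^ 2)⁻¹ * x ^ 2) := by
    have := (integrable_mul_exp_neg_mul_sq (by positivity : 0 < (16 * u ^ 2)⁻¹)).abs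
    simpa [abs_mul] using this
  set c := l⁻¹ * (a + 1) * Real.exp (-(R ^ 2) / (16 * u ^ 2)) with hc
  have hc0 : 0 ≤ c := by positivity
  calc ∫ x in Set.Ioi R, (a + |x|) * mix G s x
      ≤ ∫ x in Set.Ioi R, c * (|x| * Real.exp (-(16 * u ^ 2)⁻¹ * x ^ 2)) := by
        refine setIntegral_mono_on (integrable_mix_linear hG hs0 a).integrableOn
          (hi.const_mul c).integrableOn measurableSet_Ioi fun x hx => ?_
        have hx1 : R < x := hx
        have hx0 : 0 < x := by linarith
        rw [abs_of_pos hx0]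
        have h1 : mix G s x ≤ l⁻¹ * (Real.exp (-(R ^ 2) / (16 * u ^ 2)) *
            Real.exp (-(16 * u ^ 2)⁻¹ * x ^ 2)) := by
          refine (mix_le_exp hG hs0 (x := x) (by rw [abs_of_pos hx0]; linarith)).trans ?_
          rw [← Real.exp_add]
          have e1 : s⁻¹ ≤ l⁻¹ := by gcongr; exact hs.1
          have e2 : -(x ^ 2) / (8 * s ^ 2) ≤ -(R ^ 2) / (16 * u ^ 2) + -(16 * u ^ 2)⁻¹ * x ^ 2 := by
            have b1 : x ^ 2 / (8 * u ^ 2) ≤ x ^ 2 / (8 * s ^ 2) := by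
              gcongr; exact hs.2
            have b2 : R ^ 2 / (16 * u ^ 2) ≤ x ^ 2 / (16 * u ^ 2) := by gcongr
            have b3 : x ^ 2 / (8 * u ^ 2) = 2 * (x ^ 2 / (16 * u ^ 2)) := by field_simp; norm_num
            have b4 : -(16 * u ^ 2)⁻¹ * x ^ 2 = -(x ^ 2 / (16 * u ^ 2)) := by field_simp
            rw [b4, neg_div, neg_div]
            linarith
          gcongr
        calc (a + x) * mix G s x ≤ ((a + 1) * x) * (l⁻¹ * (Real.exp (-(R ^ 2) / (16 * u ^ 2)) *
            Real.exp (-(16 * u ^ 2)⁻¹ * x ^ 2))) := by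
              gcongr
              · exact (mix_pos hG hs0 x).le
              · nlinarith
          _ = _ := by rw [hc]; ring
    _ ≤ ∫ x, c * (|x| * Real.exp (-(16 * u ^ 2)⁻¹ * x ^ 2)) :=
        setIntegral_le_integral (hi.const_mul c) (ae_of_all _ fun x => by positivity)
    _ = _ := by rw [integral_const_mul, hc]; ring

end Tail

/-- `f` times the difference between the estimated and the true score, for `f = mix G (σ i)`. -/
noncomputable def scoreDiff (G : Measure ℝ) {n : ℕ} (h b : ℝ) (σ : Fin n → ℝ) (i : Fin n)
    (y : Fin n → ℝ) (x : ℝ) : ℝ :=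
  dkde h b σ i y x / kde h b σ i y x * mix G (σ i) x - dmix G (σ i) x

/-- Constants of the tail bound. -/
noncomputable def tailConst (u : ℝ) : ℝ := ∫ x : ℝ, |x| * Real.exp (-(16 * u ^ 2)⁻¹ * x ^ 2)

theorem tailConst_nonneg (u : ℝ) : 0 ≤ tailConst u :=
  integral_nonneg fun x => by positivity

/-- Regime in which the risk bounds hold: `N` is an auxiliary slowly growing scale, `k` bounds all
constants that depend on the range `[l, u]` of the scales. -/
structure Regime (G : Measure ℝ) (n : ℕ) (h b l u C N k t : ℝ) : Prop where
  h_pos : 0 < h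
  h_le : h ≤ 1
  b_pos : 0 < b
  l_pos : 0 < l
  mean : ∀ᵐ m ∂G, |m| ≤ C
  one_le : 1 ≤ N
  C_le : C ≤ N
  t_le : |t| ≤ N
  log_n : Real.log n ≤ N
  log_h : |Real.log h| ≤ N
  exp_le : n * Real.exp (-(N ^ 2) / 4) ≤ 1
  one_le_k : 1 ≤ k
  inv_l : l⁻¹ ≤ k
  u_le : u ≤ k
  log_l : |Real.log l| ≤ k
  log_u : |Real.log u| ≤ k

/-! ### Pointwise bounds within the regime -/

section

variable {G : Measure ℝ} [IsProbabilityMeasure G] {n : ℕ} {h b l u C N k t : ℝ}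
  {σ : Fin n → ℝ} (i : Fin n)
  (H : Regime G n h b l u C N k t) (hσ : ∀ j, σ j ∈ Set.Icc l u)
include H hσ

omit [IsProbabilityMeasure G] in
theorem Regime.abs_score_le (y : Fin n → ℝ) (x : ℝ) :
    |dkde h b σ i y x / kde h b σ i y x| ≤ 7 * k ^ 3 * (N / h) := by
  obtain ⟨hh, hh1, hb, hl, hG, hN, hC, ht, hn, hlh, hexp, hk, hli, hu, hll, hlu⟩ := H
  have hu0 : 0 < u := hl.trans_le ((hσ i).1.trans (hσ i).2)
  have hn0 : 0 ≤ (n : ℝ) * Real.exp (-(N ^ 2) / 4) := by positivity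
  refine (abs_dkde_div_kde_le i hh hb hl hσ (L := N) (by linarith) y x).trans ?_
  have h1 : u / l ≤ k * k := by
    rw [div_eq_mul_inv]; exact mul_le_mul hu hli (by positivity) (by linarith)
  calc (h * l)⁻¹ * (N + 6 * (u / l) * (n * Real.exp (-(N ^ 2) / 4)))
      = h⁻¹ * (l⁻¹ * (N + 6 * (u / l) * (n * Real.exp (-(N ^ 2) / 4)))) := by
        rw [mul_inv, mul_assoc]
    _ ≤ h⁻¹ * (k * (k * k * N + 6 * (k * k) * N)) := by
        have : n * Real.exp (-(N ^ 2) / 4) ≤ N := hexp.trans hN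
        have e1 : N ≤ k * k * N := le_mul_of_one_le_left (by linarith) (by nlinarith)
        gcongr
    _ = _ := by rw [div_eq_mul_inv]; ring

omit [IsProbabilityMeasure G] hσ in
theorem Regime.sum_weight_mul_abs_le :
    ∑ j, weight b σ (σ i) j * |σ j - σ i| ≤ 3 * N * b := by
  have hN := H.one_le
  have h1 := NEST.sum_weight_mul_abs_le σ i H.b_pos (L := N) (by linarith)
  have h2 := H.exp_le
  have h3 := H.b_pos
  nlinarith

omit [IsProbabilityMeasure G] in
theorem Regime.drift_nonneg :
    0 ≤ ∑ j, weight b σ (σ i) j * |σ j - σ i| + u * h ^ 2 :=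
  add_nonneg (Finset.sum_nonneg fun _ _ => mul_nonneg (weight_nonneg σ H.b_pos _ _)
    (abs_nonneg _)) (mul_nonneg (H.l_pos.le.trans ((hσ i).1.trans (hσ i).2)) (sq_nonneg _))

omit [IsProbabilityMeasure G] hσ in
theorem Regime.drift_le :
    ∑ j, weight b σ (σ i) j * |σ j - σ i| + u * h ^ 2 ≤ 3 * k * N * (b + h ^ 2) := by
  have h1 := H.sum_weight_mul_abs_le (σ := σ) i
  have h2 := H.one_le
  have h3 := H.one_le_k
  have h4 : 0 ≤ h ^ 2 := sq_nonneg h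
  have h5 := H.b_pos
  have h6 : N * b ≤ k * (N * b) := le_mul_of_one_le_left (by positivity) h3
  have h7 : u * h ^ 2 ≤ k * h ^ 2 := mul_le_mul_of_nonneg_right H.u_le h4
  have h8 : k * h ^ 2 ≤ N * (k * h ^ 2) := le_mul_of_one_le_left (by positivity) h2
  have h9 : 0 ≤ N * (k * h ^ 2) := by positivity
  nlinarith

omit [IsProbabilityMeasure G] hσ in
theorem Regime.inv_sq_le : (l ^ 2)⁻¹ ≤ k ^ 2 := by
  have := H.l_pos
  rw [← inv_pow]; gcongr; exact H.inv_l

omit [IsProbabilityMeasure G] hσ in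
theorem Regime.inv_cube_le : (l ^ 3)⁻¹ ≤ k ^ 3 := by
  have := H.l_pos
  rw [← inv_pow]; gcongr; exact H.inv_l

omit hσ in
theorem Regime.C_nonneg : 0 ≤ C := bound_nonneg H.mean

omit [IsProbabilityMeasure G] in
theorem Regime.scale_pos : 0 < σ i := H.l_pos.trans_le (hσ i).1

/-- A bound valid for all data and all `x`. It loses a factor `1 / h`, harmless in the tail beyond
`2 N`, where the mixture decays like a Gaussian. -/
theorem Regime.abs_scoreDiff_le (y : Fin n → ℝ) (x : ℝ) :
    |scoreDiff G h b σ i y x| ≤ k ^ 2 * ((8 * k ^ 3 * (N / h) + |x|) * mix G (σ i) x) := by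
  have hs := H.scale_pos i hσ
  have hm := mix_pos H.mean hs x
  have h1 := H.abs_score_le i hσ y x
  have h2 := abs_dmix_le_mul_mix H.mean hs x
  have hk := H.one_le_k
  have hN := H.one_le
  have hh := H.h_pos
  have hC := H.C_nonneg
  have hl := H.l_pos
  have h3 : (|x| + C) / σ i ^ 2 ≤ k ^ 2 * (|x| + C) := by
    rw [div_eq_mul_inv, mul_comm]
    refine mul_le_mul_of_nonneg_right ?_ (by positivity)
    refine le_trans ?_ (H.inv_sq_le)
    gcongr
    exact (hσ i).1
  have h4 : C ≤ k ^ 3 * (N / h) := by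
    have a1 : N ≤ N / h := by rw [le_div_iff₀ hh]; nlinarith [H.h_le]
    have a2 : N / h ≤ k ^ 3 * (N / h) :=
      le_mul_of_one_le_left (by positivity) (one_le_pow₀ hk)
    linarith [H.C_le]
  have h5 : 7 * k ^ 3 * (N / h) ≤ k ^ 2 * (7 * k ^ 3 * (N / h)) :=
    le_mul_of_one_le_left (by positivity) (one_le_pow₀ hk)
  unfold scoreDiff
  calc _ ≤ |dkde h b σ i y x / kde h b σ i y x| * mix G (σ i) x + |dmix G (σ i) x| := by
        refine (abs_sub _ _).trans ?_
        rw [abs_mul, abs_of_pos hm]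
    _ ≤ 7 * k ^ 3 * (N / h) * mix G (σ i) x + k ^ 2 * (|x| + C) * mix G (σ i) x := by
        refine add_le_add (mul_le_mul_of_nonneg_right h1 hm.le) (h2.trans ?_)
        exact mul_le_mul_of_nonneg_right h3 hm.le
    _ = (7 * k ^ 3 * (N / h) + k ^ 2 * (|x| + C)) * mix G (σ i) x := by ring
    _ ≤ (k ^ 2 * (8 * k ^ 3 * (N / h) + |x|)) * mix G (σ i) x := by
        refine mul_le_mul_of_nonneg_right ?_ hm.le
        have : 0 ≤ k ^ 2 := by positivity
        nlinarith [mul_le_mul_of_nonneg_left h4 this]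
    _ = _ := by ring

theorem Regime.continuous_scoreDiff :
    Continuous (Function.uncurry fun (e : Fin n → ℝ × ℝ) x => scoreDiff G h b σ i (obs σ e) x) := by
  have hs := H.scale_pos i hσ
  have h1 := continuous_mix G hs
  have h2 := continuous_dmix G hs
  have h3 : ∀ y x, kde h b σ i y x ≠ 0 := fun y x =>
    (kde_pos i H.h_pos H.b_pos H.l_pos hσ y x).ne'
  unfold scoreDiff Function.uncurry
  refine Continuous.sub (Continuous.mul (Continuous.div ?_ ?_ fun _ => h3 _ _) ?_) ?_ <;> fun_prop

theorem Regime.integrable_scoreDiff (e : Fin n → ℝ × ℝ) :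
    Integrable fun x => scoreDiff G h b σ i (obs σ e) x :=
  Integrable.mono' ((integrable_mix_linear H.mean (H.scale_pos i hσ)
    (8 * k ^ 3 * (N / h))).const_mul (k ^ 2))
    (((H.continuous_scoreDiff i hσ).comp (by fun_prop : Continuous fun x : ℝ =>
      (e, x))).aestronglyMeasurable)
    (ae_of_all _ fun x => H.abs_scoreDiff_le i hσ _ x)

theorem Regime.setIntegral_abs_scoreDiff_le (e : Fin n → ℝ × ℝ) :
    ∫ x in Set.Ioi (2 * N), |scoreDiff G h b σ i (obs σ e) x| ≤
      9 * tailConst u * k ^ 6 * (N / h * Real.exp (-(N ^ 2) / (4 * u ^ 2))) := by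
  have hN := H.one_le
  have hk := H.one_le_k
  have hh := H.h_pos
  have hl := H.l_pos
  have hu : 0 < u := hl.trans_le ((hσ i).1.trans (hσ i).2)
  have hJ := tailConst_nonneg u
  have h1 := setIntegral_mix_linear_le H.mean hl (hσ i) (a := 8 * k ^ 3 * (N / h)) (R := 2 * N)
    (by positivity) (by linarith) (by linarith [H.C_le])
  have h2 : -((2 * N) ^ 2) / (16 * u ^ 2) = -(N ^ 2) / (4 * u ^ 2) := by field_simp; norm_num
  rw [h2] at h1
  have h3 : (1 : ℝ) ≤ k ^ 3 * (N / h) := by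
    have a1 : 1 ≤ N / h := by rw [le_div_iff₀ hh]; nlinarith [H.h_le]
    have a2 : (1 : ℝ) ≤ k ^ 3 := one_le_pow₀ hk
    nlinarith
  calc _ ≤ ∫ x in Set.Ioi (2 * N), k ^ 2 * ((8 * k ^ 3 * (N / h) + |x|) * mix G (σ i) x) :=
        integral_mono (H.integrable_scoreDiff i hσ e).abs.integrableOn
          ((integrable_mix_linear H.mean (H.scale_pos i hσ) _).const_mul _).integrableOn
          fun x => H.abs_scoreDiff_le i hσ _ x
    _ = k ^ 2 * ∫ x in Set.Ioi (2 * N), (8 * k ^ 3 * (N / h) + |x|) * mix G (σ i) x := by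
        rw [integral_const_mul]
    _ ≤ k ^ 2 * (tailConst u * k * (9 * k ^ 3 * (N / h)) *
          Real.exp (-(N ^ 2) / (4 * u ^ 2))) := by
        refine mul_le_mul_of_nonneg_left (h1.trans ?_) (by positivity)
        have := H.inv_l
        unfold tailConst at hJ ⊢
        gcongr
        linarith
    _ = _ := by ring

theorem Regime.integral_abs_kde_sub_mix_le {θ : ℝ} (hθ : 0 < θ) (x : ℝ) :
    ∫ e, |kde h b σ i (obs σ e) x - mix G (σ i) x| ∂(Measure.pi fun _ : Fin n => noiseLaw G) ≤
      3 * k ^ 3 * N * (θ + (1 + θ⁻¹) * (weight b σ (σ i) i / h) + (b + h ^ 2)) := by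
  have hN := H.one_le
  have hk := H.one_le_k
  have hh := H.h_pos
  have hl := H.l_pos
  have hb := H.b_pos
  have hw := weight_nonneg σ hb (σ i) i
  have h1 := integral_abs_kde_sub_smix_le G i hh hb hl hσ H.h_le hθ x
  have h2 := abs_smix_sub_le G (h := h) i hb hl hσ x
  have h3 := H.drift_le (σ := σ) i
  have hik := integrable_kde_obs G i hh hb hl hσ x
  have h4 : ∫ e, |kde h b σ i (obs σ e) x - mix G (σ i) x|
      ∂(Measure.pi fun _ : Fin n => noiseLaw G) ≤
      ∫ e, |kde h b σ i (obs σ e) x - smix G h b σ i x|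
        ∂(Measure.pi fun _ : Fin n => noiseLaw G) + |smix G h b σ i x - mix G (σ i) x| := by
    have hi : Integrable (fun e => |kde h b σ i (obs σ e) x - smix G h b σ i x|)
        (Measure.pi fun _ : Fin n => noiseLaw G) := (hik.sub (integrable_const _)).abs
    calc _ ≤ ∫ e, (|kde h b σ i (obs σ e) x - smix G h b σ i x| +
          |smix G h b σ i x - mix G (σ i) x|) ∂(Measure.pi fun _ : Fin n => noiseLaw G) :=
          integral_mono (hik.sub (integrable_const _)).abs (hi.add (integrable_const _))
            fun e => abs_sub_le _ _ _
      _ = _ := by rw [integral_add hi (integrable_const _)]; simp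
  set W := weight b σ (σ i) i with hW
  have e1 : W * (h * l)⁻¹ ≤ 3 * k ^ 3 * N * (W / h) := by
    calc W * (h * l)⁻¹ = l⁻¹ * (W / h) := by rw [mul_inv]; ring
      _ ≤ 3 * k ^ 3 * N * (W / h) := by
        refine mul_le_mul_of_nonneg_right ?_ (by positivity)
        have : k ≤ k ^ 3 := le_self_pow₀ hk (by norm_num)
        have : k ^ 3 ≤ k ^ 3 * N := le_mul_of_one_le_right (by positivity) hN
        have : 0 ≤ k ^ 3 * N := by positivity
        linarith [H.inv_l]
  have e2 : θ ≤ 3 * k ^ 3 * N * θ := by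
    refine le_mul_of_one_le_left hθ.le ?_
    have : 1 ≤ k ^ 3 := one_le_pow₀ hk
    nlinarith
  have e3 : θ⁻¹ * (W * (h * l ^ 2)⁻¹) ≤ 3 * k ^ 3 * N * (θ⁻¹ * (W / h)) := by
    calc θ⁻¹ * (W * (h * l ^ 2)⁻¹) = (l ^ 2)⁻¹ * (θ⁻¹ * (W / h)) := by rw [mul_inv]; ring
      _ ≤ _ := by
        refine mul_le_mul_of_nonneg_right ?_ (by positivity)
        have : k ^ 2 ≤ k ^ 3 := pow_le_pow_right₀ hk (by norm_num)
        have : k ^ 3 ≤ k ^ 3 * N := le_mul_of_one_le_right (by positivity) hN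
        have : 0 ≤ k ^ 3 * N := by positivity
        linarith [H.inv_sq_le]
  have e4 : |smix G h b σ i x - mix G (σ i) x| ≤ 3 * k ^ 3 * N * (b + h ^ 2) := by
    refine h2.trans ?_
    calc _ ≤ k ^ 2 * (3 * k * N * (b + h ^ 2)) :=
          mul_le_mul H.inv_sq_le h3 (H.drift_nonneg i hσ) (by positivity)
      _ = _ := by ring
  calc _ ≤ _ := h4
    _ ≤ (W * (h * l)⁻¹ + (θ + θ⁻¹ * (W * (h * l ^ 2)⁻¹))) + 3 * k ^ 3 * N * (b + h ^ 2) :=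
        add_le_add h1 e4
    _ ≤ _ := by linarith

/-- The estimate lies between multiples of `1 / (n h)` and `1 / h`, and the log-density of the
mixture is at most quadratic. Thus the constant `c` in the integration by parts is only polynomial
in `N`. -/
theorem Regime.abs_log_kde_sub_log_mix_le (y : Fin n → ℝ) {x : ℝ} (hx : |x| ≤ 2 * N) :
    |Real.log (kde h b σ i y x) - Real.log (mix G (σ i) x)| ≤ 15 * k ^ 2 * N ^ 2 := by
  have hN := H.one_le
  have hk := H.one_le_k
  have hh := H.h_pos
  have hl := H.l_pos
  have hb := H.b_pos
  have hu : 0 < u := hl.trans_le ((hσ i).1.trans (hσ i).2)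
  have hn : 0 < (n : ℝ) := by exact_mod_cast i.pos
  have hlog3 : Real.log 3 ≤ 2 := by
    have := Real.log_le_sub_one_of_pos (by norm_num : (0 : ℝ) < 3)
    linarith
  have h1 := Real.log_le_log (kde_pos i hh hb hl hσ y x) (kde_le i hh hb hl hσ y x)
  have h2 := Real.log_le_log (by positivity) (inv_le_kde i hh hb hl hσ y x)
  rw [Real.log_inv, Real.log_mul hh.ne' hl.ne'] at h1
  rw [Real.log_inv, Real.log_mul (by positivity) (by positivity),
    Real.log_mul (by norm_num) hn.ne', Real.log_mul hh.ne' hu.ne'] at h2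
  have h3 := abs_log_mix_le H.mean hl (hσ i) x
  have h4 : (|x| + C) ^ 2 / (2 * l ^ 2) ≤ 5 * k ^ 2 * N ^ 2 := by
    have a1 : (|x| + C) ^ 2 ≤ (3 * N) ^ 2 := by
      have := H.C_nonneg
      have := abs_nonneg x
      gcongr
      linarith [H.C_le]
    calc (|x| + C) ^ 2 / (2 * l ^ 2) = (|x| + C) ^ 2 / 2 * (l ^ 2)⁻¹ := by field_simp
      _ ≤ (3 * N) ^ 2 / 2 * k ^ 2 := by gcongr; exact H.inv_sq_le
      _ ≤ _ := by nlinarith [mul_nonneg (sq_nonneg N) (sq_nonneg k)]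
  have h5 := abs_le.1 H.log_h
  have h6 := abs_le.1 H.log_l
  have h7 := abs_le.1 H.log_u
  have h8 := H.log_n
  have h9 : |Real.log (kde h b σ i y x)| ≤ 2 * N + 2 + k := by
    rw [abs_le]; constructor <;> linarith
  have h10 := abs_sub (Real.log (kde h b σ i y x)) (Real.log (mix G (σ i) x))
  have h11 : N ≤ k ^ 2 * N ^ 2 := by
    have a1 : N ≤ N ^ 2 := le_self_pow₀ hN (by norm_num)
    have a2 : N ^ 2 ≤ k ^ 2 * N ^ 2 := le_mul_of_one_le_left (by positivity) (one_le_pow₀ hk)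
    linarith
  have h12 : k ≤ k ^ 2 * N ^ 2 := by
    have a1 : k ≤ k ^ 2 := le_self_pow₀ hk (by norm_num)
    have a2 : k ^ 2 ≤ k ^ 2 * N ^ 2 := le_mul_of_one_le_right (by positivity) (one_le_pow₀ hN)
    linarith
  have h13 : 1 ≤ k ^ 2 * N ^ 2 := hk.trans h12
  linarith [H.log_l, H.log_u]

end

/-! ### The score difference, integrated over the selected region -/

section

variable {G : Measure ℝ} [IsProbabilityMeasure G] {n : ℕ} {h b l u C N k t : ℝ}
  {σ : Fin n → ℝ} (i : Fin n)
  (H : Regime G n h b l u C N k t) (hσ : ∀ j, σ j ∈ Set.Icc l u)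
include H hσ

omit [IsProbabilityMeasure G] hσ in
theorem Regime.abs_le_of_mem {x : ℝ} (hx : x ∈ Set.Icc t (2 * N)) : |x| ≤ 2 * N := by
  have := abs_le.1 H.t_le
  have := H.one_le
  rw [abs_le]; constructor <;> linarith [hx.1, hx.2]

omit [IsProbabilityMeasure G] hσ in
theorem Regime.t_le_two_mul : t ≤ 2 * N := by
  have := abs_le.1 H.t_le
  have := H.one_le
  linarith

omit [IsProbabilityMeasure G] hσ in
theorem Regime.setIntegral_Ioi_split {F : ℝ → ℝ} (hF : Integrable F) :
    ∫ x in Set.Ioi t, F x = (∫ x in Set.Ioc t (2 * N), F x) + ∫ x in Set.Ioi (2 * N), F x := by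
  rw [← Set.Ioc_union_Ioi_eq_Ioi H.t_le_two_mul,
    setIntegral_union (Set.Ioc_disjoint_Ioi le_rfl) measurableSet_Ioi hF.integrableOn
      hF.integrableOn]

/-- The absolute value stays outside the integral over `x`, so integration by parts applies on `(t,
2N]` and only the density error enters, with variance `W / h`. The tail beyond `2 N` is bounded
absolutely. -/
theorem Regime.abs_integral_scoreDiff_le {θ : ℝ} (hθ : 0 < θ) :
    |∫ e, (∫ x in Set.Ioi t, scoreDiff G h b σ i (obs σ e) x)
      ∂(Measure.pi fun _ : Fin n => noiseLaw G)| ≤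
      1056 * k ^ 7 * N ^ 5 * (θ + (1 + θ⁻¹) * (weight b σ (σ i) i / h) + (b + h ^ 2)) +
        9 * tailConst u * k ^ 6 * (N / h * Real.exp (-(N ^ 2) / (4 * u ^ 2))) := by
  have hN := H.one_le
  have hk := H.one_le_k
  have hh := H.h_pos
  have hl := H.l_pos
  have hb := H.b_pos
  have hs := H.scale_pos i hσ
  have hC := H.C_nonneg
  set ν := Measure.pi fun _ : Fin n => noiseLaw G with hν
  set T := 9 * tailConst u * k ^ 6 * (N / h * Real.exp (-(N ^ 2) / (4 * u ^ 2))) with hT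
  set B := 3 * k ^ 3 * N * (θ + (1 + θ⁻¹) * (weight b σ (σ i) i / h) + (b + h ^ 2)) with hB
  set A : (Fin n → ℝ × ℝ) → ℝ → ℝ := fun e x => kde h b σ i (obs σ e) x with hA
  set f := mix G (σ i) with hf
  have hB' : ∀ x, ∫ e, |A e x - f x| ∂ν ≤ B := fun x => H.integral_abs_kde_sub_mix_le i hσ hθ x
  have hfc : Continuous f := continuous_mix G hs
  have hAi : ∀ x, Integrable (fun e => |A e x - f x|) ν := fun x =>
    ((integrable_kde_obs G i hh hb hl hσ x).sub (integrable_const _)).abs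
  obtain ⟨hint, hintB⟩ := integral_setIntegral_le ν (F := fun e x => |A e x - f x|)
    (by simp only [hA]; fun_prop) (K := (h * l)⁻¹ + (σ i)⁻¹) (B := B)
    H.t_le_two_mul
    (fun e x _ => by
      rw [abs_abs]
      refine (abs_sub _ _).trans (add_le_add ?_ ?_)
      · rw [abs_of_pos (kde_pos i hh hb hl hσ _ _)]; exact kde_le i hh hb hl hσ _ _
      · rw [abs_of_pos (mix_pos H.mean hs x)]; exact mix_le G hs x)
    (fun x _ => hB' x)
  set M := 3 * N * k ^ 2 with hM
  have hM0 : 0 ≤ M := by positivity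
  have hmain : ∀ e, |∫ x in Set.Ioi t, scoreDiff G h b σ i (obs σ e) x| ≤
      2 * (1 + 15 * k ^ 2 * N ^ 2) * (|A e t - f t| + |A e (2 * N) - f (2 * N)| +
        M * ∫ x in Set.Ioc t (2 * N), |A e x - f x|) + T := by
    intro e
    rw [H.setIntegral_Ioi_split (H.integrable_scoreDiff i hσ e)]
    refine (abs_add_le _ _).trans (add_le_add ?_ ?_)
    · refine abs_integral_score_sub_le H.t_le_two_mul
        (fun x => kde_pos i hh hb hl hσ _ x) (fun x => mix_pos H.mean hs x)
        (fun x => hasDerivAt_kde h b σ i _ x) (fun x => hasDerivAt_mix G hs x) (by fun_prop)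
        (continuous_dmix G hs) hM0
        (fun x hx => H.abs_log_kde_sub_log_mix_le i hσ _ (H.abs_le_of_mem hx)) fun x hx => ?_
      refine (abs_dmix_le_mul_mix H.mean hs x).trans ?_
      refine mul_le_mul_of_nonneg_right ?_ (mix_pos H.mean hs x).le
      have h1 := H.abs_le_of_mem hx
      have h2 := H.C_le
      rw [div_eq_mul_inv, hM]
      refine mul_le_mul (by linarith) ?_ (by positivity) (by positivity)
      refine le_trans ?_ H.inv_sq_le
      gcongr
      exact (hσ i).1
    · exact (abs_integral_le_integral_abs).trans (H.setIntegral_abs_scoreDiff_le i hσ e)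
  have hgi : Integrable (fun e => 2 * (1 + 15 * k ^ 2 * N ^ 2) * (|A e t - f t| +
      |A e (2 * N) - f (2 * N)| + M * ∫ x in Set.Ioc t (2 * N), |A e x - f x|)) ν :=
    (((hAi t).add (hAi (2 * N))).add (hint.const_mul M)).const_mul _
  rw [← Real.norm_eq_abs]
  refine (norm_integral_le_of_norm_le (hgi.add (integrable_const T))
    (ae_of_all _ hmain)).trans ?_
  have hAA : Integrable (fun e => |A e t - f t| + |A e (2 * N) - f (2 * N)|) ν :=
    (hAi t).add (hAi (2 * N))
  rw [integral_add' hgi (integrable_const T), integral_const_mul,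
    integral_add hAA (hint.const_mul M),
    integral_add (hAi t) (hAi (2 * N)), integral_const_mul]
  simp only [integral_const, probReal_univ, one_smul]
  refine add_le_add ?_ le_rfl
  have hB0 : 0 ≤ B := (integral_nonneg fun e => abs_nonneg _).trans (hB' t)
  have h1 : 2 * N - t ≤ 3 * N := by linarith [(abs_le.1 H.t_le).1]
  have h2 : M * ∫ e, (∫ x in Set.Ioc t (2 * N), |A e x - f x|) ∂ν ≤ M * (3 * N * B) := by
    refine mul_le_mul_of_nonneg_left (hintB.trans ?_) hM0
    exact mul_le_mul_of_nonneg_right h1 hB0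
  have hkN : 1 ≤ k ^ 2 * N ^ 2 := by
    have := one_le_pow₀ hk (n := 2)
    have := one_le_pow₀ hN (n := 2)
    nlinarith
  -- The two boundary terms contribute `2 B` and the integral `M * 3N * B = 9 k² N² B`. Then `1 ≤ k²
  -- N²` collects the factors, and `2 * 16 * 11 * 3 = 1056`, the last 3 coming from `B`.
  calc _ ≤ 2 * (1 + 15 * k ^ 2 * N ^ 2) * (B + B + M * (3 * N * B)) := by
        refine mul_le_mul_of_nonneg_left ?_ (by positivity)
        exact add_le_add (add_le_add (hB' t) (hB' (2 * N))) h2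
    _ = 2 * (1 + 15 * (k ^ 2 * N ^ 2)) * ((2 + 9 * (k ^ 2 * N ^ 2)) * B) := by rw [hM]; ring
    _ ≤ 2 * (16 * (k ^ 2 * N ^ 2)) * ((11 * (k ^ 2 * N ^ 2)) * B) := by
        gcongr <;> linarith
    _ = _ := by rw [hB]; ring

/-- The comparison passes through the smoothed score `s' / s`. Then the estimated score, of size `1
/ h`, multiplies only the stochastic error `a - s`, while the bias `f - s` is multiplied by the
smoothed score, of order `N`. A direct comparison with `f' / f` would produce a term of order `b /
h`, which need not vanish. -/
theorem Regime.abs_scoreDiff_le_add (hNb : 54 * k ^ 5 * N ^ 3 * b ≤ 1) (y : Fin n → ℝ) {x : ℝ}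
    (hx : |x| ≤ 2 * N) :
    |scoreDiff G h b σ i y x| ≤
      4 * k ^ 2 * (|dkde h b σ i y x - dsmix G h b σ i x| +
        7 * k ^ 3 * (N / h) * |kde h b σ i y x - smix G h b σ i x|) +
      27 * k ^ 5 * N ^ 2 * (b + h ^ 2) := by
  have hN := H.one_le
  have hk := H.one_le_k
  have hh := H.h_pos
  have hl := H.l_pos
  have hb := H.b_pos
  have hC := H.C_nonneg
  have hCN := H.C_le
  have hs := H.scale_pos i hσ
  have hu : 0 < u := hl.trans_le ((hσ i).1.trans (hσ i).2)
  have hA := kde_pos i hh hb hl hσ y x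
  have hS := smix_pos (G := G) (h := h) i hb hl hσ H.mean x
  have hxC : |x| + C ≤ 3 * N := by linarith
  have hr := H.abs_score_le i hσ y x
  have hrb : |dsmix G h b σ i x / smix G h b σ i x| ≤ 3 * N * k ^ 2 := by
    rw [abs_div, abs_of_pos hS, div_le_iff₀ hS]
    refine (abs_dsmix_le_mul_smix i hb hl hσ H.mean x).trans ?_
    refine mul_le_mul_of_nonneg_right ?_ hS.le
    rw [div_eq_mul_inv]
    exact mul_le_mul hxC H.inv_sq_le (by positivity) (by positivity)
  have hul : u / l ^ 4 ≤ k ^ 5 := by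
    calc u / l ^ 4 = u * l⁻¹ ^ 4 := by rw [div_eq_mul_inv, inv_pow]
      _ ≤ k * k ^ 4 := by gcongr; exacts [H.u_le, H.inv_l]
      _ = k ^ 5 := by ring
  have hcomp : mix G (σ i) x ≤ 4 * k ^ 2 * smix G h b σ i x := by
    have h1 := mix_le_mul_smix (h := h) i hb hl hσ H.mean (x := x) (Z := 3 * N)
      (by rw [abs_of_pos hh]; exact H.h_le) hxC (by
        calc _ ≤ (3 * N) ^ 2 * k ^ 5 * (3 * N * b) := by
              refine mul_le_mul (mul_le_mul_of_nonneg_left hul (by positivity))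
                (H.sum_weight_mul_abs_le (σ := σ) i) ?_ (by positivity)
              exact Finset.sum_nonneg fun _ _ => mul_nonneg (weight_nonneg σ hb _ _)
                (abs_nonneg _)
          _ ≤ 1 / 2 := by linarith)
    refine h1.trans (mul_le_mul_of_nonneg_right ?_ hS.le)
    have : u / l ≤ k * k := by
      rw [div_eq_mul_inv]; exact mul_le_mul H.u_le H.inv_l (by positivity) (by linarith)
    nlinarith
  have hd := H.drift_le (σ := σ) i
  have hd0 := H.drift_nonneg i hσ
  have h1 : |smix G h b σ i x - mix G (σ i) x| ≤ k ^ 2 * (3 * k * N * (b + h ^ 2)) :=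
    (abs_smix_sub_le G (h := h) i hb hl hσ x).trans
      (mul_le_mul H.inv_sq_le hd hd0 (by positivity))
  have h2 : |dsmix G h b σ i x - dmix G (σ i) x| ≤ 6 * k ^ 3 * (3 * k * N * (b + h ^ 2)) :=
    (abs_dsmix_sub_le G (h := h) i hb hl hσ x).trans
      (mul_le_mul (mul_le_mul_of_nonneg_left H.inv_cube_le (by norm_num)) hd hd0 (by positivity))
  set a := kde h b σ i y x with ha
  set a' := dkde h b σ i y x with ha'
  set s := smix G h b σ i x with hs'
  set s' := dsmix G h b σ i x with hs''
  set f := mix G (σ i) x with hf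
  set f' := dmix G (σ i) x with hf'
  have hf0 : 0 < f := mix_pos H.mean hs x
  have hdec : scoreDiff G h b σ i y x = f * (a' / a - s' / s) + (s' / s * (f - s) + (s' - f')) := by
    unfold scoreDiff
    rw [← ha, ← ha', ← hf, ← hf']
    field_simp
    ring
  -- Replacing the weight `f` by a multiple of `s` clears the denominator `s`, so no small density
  -- is divided by.
  have h3 : f * |a' / a - s' / s| ≤ 4 * k ^ 2 * (|a' - s'| + 7 * k ^ 3 * (N / h) * |a - s|) := by
    calc f * |a' / a - s' / s| ≤ 4 * k ^ 2 * s * |a' / a - s' / s| := by gcongr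
      _ = 4 * k ^ 2 * |s * (a' / a - s' / s)| := by rw [abs_mul, abs_of_pos hS]; ring
      _ = 4 * k ^ 2 * |(a' - s') - a' / a * (a - s)| := by
          congr 2; field_simp; ring
      _ ≤ 4 * k ^ 2 * (|a' - s'| + 7 * k ^ 3 * (N / h) * |a - s|) := by
          refine mul_le_mul_of_nonneg_left ((abs_sub _ _).trans ?_) (by positivity)
          rw [abs_mul]
          exact add_le_add le_rfl (mul_le_mul_of_nonneg_right hr (abs_nonneg _))
  have h4 : |s' / s * (f - s) + (s' - f')| ≤ 27 * k ^ 5 * N ^ 2 * (b + h ^ 2) := by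
    refine (abs_add_le _ _).trans ?_
    rw [abs_mul, abs_sub_comm f s]
    calc _ ≤ 3 * N * k ^ 2 * (k ^ 2 * (3 * k * N * (b + h ^ 2))) +
          6 * k ^ 3 * (3 * k * N * (b + h ^ 2)) := by gcongr
      _ = (9 * (k ^ 5 * N ^ 2) + 18 * (k ^ 4 * N)) * (b + h ^ 2) := by ring
      _ ≤ (9 * (k ^ 5 * N ^ 2) + 18 * (k ^ 5 * N ^ 2)) * (b + h ^ 2) := by
          have : k ^ 4 ≤ k ^ 5 := pow_le_pow_right₀ hk (by norm_num)
          have : N ≤ N ^ 2 := le_self_pow₀ hN (by norm_num)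
          gcongr
      _ = _ := by ring
  rw [hdec]
  refine (abs_add_le _ _).trans ?_
  rw [abs_mul, abs_of_pos hf0]
  exact add_le_add h3 h4

theorem Regime.integral_abs_scoreDiff_le {θ : ℝ} (hθ : 0 < θ)
    (hNb : 54 * k ^ 5 * N ^ 3 * b ≤ 1) {x : ℝ} (hx : |x| ≤ 2 * N) :
    ∫ e, |scoreDiff G h b σ i (obs σ e) x| ∂(Measure.pi fun _ : Fin n => noiseLaw G) ≤
      32 * k ^ 8 * N ^ 2 * (θ + (1 + θ⁻¹) * (weight b σ (σ i) i / h ^ 3) + (b + h ^ 2)) := by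
  have hN := H.one_le
  have hk := H.one_le_k
  have hh := H.h_pos
  have hh1 := H.h_le
  have hl := H.l_pos
  have hb := H.b_pos
  have hw := weight_nonneg σ hb (σ i) i
  set ν := Measure.pi fun _ : Fin n => noiseLaw G with hν
  set W := weight b σ (σ i) i with hW
  set V := W / h ^ 3 with hV
  have hV0 : 0 ≤ V := by positivity
  have hi1 : Integrable (fun e => |kde h b σ i (obs σ e) x - smix G h b σ i x|) ν :=
    ((integrable_kde_obs G i hh hb hl hσ x).sub (integrable_const _)).abs
  have hi2 : Integrable (fun e => |dkde h b σ i (obs σ e) x - dsmix G h b σ i x|) ν :=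
    ((integrable_dkde_obs G i hh hb hl hσ x).sub (integrable_const _)).abs
  have hi3 : Integrable (fun e => 4 * k ^ 2 * (|dkde h b σ i (obs σ e) x - dsmix G h b σ i x| +
      7 * k ^ 3 * (N / h) * |kde h b σ i (obs σ e) x - smix G h b σ i x|)) ν :=
    (hi2.add (hi1.const_mul _)).const_mul _
  -- The parameter is `h * θ` because this error is multiplied by `1 / h`: the result is `θ + θ⁻¹ W
  -- / h³` up to constants, the same rate as for the derivative.
  have h1 := integral_abs_kde_sub_smix_le G i hh hb hl hσ hh1 (mul_pos hh hθ) x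
  have h2 := integral_abs_dkde_sub_dsmix_le G i hh hb hl hσ hθ x
  have e1 : ∫ e, |dkde h b σ i (obs σ e) x - dsmix G h b σ i x| ∂ν ≤
      k ^ 4 * (V + (θ + θ⁻¹ * V)) := by
    refine h2.trans ?_
    have a1 : W * (l ^ 2)⁻¹ ≤ k ^ 4 * V := by
      have b1 : W ≤ V := by
        rw [hV, le_div_iff₀ (by positivity)]
        exact mul_le_of_le_one_right hw (pow_le_one₀ hh.le hh1)
      have b2 : (l ^ 2)⁻¹ ≤ k ^ 4 := H.inv_sq_le.trans (pow_le_pow_right₀ hk (by norm_num))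
      rw [mul_comm]
      exact mul_le_mul b2 b1 hw (by positivity)
    have a2 : θ ≤ k ^ 4 * θ := le_mul_of_one_le_left hθ.le (one_le_pow₀ hk)
    have a3 : θ⁻¹ * (W * (h ^ 3 * l ^ 4)⁻¹) ≤ k ^ 4 * (θ⁻¹ * V) := by
      calc θ⁻¹ * (W * (h ^ 3 * l ^ 4)⁻¹) = l⁻¹ ^ 4 * (θ⁻¹ * V) := by
            rw [hV, mul_inv, inv_pow]; ring
        _ ≤ _ := by gcongr; exact H.inv_l
    linarith
  have e2 : 1 / h * ∫ e, |kde h b σ i (obs σ e) x - smix G h b σ i x| ∂ν ≤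
      k ^ 2 * (V + (θ + θ⁻¹ * V)) := by
    calc _ ≤ 1 / h * (W * (h * l)⁻¹ + (h * θ + (h * θ)⁻¹ * (W * (h * l ^ 2)⁻¹))) := by
          gcongr
      _ = l⁻¹ * (W / h ^ 2) + (θ + (l ^ 2)⁻¹ * (θ⁻¹ * V)) := by
          rw [hV]; field_simp
      _ ≤ k ^ 2 * V + (k ^ 2 * θ + k ^ 2 * (θ⁻¹ * V)) := by
          have b1 : W / h ^ 2 ≤ V := by
            rw [hV]
            refine div_le_div_of_nonneg_left hw (by positivity) ?_
            exact pow_le_pow_of_le_one hh.le hh1 (by norm_num)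
          have b2 : l⁻¹ ≤ k ^ 2 := H.inv_l.trans (le_self_pow₀ hk (by norm_num))
          refine add_le_add (mul_le_mul b2 b1 (by positivity) (by positivity))
            (add_le_add (le_mul_of_one_le_left hθ.le (one_le_pow₀ hk)) ?_)
          exact mul_le_mul_of_nonneg_right H.inv_sq_le (by positivity)
      _ = _ := by ring
  set I1 := ∫ e, |dkde h b σ i (obs σ e) x - dsmix G h b σ i x| ∂ν with hI1
  set I2 := ∫ e, |kde h b σ i (obs σ e) x - smix G h b σ i x| ∂ν with hI2
  have hq : 0 ≤ V + (θ + θ⁻¹ * V) := by positivity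
  calc _ ≤ ∫ e, (4 * k ^ 2 * (|dkde h b σ i (obs σ e) x - dsmix G h b σ i x| +
        7 * k ^ 3 * (N / h) * |kde h b σ i (obs σ e) x - smix G h b σ i x|) +
        27 * k ^ 5 * N ^ 2 * (b + h ^ 2)) ∂ν :=
        integral_mono_of_nonneg (ae_of_all _ fun e => abs_nonneg _)
          (hi3.add (integrable_const _))
          (ae_of_all _ fun e => H.abs_scoreDiff_le_add i hσ hNb _ hx)
    _ = 4 * k ^ 2 * (I1 + 7 * k ^ 3 * N * (1 / h * I2)) +
        27 * k ^ 5 * N ^ 2 * (b + h ^ 2) := by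
        rw [integral_add hi3 (integrable_const _), integral_const_mul,
          integral_add hi2 (hi1.const_mul _), integral_const_mul]
        simp only [integral_const, probReal_univ, one_smul]
        rw [hI2]
        ring
    _ ≤ 4 * k ^ 2 * (k ^ 4 * (V + (θ + θ⁻¹ * V)) +
        7 * k ^ 3 * N * (k ^ 2 * (V + (θ + θ⁻¹ * V)))) + 27 * k ^ 5 * N ^ 2 * (b + h ^ 2) := by
        gcongr
    _ = (4 * k ^ 6 + 28 * (k ^ 7 * N)) * (V + (θ + θ⁻¹ * V)) +
        27 * (k ^ 5 * N ^ 2) * (b + h ^ 2) := by ring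
    _ ≤ (4 * (k ^ 8 * N ^ 2) + 28 * (k ^ 8 * N ^ 2)) * (V + (θ + θ⁻¹ * V)) +
        32 * (k ^ 8 * N ^ 2) * (b + h ^ 2) := by
        have c1 : N ≤ N ^ 2 := le_self_pow₀ hN (by norm_num)
        have c2 : k ^ 6 ≤ k ^ 8 * N ^ 2 := by
          have := pow_le_pow_right₀ hk (by norm_num : 6 ≤ 8)
          have := le_mul_of_one_le_right (by positivity : 0 ≤ k ^ 8) (one_le_pow₀ hN (n := 2))
          linarith
        have c3 : k ^ 7 * N ≤ k ^ 8 * N ^ 2 :=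
          mul_le_mul (pow_le_pow_right₀ hk (by norm_num)) c1 (by linarith) (by positivity)
        have c4 : k ^ 5 * N ^ 2 ≤ k ^ 8 * N ^ 2 :=
          mul_le_mul_of_nonneg_right (pow_le_pow_right₀ hk (by norm_num)) (by positivity)
        gcongr
        norm_num
    _ = _ := by ring

/-- The version without cancellation, for integrands only dominated by the absolute score
difference; the price is `h ^ 3` in place of `h`. -/
theorem Regime.abs_integral_le_of_le_scoreDiff {θ : ℝ} (hθ : 0 < θ)
    (hNb : 54 * k ^ 5 * N ^ 3 * b ≤ 1) {F : (Fin n → ℝ × ℝ) → ℝ → ℝ} {c : ℝ} (hc : 0 ≤ c)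
    (hF : ∀ e x, |F e x| ≤ c * |scoreDiff G h b σ i (obs σ e) x|) :
    |∫ e, (∫ x in Set.Ioi t, F e x) ∂(Measure.pi fun _ : Fin n => noiseLaw G)| ≤
      c * (96 * k ^ 8 * N ^ 3 * (θ + (1 + θ⁻¹) * (weight b σ (σ i) i / h ^ 3) + (b + h ^ 2)) +
        9 * tailConst u * k ^ 6 * (N / h * Real.exp (-(N ^ 2) / (4 * u ^ 2)))) := by
  have hN := H.one_le
  have hk := H.one_le_k
  have hh := H.h_pos
  have hs := H.scale_pos i hσ
  set ν := Measure.pi fun _ : Fin n => noiseLaw G with hν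
  set T := 9 * tailConst u * k ^ 6 * (N / h * Real.exp (-(N ^ 2) / (4 * u ^ 2))) with hT
  set D : (Fin n → ℝ × ℝ) → ℝ → ℝ := fun e x => |scoreDiff G h b σ i (obs σ e) x| with hD
  set B := 32 * k ^ 8 * N ^ 2 *
    (θ + (1 + θ⁻¹) * (weight b σ (σ i) i / h ^ 3) + (b + h ^ 2)) with hB
  obtain ⟨hint, hintB⟩ := integral_setIntegral_le ν (F := D)
    (H.continuous_scoreDiff i hσ).abs
    (K := k ^ 2 * ((8 * k ^ 3 * (N / h) + 2 * N) * (σ i)⁻¹)) (B := B) H.t_le_two_mul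
    (fun e x hx => by
      simp only [hD, abs_abs]
      refine (H.abs_scoreDiff_le i hσ _ x).trans ?_
      have := H.abs_le_of_mem (Set.Ioc_subset_Icc_self hx)
      have := mix_le G hs x
      have := mix_pos H.mean hs x
      gcongr)
    (fun x hx => H.integral_abs_scoreDiff_le i hσ hθ hNb
      (H.abs_le_of_mem (Set.Ioc_subset_Icc_self hx)))
  have hmain : ∀ e, |∫ x in Set.Ioi t, F e x| ≤
      c * ((∫ x in Set.Ioc t (2 * N), D e x) + T) := by
    intro e
    have hi := (H.integrable_scoreDiff i hσ e).abs
    have h1 : |∫ x in Set.Ioi t, F e x| ≤ ∫ x in Set.Ioi t, c * D e x := by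
      rw [← Real.norm_eq_abs]
      exact norm_integral_le_of_norm_le (hi.const_mul c).integrableOn
        (ae_of_all _ fun x => hF e x)
    rw [integral_const_mul, H.setIntegral_Ioi_split hi] at h1
    refine h1.trans (mul_le_mul_of_nonneg_left (add_le_add le_rfl ?_) hc)
    exact H.setIntegral_abs_scoreDiff_le i hσ e
  rw [← Real.norm_eq_abs]
  refine (norm_integral_le_of_norm_le ((hint.add (integrable_const T)).const_mul c)
    (ae_of_all _ hmain)).trans ?_
  rw [integral_const_mul, integral_add' hint (integrable_const T)]
  simp only [integral_const, probReal_univ, one_smul]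
  refine mul_le_mul_of_nonneg_left (add_le_add (hintB.trans ?_) le_rfl) hc
  have hB0 : 0 ≤ B := by
    have := H.b_pos
    have := weight_nonneg σ H.b_pos (σ i) i
    positivity
  have h1 : 2 * N - t ≤ 3 * N := by linarith [(abs_le.1 H.t_le).1]
  refine (mul_le_mul_of_nonneg_right h1 hB0).trans (le_of_eq ?_)
  rw [hB]; ring

end

/-- Expectation over the selected event, with the mean integrated out. -/
theorem integral_select {G : Measure ℝ} [IsProbabilityMeasure G] {C : ℝ}
    (hG : ∀ᵐ m ∂G, |m| ≤ C) {s : ℝ} (hs : 0 < s) {F : ℝ → ℝ} (hF : Measurable F) {K : ℝ}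
    (hK : ∀ x, |F x| ≤ |x| + K) (t : ℝ) :
    ∫ p : ℝ × ℝ, (Set.Ioi t).indicator (fun x => F x - p.1) (p.1 + s * p.2) ∂(noiseLaw G) =
      ∫ x in Set.Ioi t, (F x * mix G s x - (x * mix G s x + s ^ 2 * dmix G s x)) := by
  set Φ : ℝ × ℝ → ℝ := fun q => (Set.Ioi t).indicator (fun x => F x - q.1) q.2 with hΦ
  have hΦm : Measurable Φ := by
    have : Φ = (Prod.snd ⁻¹' Set.Ioi t).indicator fun q => F q.2 - q.1 := by
      ext q; simp [hΦ, Set.indicator]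
    rw [this]
    exact Measurable.indicator (by fun_prop) (measurable_snd measurableSet_Ioi)
  have hT : Measurable fun p : ℝ × ℝ => (p.1, p.1 + s * p.2) := by fun_prop
  have hz : Integrable (fun p : ℝ × ℝ => |p.2|) (noiseLaw G) := by
    have h1 : Integrable (fun z : ℝ => z) (gaussianReal 0 1) :=
      IsGaussian.integrable_id
    exact (measurePreserving_snd (μ := G) (ν := gaussianReal 0 1)).integrable_comp_of_integrable
      h1.abs
  have hmean : ∀ᵐ p ∂(noiseLaw G), |p.1| ≤ C :=
    (measurePreserving_fst (μ := G) (ν := gaussianReal 0 1)).quasiMeasurePreserving.ae hG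
  have hi1 : Integrable (fun p : ℝ × ℝ => Φ (p.1, p.1 + s * p.2)) (noiseLaw G) := by
    refine Integrable.mono' ((hz.const_mul s).add (integrable_const (2 * C + K)))
      (hΦm.comp hT).aestronglyMeasurable ?_
    filter_upwards [hmean] with p hp
    have hCn : 0 ≤ C := (abs_nonneg _).trans hp
    have hKn : 0 ≤ K := by have := (abs_nonneg _).trans (hK 0); simpa using this
    simp only [hΦ, Pi.add_apply]
    by_cases hx : p.1 + s * p.2 ∈ Set.Ioi t
    · rw [Set.indicator_of_mem hx, Real.norm_eq_abs]
      have h1 := abs_sub (F (p.1 + s * p.2)) p.1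
      have h2 := hK (p.1 + s * p.2)
      have h3 := abs_add_le p.1 (s * p.2)
      rw [abs_mul, abs_of_pos hs] at h3
      linarith
    · rw [Set.indicator_of_notMem hx, norm_zero]
      positivity
  have hi2 : Integrable Φ ((noiseLaw G).map fun p => (p.1, p.1 + s * p.2)) :=
    (integrable_map_measure hΦm.aestronglyMeasurable hT.aemeasurable).2 hi1
  have hden : Measurable fun p : ℝ × ℝ => ENNReal.ofReal (phi s (p.2 - p.1)) := by fun_prop
  have hlt : ∀ᵐ p ∂(G.prod volume), ENNReal.ofReal (phi s (p.2 - p.1)) < ⊤ :=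
    ae_of_all _ fun p => ENNReal.ofReal_lt_top
  have hi3 : Integrable (fun p : ℝ × ℝ => phi s (p.2 - p.1) * Φ p) (G.prod volume) := by
    rw [map_noiseLaw G hs, integrable_withDensity_iff_integrable_smul' hden hlt] at hi2
    refine hi2.congr (ae_of_all _ fun p => ?_)
    simp only [smul_eq_mul]
    rw [ENNReal.toReal_ofReal (phi_pos hs _).le]
  calc _ = ∫ q, Φ q ∂((noiseLaw G).map fun p => (p.1, p.1 + s * p.2)) := by
        rw [integral_map hT.aemeasurable hΦm.aestronglyMeasurable]
    _ = ∫ q, phi s (q.2 - q.1) * Φ q ∂(G.prod volume) := by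
        rw [map_noiseLaw G hs, integral_withDensity_eq_integral_toReal_smul hden hlt]
        refine integral_congr_ae (ae_of_all _ fun q => ?_)
        simp only [smul_eq_mul]
        rw [ENNReal.toReal_ofReal (phi_pos hs _).le]
    _ = ∫ x, ∫ m, phi s (x - m) * Φ (m, x) ∂G := integral_prod_symm _ hi3
    _ = _ := by
        rw [← integral_indicator measurableSet_Ioi]
        refine integral_congr_ae (ae_of_all _ fun x => ?_)
        simp only [hΦ]
        by_cases hx : x ∈ Set.Ioi t
        · simp only [Set.indicator_of_mem hx]
          rw [← integral_mul_phi_sub hs, mix, ← integral_const_mul,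
            ← integral_sub ((integrable_phi_sub G hs x).const_mul _)
              (integrable_mul_phi_sub hG hs x)]
          refine integral_congr_ae (ae_of_all _ fun m => ?_)
          simp only
          ring
        · simp only [Set.indicator_of_notMem hx, mul_zero, integral_zero]

/-! ### From the conditional bias to the integrated score difference -/

theorem obs_update {n : ℕ} (σ : Fin n → ℝ) (e : Fin n → ℝ × ℝ) (i : Fin n) (d : ℝ × ℝ) :
    obs σ (Function.update e i d) = Function.update (obs σ e) i (d.1 + σ i * d.2) := by
  ext j
  by_cases hj : j = i
  · subst hj; simp [obs]
  · simp [obs, hj]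

theorem measurable_nest {α : Type*} [MeasurableSpace α] {n : ℕ} (h b : ℝ) (i : Fin n)
    {f g : α → Fin n → ℝ} (hf : Measurable f) (hg : Measurable g) :
    Measurable fun a => nest h b (f a) (g a) i := by
  unfold nest fHat fHatDeriv weight
  fun_prop

/-- A crude deterministic bound, used only for integrability: truncation level 0 in
`abs_dkde_div_kde_le`. -/
theorem abs_nest_sub_le {n : ℕ} {h b l u : ℝ} (hh : 0 < h) (hb : 0 < b) (hl : 0 < l)
    {σ : Fin n → ℝ} (hσ : ∀ j, σ j ∈ Set.Icc l u) (i : Fin n) (x : Fin n → ℝ) :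
    |nest h b x σ i - x i| ≤ u ^ 2 * ((h * l)⁻¹ * (6 * (u / l) * n)) := by
  have hu : 0 < u := hl.trans_le ((hσ i).1.trans (hσ i).2)
  have hs : 0 < σ i := hl.trans_le (hσ i).1
  have h1 := nest_update h b σ i x (x i)
  rw [Function.update_eq_self] at h1
  have h2 := abs_dkde_div_kde_le i hh hb hl hσ le_rfl x (x i)
  simp only [ne_eq, OfNat.ofNat_ne_zero, not_false_eq_true, zero_pow, neg_zero, zero_div,
    Real.exp_zero, mul_one, zero_add] at h2
  rw [h1, add_sub_cancel_left, abs_mul, abs_of_pos (by positivity : 0 < σ i ^ 2)]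
  gcongr
  exact (hσ i).2

section Bias

variable {Gμ Gσ : Measure ℝ} [IsProbabilityMeasure Gμ] [IsProbabilityMeasure Gσ]
  {n : ℕ} {h b l u C : ℝ} (hh : 0 < h) (hb : 0 < b) (hl : 0 < l)
  (hσ : ∀ᵐ s ∂Gσ, s ∈ Set.Icc l u) (hG : ∀ᵐ m ∂Gμ, |m| ≤ C)
  {ψ : ℝ → ℝ} (hψ : Measurable ψ) {T : ℝ} (hT : ∀ a, |ψ a| ≤ |a| + T) (i : Fin n)
include hh hb hl hσ hG hψ hT

omit hh hb hl hσ hG hT [IsProbabilityMeasure Gμ] [IsProbabilityMeasure Gσ] in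
theorem measurable_estError :
    Measurable (estError (fun x σ i => ψ (nest h b x σ i)) i) := by
  unfold estError
  exact (hψ.comp (measurable_nest h b i (by fun_prop) (by fun_prop))).sub (by fun_prop)

theorem integrable_estError_assemble :
    Integrable (fun p => estError (fun x σ i => ψ (nest h b x σ i)) i (assemble p))
      ((Measure.pi fun _ : Fin n => Gσ).prod (Measure.pi fun _ : Fin n => noiseLaw Gμ)) := by
  have hz : Integrable (fun p : (Fin n → ℝ) × (Fin n → ℝ × ℝ) => |(p.2 i).2|)
      ((Measure.pi fun _ : Fin n => Gσ).prod (Measure.pi fun _ : Fin n => noiseLaw Gμ)) := by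
    have h1 : Integrable (fun z : ℝ => z) (gaussianReal 0 1) := IsGaussian.integrable_id
    have h2 : MeasurePreserving (fun p : ℝ × ℝ => p.2) (noiseLaw Gμ) (gaussianReal 0 1) :=
      measurePreserving_snd
    have h3 := measurePreserving_eval (fun _ : Fin n => noiseLaw Gμ) i
    have h4 : MeasurePreserving Prod.snd ((Measure.pi fun _ : Fin n => Gσ).prod
      (Measure.pi fun _ : Fin n => noiseLaw Gμ)) (Measure.pi fun _ : Fin n => noiseLaw Gμ) :=
      measurePreserving_snd
    exact (h2.comp (h3.comp h4)).integrable_comp_of_integrable h1.abs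
  have hm : ∀ᵐ p ∂((Measure.pi fun _ : Fin n => Gσ).prod
      (Measure.pi fun _ : Fin n => noiseLaw Gμ)), |(p.2 i).1| ≤ C := by
    have h2 : MeasurePreserving (fun p : ℝ × ℝ => p.1) (noiseLaw Gμ) Gμ := measurePreserving_fst
    have h3 := measurePreserving_eval (fun _ : Fin n => noiseLaw Gμ) i
    have h4 : MeasurePreserving Prod.snd ((Measure.pi fun _ : Fin n => Gσ).prod
      (Measure.pi fun _ : Fin n => noiseLaw Gμ)) (Measure.pi fun _ : Fin n => noiseLaw Gμ) :=
      measurePreserving_snd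
    exact (h2.comp (h3.comp h4)).quasiMeasurePreserving.ae hG
  have hs : ∀ᵐ p ∂((Measure.pi fun _ : Fin n => Gσ).prod
      (Measure.pi fun _ : Fin n => noiseLaw Gμ)), ∀ j, p.1 j ∈ Set.Icc l u :=
    Measure.quasiMeasurePreserving_fst.ae (ae_pi_mem hσ)
  have hmeas : Measurable fun p : (Fin n → ℝ) × (Fin n → ℝ × ℝ) =>
      estError (fun x σ i => ψ (nest h b x σ i)) i (assemble p) :=
    (measurable_estError hψ i).comp (by unfold assemble; fun_prop)
  refine Integrable.mono' ((hz.const_mul u).add (integrable_const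
    (2 * C + T + u ^ 2 * ((h * l)⁻¹ * (6 * (u / l) * n))))) hmeas.aestronglyMeasurable ?_
  filter_upwards [hm, hs] with p hp1 hp2
  have h1 := abs_nest_sub_le hh hb hl hp2 i (obs p.1 p.2)
  have h2 := hT (nest h b (obs p.1 p.2) p.1 i)
  have h3 : estError (fun x σ i => ψ (nest h b x σ i)) i (assemble p) =
      ψ (nest h b (obs p.1 p.2) p.1 i) - (p.2 i).1 := rfl
  have h4 := abs_sub (ψ (nest h b (obs p.1 p.2) p.1 i)) (p.2 i).1
  have h5 := abs_add_le (p.2 i).1 (p.1 i * (p.2 i).2)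
  have h6 : obs p.1 p.2 i = (p.2 i).1 + p.1 i * (p.2 i).2 := rfl
  have h7 := abs_sub_abs_le_abs_sub (nest h b (obs p.1 p.2) p.1 i) (obs p.1 p.2 i)
  have h8 : |p.1 i * (p.2 i).2| ≤ u * |(p.2 i).2| := by
    rw [abs_mul, abs_of_pos (hl.trans_le (hp2 i).1)]
    exact mul_le_mul_of_nonneg_right (hp2 i).2 (abs_nonneg _)
  rw [Real.norm_eq_abs, h3]
  simp only [Pi.add_apply]
  rw [← h6] at h5
  linarith

omit hσ in
/-- Conditionally on the scales, the bias on the selected event is an integral over the value `x`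
of the selected observation, with the other observations averaged. -/
theorem integral_indicator_estError_eq (t : ℝ) {σ : Fin n → ℝ} (hσ' : ∀ j, σ j ∈ Set.Icc l u)
    (hint : Integrable (fun e => (Set.Ioi t).indicator
      (fun _ => ψ (nest h b (obs σ e) σ i) - (e i).1) (obs σ e i))
      (Measure.pi fun _ : Fin n => noiseLaw Gμ)) :
    ∫ e, (Set.Ioi t).indicator (fun _ => ψ (nest h b (obs σ e) σ i) - (e i).1) (obs σ e i)
      ∂(Measure.pi fun _ : Fin n => noiseLaw Gμ) =
    ∫ e, (∫ x in Set.Ioi t, (ψ (x + σ i ^ 2 *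
        (dkde h b σ i (obs σ e) x / kde h b σ i (obs σ e) x)) * mix Gμ (σ i) x -
        (x * mix Gμ (σ i) x + σ i ^ 2 * dmix Gμ (σ i) x)))
      ∂(Measure.pi fun _ : Fin n => noiseLaw Gμ) := by
  have hs : 0 < σ i := hl.trans_le (hσ' i).1
  rw [integral_pi_eq_integral_update (noiseLaw Gμ) i hint]
  refine integral_congr_ae (ae_of_all _ fun e => ?_)
  have h1 := integral_select hG hs (F := fun x => ψ (x + σ i ^ 2 *
        (dkde h b σ i (obs σ e) x / kde h b σ i (obs σ e) x)))
      (K := u ^ 2 * ((h * l)⁻¹ * (6 * (u / l) * n)) + T)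
      (hψ.comp (by
        have c1 : Continuous fun x => dkde h b σ i (obs σ e) x := by fun_prop
        have c2 : Continuous fun x => kde h b σ i (obs σ e) x := by fun_prop
        have := c1.measurable
        have := c2.measurable
        fun_prop))
      (fun x => by
        have a1 := abs_nest_sub_le hh hb hl hσ' i (Function.update (obs σ e) i x)
        rw [nest_update, Function.update_self] at a1
        refine (hT _).trans ?_
        have a2 := abs_sub_abs_le_abs_sub (x + σ i ^ 2 *
          (dkde h b σ i (obs σ e) x / kde h b σ i (obs σ e) x)) x
        linarith) t
  simp only
  rw [← h1]
  refine integral_congr_ae (ae_of_all _ fun d => ?_)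
  simp only [obs_update, Function.update_self, nest_update]
  by_cases hx : d.1 + σ i * d.2 ∈ Set.Ioi t
  · simp only [Set.indicator_of_mem hx]
  · simp only [Set.indicator_of_notMem hx]

/-- Fubini over the scales. The conditional bound is affine in the self-weight, so it averages to
the mean self-weight. -/
theorem abs_setIntegral_estError_le (t : ℝ) {a c : ℝ} (hc : 0 ≤ c)
    (hbias : ∀ σ : Fin n → ℝ, (∀ j, σ j ∈ Set.Icc l u) →
      |∫ e, (∫ x in Set.Ioi t, (ψ (x + σ i ^ 2 *
        (dkde h b σ i (obs σ e) x / kde h b σ i (obs σ e) x)) * mix Gμ (σ i) x -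
        (x * mix Gμ (σ i) x + σ i ^ 2 * dmix Gμ (σ i) x)))
      ∂(Measure.pi fun _ : Fin n => noiseLaw Gμ)| ≤ a + c * weight b σ (σ i) i) :
    |∫ D in {D | t < (D i).2.2}, estError (fun x σ i => ψ (nest h b x σ i)) i D
      ∂(dataLaw n Gμ Gσ)| ≤ a + c * (2 * ((u - l) / b + 1) / n) := by
  have hpos : ∀ᵐ s ∂Gσ, 0 < s := hσ.mono fun s hs => hl.trans_le hs.1
  have hmp := measurePreserving_assemble Gμ n hpos
  have hS : MeasurableSet {D : Fin n → ℝ × ℝ × ℝ | t < (D i).2.2} :=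
    measurableSet_lt measurable_const (by fun_prop)
  have hm := measurable_estError (h := h) (b := b) hψ i
  have hi := integrable_estError_assemble hh hb hl hσ hG hψ hT i
  have hS' : MeasurableSet {p : (Fin n → ℝ) × (Fin n → ℝ × ℝ) | t < obs p.1 p.2 i} :=
    measurableSet_lt measurable_const (by unfold obs; fun_prop)
  have hi' : Integrable (fun p : (Fin n → ℝ) × (Fin n → ℝ × ℝ) => (Set.Ioi t).indicator
      (fun _ => ψ (nest h b (obs p.1 p.2) p.1 i) - (p.2 i).1) (obs p.1 p.2 i))
      ((Measure.pi fun _ : Fin n => Gσ).prod (Measure.pi fun _ : Fin n => noiseLaw Gμ)) :=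
    hi.indicator hS'
  have h1 : ∫ D in {D | t < (D i).2.2}, estError (fun x σ i => ψ (nest h b x σ i)) i D
      ∂(dataLaw n Gμ Gσ) = ∫ σ, (∫ e, (Set.Ioi t).indicator
      (fun _ => ψ (nest h b (obs σ e) σ i) - (e i).1) (obs σ e i)
      ∂(Measure.pi fun _ : Fin n => noiseLaw Gμ)) ∂(Measure.pi fun _ : Fin n => Gσ) := by
    rw [← integral_indicator hS, ← hmp.map_eq, integral_map hmp.measurable.aemeasurable
      (hm.indicator hS).aestronglyMeasurable, ← integral_prod _ hi']
    rfl
  rw [h1, ← Real.norm_eq_abs]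
  have hwi := integrable_weight_self hb i (Measure.pi fun _ : Fin n => Gσ)
  refine (norm_integral_le_of_norm_le ((integrable_const a).add (hwi.const_mul c)) ?_).trans ?_
  · filter_upwards [ae_pi_mem hσ, hi'.prod_right_ae] with σ hσ1 hσ2
    rw [integral_indicator_estError_eq hh hb hl hG hψ hT i t hσ1 hσ2]
    exact hbias σ hσ1
  · rw [integral_add' (integrable_const a) (hwi.const_mul c), integral_const_mul]
    simp only [integral_const, probReal_univ, one_smul]
    exact add_le_add le_rfl (mul_le_mul_of_nonneg_left (integral_weight_self_le Gσ hb hσ i) hc)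

theorem integrable_estError_selectedLaw (t : ℝ) :
    Integrable (estError (fun x σ i => ψ (nest h b x σ i)) i) (selectedLaw Gμ Gσ t i) := by
  have hpos : ∀ᵐ s ∂Gσ, 0 < s := hσ.mono fun s hs => hl.trans_le hs.1
  have hmp := measurePreserving_assemble Gμ n hpos
  have hi := (hmp.integrable_comp
    (measurable_estError (h := h) (b := b) hψ i).aestronglyMeasurable).1
    (integrable_estError_assemble hh hb hl hσ hG hψ hT i)
  unfold selectedLaw
  by_cases h0 : dataLaw n Gμ Gσ {D | t < (D i).2.2} = 0
  · rw [cond_eq_zero_of_meas_eq_zero h0]; exact integrable_zero_measure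
  · exact hi.restrict.smul_measure (ENNReal.inv_ne_top.2 h0)

omit hh hb hG hψ hT in
theorem dataLaw_select_eq (t : ℝ) :
    (dataLaw n Gμ Gσ).real {D | t < (D i).2.2} = (tripleLaw Gμ Gσ).real {p | t < p.2.2} := by
  have hpos : ∀ᵐ s ∂Gσ, 0 < s := hσ.mono fun s hs => hl.trans_le hs.1
  have := isProbabilityMeasure_tripleLaw Gμ hpos
  have h := measurePreserving_eval (fun _ : Fin n => tripleLaw Gμ Gσ) i
  have hS : MeasurableSet {p : ℝ × ℝ × ℝ | t < p.2.2} :=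
    measurableSet_lt measurable_const (by fun_prop)
  exact congrArg ENNReal.toReal (h.measure_preimage hS.nullMeasurableSet)

omit hh hb hG hψ hT in
theorem integral_selectedLaw_eq (t : ℝ) (f : (Fin n → ℝ × ℝ × ℝ) → ℝ) :
    ∫ D, f D ∂(selectedLaw Gμ Gσ t i) = ((tripleLaw Gμ Gσ).real {p | t < p.2.2})⁻¹ *
      ∫ D in {D | t < (D i).2.2}, f D ∂(dataLaw n Gμ Gσ) := by
  rw [selectedLaw, ProbabilityTheory.cond, integral_smul_measure, ← dataLaw_select_eq hl hσ i t, smul_eq_mul,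
    ENNReal.toReal_inv]
  rfl

end Bias

/-! ### Conditional bias bounds for the plain and the truncated estimator -/

section FixedSize

variable {G : Measure ℝ} [IsProbabilityMeasure G] {n : ℕ} {h b l u C N k t : ℝ}
  {σ : Fin n → ℝ} (i : Fin n)
  (H : Regime G n h b l u C N k t) (hσ : ∀ j, σ j ∈ Set.Icc l u)
include H hσ

omit [IsProbabilityMeasure G] in
theorem Regime.scale_sq_le : σ i ^ 2 ≤ k ^ 2 := by
  have := H.scale_pos i hσ
  gcongr
  exact (hσ i).2.trans H.u_le

theorem Regime.abs_bias_id_le {θ : ℝ} (hθ : 0 < θ) :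
    |∫ e, (∫ x in Set.Ioi t, ((x + σ i ^ 2 *
        (dkde h b σ i (obs σ e) x / kde h b σ i (obs σ e) x)) * mix G (σ i) x -
        (x * mix G (σ i) x + σ i ^ 2 * dmix G (σ i) x)))
      ∂(Measure.pi fun _ : Fin n => noiseLaw G)| ≤
      1056 * k ^ 10 * N ^ 5 * (θ + (1 + θ⁻¹) * (weight b σ (σ i) i / h ^ 1) + (b + h ^ 2)) +
        9 * tailConst u * k ^ 8 * (N / h * Real.exp (-(N ^ 2) / (4 * u ^ 2))) := by
  have hN := H.one_le
  have hk := H.one_le_k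
  have hh := H.h_pos
  have hb := H.b_pos
  have hw := weight_nonneg σ hb (σ i) i
  have hJ := tailConst_nonneg u
  -- The terms in `x` cancel and leave `σ i ^ 2` times the score difference.
  have e1 : ∀ e x, (x + σ i ^ 2 *
        (dkde h b σ i (obs σ e) x / kde h b σ i (obs σ e) x)) * mix G (σ i) x -
        (x * mix G (σ i) x + σ i ^ 2 * dmix G (σ i) x) =
      σ i ^ 2 * scoreDiff G h b σ i (obs σ e) x := by
    intro e x; unfold scoreDiff; ring
  simp_rw [e1, integral_const_mul]
  rw [abs_mul, abs_of_nonneg (sq_nonneg _), pow_one]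
  refine (mul_le_mul (H.scale_sq_le i hσ) (H.abs_integral_scoreDiff_le i hσ hθ) (abs_nonneg _)
    (by positivity)).trans ?_
  rw [mul_add]
  refine add_le_add ?_ (le_of_eq (by ring))
  have h1 : k ^ 9 ≤ k ^ 10 := pow_le_pow_right₀ hk (by norm_num)
  calc _ = 1056 * k ^ 9 * N ^ 5 *
      (θ + (1 + θ⁻¹) * (weight b σ (σ i) i / h) + (b + h ^ 2)) := by ring
    _ ≤ _ := by gcongr

/-- The map `ψ` fixes the posterior mean, which lies in `[-C, C]`, so the integrand is a difference
of two values of `ψ` and is dominated by the score difference. Its signed form is lost, so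
integration by parts is not available. -/
theorem Regime.abs_bias_lipschitz_le {θ : ℝ} (hθ : 0 < θ) (hNb : 54 * k ^ 5 * N ^ 3 * b ≤ 1)
    {ψ : ℝ → ℝ} (hψ : ∀ v w, |ψ v - ψ w| ≤ |v - w|) (hψC : ∀ v, |v| ≤ C → ψ v = v) :
    |∫ e, (∫ x in Set.Ioi t, (ψ (x + σ i ^ 2 *
        (dkde h b σ i (obs σ e) x / kde h b σ i (obs σ e) x)) * mix G (σ i) x -
        (x * mix G (σ i) x + σ i ^ 2 * dmix G (σ i) x)))
      ∂(Measure.pi fun _ : Fin n => noiseLaw G)| ≤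
      1056 * k ^ 10 * N ^ 5 * (θ + (1 + θ⁻¹) * (weight b σ (σ i) i / h ^ 3) + (b + h ^ 2)) +
        9 * tailConst u * k ^ 8 * (N / h * Real.exp (-(N ^ 2) / (4 * u ^ 2))) := by
  have hN := H.one_le
  have hk := H.one_le_k
  have hh := H.h_pos
  have hb := H.b_pos
  have hs := H.scale_pos i hσ
  have hw := weight_nonneg σ hb (σ i) i
  refine (H.abs_integral_le_of_le_scoreDiff i hσ hθ hNb (c := k ^ 2) (by positivity)
    fun e x => ?_).trans ?_
  · have hm := mix_pos H.mean hs x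
    set f := mix G (σ i) x with hf
    set f' := dmix G (σ i) x with hf'
    set r := dkde h b σ i (obs σ e) x / kde h b σ i (obs σ e) x with hr
    have h1 : ψ (x + σ i ^ 2 * (f' / f)) = x + σ i ^ 2 * (f' / f) := by
      apply hψC
      have h2 := abs_mul_mix_add_le H.mean hs x
      rw [← hf, ← hf'] at h2
      have h3 : x + σ i ^ 2 * (f' / f) = (x * f + σ i ^ 2 * f') / f := by field_simp
      rw [h3, abs_div, abs_of_pos hm, div_le_iff₀ hm]
      exact h2
    have h4 : ψ (x + σ i ^ 2 * r) * f - (x * f + σ i ^ 2 * f') =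
        (ψ (x + σ i ^ 2 * r) - ψ (x + σ i ^ 2 * (f' / f))) * f := by
      rw [h1]; field_simp
    have h5 : scoreDiff G h b σ i (obs σ e) x = (r - f' / f) * f := by
      unfold scoreDiff
      rw [← hr, ← hf, ← hf']
      field_simp
    rw [h4, h5, abs_mul, abs_mul, abs_of_pos hm, ← mul_assoc]
    refine mul_le_mul_of_nonneg_right ((hψ _ _).trans ?_) hm.le
    rw [add_sub_add_left_eq_sub, ← mul_sub, abs_mul, abs_of_nonneg (sq_nonneg _)]
    exact mul_le_mul_of_nonneg_right (H.scale_sq_le i hσ) (abs_nonneg _)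
  · rw [mul_add]
    refine add_le_add ?_ (le_of_eq (by ring))
    have h1 : N ^ 3 ≤ N ^ 5 := pow_le_pow_right₀ hN (by norm_num)
    calc _ = 96 * k ^ 10 * N ^ 3 *
        (θ + (1 + θ⁻¹) * (weight b σ (σ i) i / h ^ 3) + (b + h ^ 2)) := by ring
      _ ≤ _ := by gcongr; norm_num

end FixedSize

/-! ### Rates as the sample size grows -/

section Asymptotics

theorem tendsto_rpow_neg {e : ℝ} (he : e < 0) :
    Tendsto (fun n : ℕ => (n : ℝ) ^ e) atTop (nhds 0) := by
  have := (tendsto_rpow_neg_atTop (neg_pos.2 he)).comp tendsto_natCast_atTop_atTop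
  simpa [Function.comp_def] using this

theorem isBigO_mul_rpow {f g : ℕ → ℝ} {c d : ℝ} (hf : f =O[atTop] fun n : ℕ => (n : ℝ) ^ c)
    (hg : g =O[atTop] fun n : ℕ => (n : ℝ) ^ d) :
    (fun n => f n * g n) =O[atTop] fun n : ℕ => (n : ℝ) ^ (c + d) := by
  refine (hf.mul hg).trans (EventuallyEq.isBigO ?_)
  filter_upwards [eventually_gt_atTop 0] with n hn
  rw [Real.rpow_add (by exact_mod_cast hn)]

theorem isBigO_pow_rpow {f : ℕ → ℝ} {c : ℝ} (hf : f =O[atTop] fun n : ℕ => (n : ℝ) ^ c) (q : ℕ) :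
    (fun n => f n ^ q) =O[atTop] fun n : ℕ => (n : ℝ) ^ (q * c) := by
  refine (hf.pow q).trans (EventuallyEq.isBigO ?_)
  filter_upwards with n
  rw [mul_comm, Real.rpow_mul (by positivity), Real.rpow_natCast]

theorem isBigO_inv_rpow {f : ℕ → ℝ} {c : ℝ} (hf : f =Θ[atTop] fun n : ℕ => (n : ℝ) ^ (-c)) :
    (fun n => (f n)⁻¹) =O[atTop] fun n : ℕ => (n : ℝ) ^ c := by
  refine hf.inv.isBigO.trans (EventuallyEq.isBigO ?_)
  filter_upwards with n
  rw [Real.rpow_neg (by positivity), inv_inv]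

theorem tendsto_zero_of_isBigO_rpow {f : ℕ → ℝ} {c : ℝ} (hc : c < 0)
    (hf : f =O[atTop] fun n : ℕ => (n : ℝ) ^ c) : Tendsto f atTop (nhds 0) :=
  hf.trans_tendsto (tendsto_rpow_neg hc)

theorem isBigO_exp_neg_rpow {c ρ : ℝ} (hc : 0 < c) (hρ : 0 < ρ) (d : ℝ) :
    (fun n : ℕ => Real.exp (-c * ((n : ℝ) ^ ρ) ^ 2)) =O[atTop] fun n : ℕ => (n : ℝ) ^ d := by
  have h1 : Tendsto (fun n : ℕ => (n : ℝ) ^ (2 * ρ)) atTop atTop :=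
    (tendsto_rpow_atTop (by positivity)).comp tendsto_natCast_atTop_atTop
  have h2 := (isLittleO_exp_neg_mul_rpow_atTop hc (d / (2 * ρ))).isBigO.comp_tendsto h1
  refine (EventuallyEq.isBigO ?_).trans (h2.trans (EventuallyEq.isBigO ?_))
  · filter_upwards with n
    simp only [Function.comp]
    rw [mul_comm 2 ρ, Real.rpow_mul (by positivity)]
    norm_num
  · filter_upwards with n
    simp only [Function.comp]
    rw [← Real.rpow_mul (by positivity)]
    congr 1
    field_simp

/-- The final error bound, multiplied by the inverse of the selection probability, tends to 0. -/
theorem tendsto_rate {bx bs : ℕ → ℝ} {ηx ηs a ρ c : ℝ} {q : ℕ}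
    (hbx' : bx =Θ[atTop] fun n : ℕ => (n : ℝ) ^ (-ηx))
    (hbs' : bs =Θ[atTop] fun n : ℕ => (n : ℝ) ^ (-ηs))
    (hρ : 0 < ρ) (hc : 0 < c) (ha : a = (1 - q * ηx - ηs) / 2) (hρa : 6 * ρ < a)
    (hρs : 6 * ρ < ηs) (hρx : 6 * ρ < 2 * ηx) :
    Tendsto (fun n : ℕ => (n : ℝ) ^ ρ * (((n : ℝ) ^ ρ) ^ 5 *
      ((n : ℝ) ^ (-a) + (1 + ((n : ℝ) ^ (-a))⁻¹) * ((n : ℝ)⁻¹ * (bs n)⁻¹ * ((bx n)⁻¹) ^ q) +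
        (bs n + bx n ^ 2)) + (n : ℝ) ^ ρ * (bx n)⁻¹ *
          Real.exp (-c * ((n : ℝ) ^ ρ) ^ 2))) atTop (nhds 0) := by
  have hN : (fun n : ℕ => (n : ℝ) ^ ρ) =O[atTop] fun n : ℕ => (n : ℝ) ^ ρ := isBigO_refl _ _
  have hN5 := isBigO_mul_rpow hN (isBigO_pow_rpow hN 5)
  have hθ : (fun n : ℕ => (n : ℝ) ^ (-a)) =O[atTop] fun n : ℕ => (n : ℝ) ^ (-a) :=
    isBigO_refl _ _
  have hn : (fun n : ℕ => (n : ℝ)⁻¹) =O[atTop] fun n : ℕ => (n : ℝ) ^ (-1 : ℝ) := by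
    refine EventuallyEq.isBigO ?_
    filter_upwards with n
    rw [Real.rpow_neg_one]
  have hθi : (fun n : ℕ => ((n : ℝ) ^ (-a))⁻¹) =O[atTop] fun n : ℕ => (n : ℝ) ^ a := by
    refine EventuallyEq.isBigO ?_
    filter_upwards with n
    rw [Real.rpow_neg (by positivity), inv_inv]
  -- The exponent of this variance term is `-1 + ηs + q * ηx = -2 * a`, so that dividing by `θ`
  -- leaves `-a`; the factors `N` contribute `6 * ρ` in all.
  have hW := isBigO_mul_rpow (isBigO_mul_rpow hn (isBigO_inv_rpow hbs'))
    (isBigO_pow_rpow (isBigO_inv_rpow hbx') q)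
  have t1 := tendsto_zero_of_isBigO_rpow (by norm_num; linarith) (isBigO_mul_rpow hN5 hθ)
  have t2 := tendsto_zero_of_isBigO_rpow (by norm_num; linarith) (isBigO_mul_rpow hN5 hW)
  have t3 := tendsto_zero_of_isBigO_rpow (by norm_num; linarith)
    (isBigO_mul_rpow hN5 (isBigO_mul_rpow hθi hW))
  have t4 := tendsto_zero_of_isBigO_rpow (by norm_num; linarith)
    (isBigO_mul_rpow hN5 hbs'.isBigO)
  have t5 := tendsto_zero_of_isBigO_rpow (by norm_num; linarith)
    (isBigO_mul_rpow hN5 (isBigO_pow_rpow hbx'.isBigO 2))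
  -- The exponential beats every power; the power is chosen so that the total exponent is `-1`.
  have t6 := tendsto_zero_of_isBigO_rpow (by linarith)
    (isBigO_mul_rpow hN (isBigO_mul_rpow (isBigO_mul_rpow hN (isBigO_inv_rpow hbx'))
      (isBigO_exp_neg_rpow hc hρ (-(2 * ρ + ηx + 1)))))
  have t := ((((t1.add t2).add t3).add t4).add t5).add t6
  simp only [add_zero] at t
  refine t.congr fun n => ?_
  ring

end Asymptotics

/-- A constant that dominates all constants depending on the range `[l, u]` of the scales. -/
noncomputable def rangeConst (l u : ℝ) : ℝ := 1 + l⁻¹ + |u| + |Real.log l| + |Real.log u|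

theorem eventually_regime {Gμ : ℕ → Measure ℝ} {C : ℕ → ℝ}
    (hC : ∀ ε : ℝ, 0 < ε → C =o[atTop] fun n : ℕ => (n : ℝ) ^ ε)
    (hμ : ∀ n, ∀ᵐ m ∂(Gμ n), |m| ≤ C n) {l u : ℝ} (hl : 0 < l) {ηx ηs : ℝ} (hηx : 0 < ηx)
    {bx bs : ℕ → ℝ} (hbx : ∀ n, 0 < bx n) (hbs : ∀ n, 0 < bs n)
    (hbx' : bx =Θ[atTop] fun n : ℕ => (n : ℝ) ^ (-ηx))
    (hbs' : bs =Θ[atTop] fun n : ℕ => (n : ℝ) ^ (-ηs)) (t : ℝ) {ρ : ℝ} (hρ : 0 < ρ)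
    (hρs : 3 * ρ < ηs) :
    ∀ᶠ n : ℕ in atTop, 1 ≤ n ∧ bs n ≤ 1 ∧
      54 * rangeConst l u ^ 5 * ((n : ℝ) ^ ρ) ^ 3 * bs n ≤ 1 ∧
      Regime (Gμ n) n (bx n) (bs n) l u (C n) ((n : ℝ) ^ ρ) (rangeConst l u) t := by
  have hNtop : Tendsto (fun n : ℕ => (n : ℝ) ^ ρ) atTop atTop :=
    (tendsto_rpow_atTop hρ).comp tendsto_natCast_atTop_atTop
  have hk : 1 ≤ rangeConst l u := by
    have := abs_nonneg u
    have := abs_nonneg (Real.log l)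
    have := abs_nonneg (Real.log u)
    have : 0 < l⁻¹ := by positivity
    unfold rangeConst; linarith
  have hli : l⁻¹ ≤ rangeConst l u := by
    have := abs_nonneg u
    have := abs_nonneg (Real.log l)
    have := abs_nonneg (Real.log u)
    unfold rangeConst; linarith
  have hu : u ≤ rangeConst l u := by
    have := le_abs_self u
    have := abs_nonneg (Real.log l)
    have := abs_nonneg (Real.log u)
    have : 0 < l⁻¹ := by positivity
    unfold rangeConst; linarith
  have hll : |Real.log l| ≤ rangeConst l u := by
    have := abs_nonneg u
    have := abs_nonneg (Real.log u)
    have : 0 < l⁻¹ := by positivity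
    unfold rangeConst; linarith
  have hlu : |Real.log u| ≤ rangeConst l u := by
    have := abs_nonneg u
    have := abs_nonneg (Real.log l)
    have : 0 < l⁻¹ := by positivity
    unfold rangeConst; linarith
  have hbx0 := tendsto_zero_of_isBigO_rpow (by linarith) hbx'.isBigO
  have hbs0 := tendsto_zero_of_isBigO_rpow (by linarith) hbs'.isBigO
  have hNb := tendsto_zero_of_isBigO_rpow (by norm_num; linarith) (isBigO_mul_rpow
    (isBigO_pow_rpow (isBigO_refl (fun n : ℕ => (n : ℝ) ^ ρ) atTop) 3) hbs'.isBigO)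
  have hNb' := hNb.const_mul (54 * rangeConst l u ^ 5)
  rw [mul_zero] at hNb'
  -- Gives `1 / bx n ≤ n ^ (ηx + 1)` for large `n`; the spare power of `n` absorbs the unknown
  -- constant in the order of `bx`.
  have hinv := tendsto_zero_of_isBigO_rpow (c := -1) (by norm_num)
    ((isBigO_mul_rpow (isBigO_inv_rpow hbx')
      (isBigO_refl (fun n : ℕ => (n : ℝ) ^ (-ηx - 1)) atTop)).congr_right fun n => by ring_nf)
  have hlog : (fun n : ℕ => Real.log n) =o[atTop] fun n : ℕ => (n : ℝ) ^ ρ :=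
    (isLittleO_log_rpow_atTop hρ).comp_tendsto tendsto_natCast_atTop_atTop
  filter_upwards [eventually_ge_atTop 1, hbs0.eventually_le_const one_pos,
    hbx0.eventually_le_const one_pos, hNb'.eventually_le_const one_pos,
    hNtop.eventually_ge_atTop 4, hNtop.eventually_ge_atTop |t|,
    hinv.eventually_le_const one_pos, (hC ρ hρ).bound one_pos,
    hlog.bound (by positivity : 0 < (ηx + 1)⁻¹)] with n hn h1 h2 h3 h4 h5 h6 h7 h8
  have hn0 : (0 : ℝ) < n := by exact_mod_cast hn
  have hN0 : 0 < (n : ℝ) ^ ρ := by positivity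
  have hlogn : 0 ≤ Real.log n := Real.log_nonneg (by exact_mod_cast hn)
  rw [Real.norm_eq_abs, Real.norm_eq_abs, abs_of_pos hN0, abs_of_nonneg hlogn] at h8
  have h8' : (ηx + 1) * Real.log n ≤ (n : ℝ) ^ ρ := by
    calc (ηx + 1) * Real.log n ≤ (ηx + 1) * ((ηx + 1)⁻¹ * (n : ℝ) ^ ρ) := by gcongr
      _ = _ := by field_simp
  have hlogN : Real.log n ≤ (n : ℝ) ^ ρ := by nlinarith
  refine ⟨hn, h1, by linarith, hbx n, h2, hbs n, hl, hμ n, by linarith, ?_, h5, hlogN, ?_, ?_, hk,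
    hli, hu, hll, hlu⟩
  · rw [Real.norm_eq_abs, Real.norm_eq_abs, abs_of_pos hN0, one_mul] at h7
    exact (le_abs_self _).trans h7
  · rw [abs_of_nonpos (Real.log_nonpos (hbx n).le h2), ← Real.log_inv]
    have h9 : (bx n)⁻¹ ≤ (n : ℝ) ^ (ηx + 1) := by
      have : (n : ℝ) ^ (-ηx - 1) = ((n : ℝ) ^ (ηx + 1))⁻¹ := by
        rw [← Real.rpow_neg hn0.le]; ring_nf
      rw [this, mul_inv_le_iff₀ (by positivity), one_mul] at h6
      exact h6
    have h10 := Real.log_le_log (inv_pos.2 (hbx n)) h9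
    rw [Real.log_rpow hn0] at h10
    linarith
  · calc (n : ℝ) * Real.exp (-(((n : ℝ) ^ ρ) ^ 2) / 4)
        = Real.exp (Real.log n + -(((n : ℝ) ^ ρ) ^ 2) / 4) := by
          rw [Real.exp_add, Real.exp_log hn0]
      -- Once `N ≥ 4`, one has `log n ≤ N ≤ N² / 4`.
      _ ≤ 1 := by
          rw [Real.exp_le_one_iff]
          nlinarith

/-- Common to all estimators: `q` is the power of the bandwidth in the variance, 1 for the plain and
3 for the truncated estimator. The choice `θ = n ^ (-a)` balances `θ` against `θ⁻¹ / (n b h ^ q)`,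
and division by the selection probability costs at most one factor `N`. -/
theorem vanishingSelectionBias_of_bias_le {Gμ Gσ : ℕ → Measure ℝ}
    [∀ n, IsProbabilityMeasure (Gμ n)] [∀ n, IsProbabilityMeasure (Gσ n)] {C : ℕ → ℝ}
    (hC : ∀ ε : ℝ, 0 < ε → C =o[atTop] fun n : ℕ => (n : ℝ) ^ ε)
    (hμ : ∀ n, ∀ᵐ m ∂(Gμ n), |m| ≤ C n) {l u : ℝ} (hl : 0 < l)
    (hσ : ∀ n, ∀ᵐ s ∂(Gσ n), s ∈ Set.Icc l u) {ηx ηs : ℝ} (hηx : 0 < ηx) (hηs : 0 < ηs)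
    {bx bs : ℕ → ℝ} (hbx : ∀ n, 0 < bx n) (hbs : ∀ n, 0 < bs n)
    (hbx' : bx =Θ[atTop] fun n : ℕ => (n : ℝ) ^ (-ηx))
    (hbs' : bs =Θ[atTop] fun n : ℕ => (n : ℝ) ^ (-ηs)) {t : ℝ}
    (ht : ∀ ε : ℝ, 0 < ε → ∀ᶠ n : ℕ in atTop,
      (n : ℝ) ^ (-ε) ≤ (tripleLaw (Gμ n) (Gσ n)).real {p | t < p.2.2})
    {q : ℕ} (hq : q * ηx + ηs < 1) {ψ : ℕ → ℝ → ℝ} (hψ : ∀ n, Measurable (ψ n)) {T : ℕ → ℝ}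
    (hT : ∀ n v, |ψ n v| ≤ |v| + T n)
    (hbias : ∀ᶠ n in atTop, ∀ (N θ : ℝ) (i : Fin n) (σ : Fin n → ℝ), 0 < θ →
      (∀ j, σ j ∈ Set.Icc l u) →
      Regime (Gμ n) n (bx n) (bs n) l u (C n) N (rangeConst l u) t →
      54 * rangeConst l u ^ 5 * N ^ 3 * bs n ≤ 1 →
      |∫ e, (∫ x in Set.Ioi t, (ψ n (x + σ i ^ 2 * (dkde (bx n) (bs n) σ i (obs σ e) x /
          kde (bx n) (bs n) σ i (obs σ e) x)) * mix (Gμ n) (σ i) x -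
          (x * mix (Gμ n) (σ i) x + σ i ^ 2 * dmix (Gμ n) (σ i) x)))
        ∂(Measure.pi fun _ : Fin n => noiseLaw (Gμ n))| ≤
      1056 * rangeConst l u ^ 10 * N ^ 5 *
        (θ + (1 + θ⁻¹) * (weight (bs n) σ (σ i) i / bx n ^ q) + (bs n + bx n ^ 2)) +
        9 * tailConst u * rangeConst l u ^ 8 *
          (N / bx n * Real.exp (-(N ^ 2) / (4 * u ^ 2)))) :
    VanishingSelectionBias Gμ Gσ t fun n x σ i => ψ n (nest (bx n) (bs n) x σ i) := by
  refine ⟨fun n i => integrable_estError_selectedLaw (hbx n) (hbs n) hl (hσ n) (hμ n) (hψ n)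
    (hT n) i t, fun ε hε => ?_⟩
  have hu : 0 < u := by
    obtain ⟨s, hs⟩ := (hσ 0).exists
    exact hl.trans_le (hs.1.trans hs.2)
  set k := rangeConst l u with hk
  set a := (1 - q * ηx - ηs) / 2 with ha
  have ha0 : 0 < a := by rw [ha]; linarith
  -- Six powers of `N = n ^ ρ` have to be absorbed, five from the bias bound and one from the
  -- selection probability; dividing by 7 makes the inequalities strict.
  set ρ := min a (min ηs ηx) / 7 with hρ
  have hmin : 0 < min a (min ηs ηx) := lt_min ha0 (lt_min hηs hηx)
  have hρ0 : 0 < ρ := by positivity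
  have hρa : 6 * ρ < a := by have := min_le_left a (min ηs ηx); rw [hρ]; linarith
  have hρs : 6 * ρ < ηs := by
    have := (min_le_right a (min ηs ηx)).trans (min_le_left _ _); rw [hρ]; linarith
  have hρx : 6 * ρ < 2 * ηx := by
    have := (min_le_right a (min ηs ηx)).trans (min_le_right _ _); rw [hρ]; linarith
  set K := 4224 * k ^ 11 + 9 * tailConst u * k ^ 8 with hK
  have hrate := (tendsto_rate hbx' hbs' hρ0 (by positivity : 0 < (4 * u ^ 2)⁻¹) ha hρa hρs
    hρx).const_mul K
  rw [mul_zero] at hrate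
  filter_upwards [hrate.eventually_lt_const hε, hbias, ht ρ hρ0,
    eventually_regime hC hμ hl hηx hbx hbs hbx' hbs' t (u := u) hρ0 (by linarith)]
    with n h1 h2 h3 h4 i
  obtain ⟨hn, hb1, hNb, H⟩ := h4
  have hn0 : (0 : ℝ) < n := by exact_mod_cast hn
  set N := (n : ℝ) ^ ρ with hN
  set θ := (n : ℝ) ^ (-a) with hθ
  have hN1 : 1 ≤ N := H.one_le
  have hk1 : 1 ≤ k := H.one_le_k
  have hθ0 : 0 < θ := by positivity
  have hb0 := hbs n
  have hx0 := hbx n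
  have hJ := tailConst_nonneg u
  set E := Real.exp (-(N ^ 2) / (4 * u ^ 2)) with hE
  have hE' : Real.exp (-(4 * u ^ 2)⁻¹ * N ^ 2) = E := by
    rw [hE]; congr 1; field_simp
  rw [hE'] at h1
  -- The bound is regrouped as `a + c * W`, where `c` collects the coefficient of the self-weight.
  have hmain := abs_setIntegral_estError_le (n := n) hx0 hb0 hl (hσ n) (hμ n) (hψ n) (hT n) i t
    (a := 1056 * k ^ 10 * N ^ 5 * (θ + (bs n + bx n ^ 2)) +
      9 * tailConst u * k ^ 8 * (N / bx n * E))
    (c := 1056 * k ^ 10 * N ^ 5 * ((1 + θ⁻¹) * (bx n ^ q)⁻¹)) (by positivity)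
    (fun σ hσ' => (h2 N θ i σ hθ0 hσ' H hNb).trans (le_of_eq (by ring)))
  have hW : 2 * ((u - l) / bs n + 1) / n ≤ 4 * k * ((n : ℝ)⁻¹ * (bs n)⁻¹) := by
    have e1 : (u - l) / bs n + 1 ≤ 2 * k / bs n := by
      rw [div_add_one hb0.ne']
      gcongr
      linarith [H.u_le]
    calc 2 * ((u - l) / bs n + 1) / n ≤ 2 * (2 * k / bs n) / n := by gcongr
      _ = _ := by field_simp; norm_num
  have hfinal : |∫ D in {D | t < (D i).2.2},
      estError (fun x σ i => ψ n (nest (bx n) (bs n) x σ i)) i D ∂(dataLaw n (Gμ n) (Gσ n))| ≤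
      K * (N ^ 5 * (θ + (1 + θ⁻¹) * ((n : ℝ)⁻¹ * (bs n)⁻¹ * ((bx n)⁻¹) ^ q) +
        (bs n + bx n ^ 2)) + N * (bx n)⁻¹ * E) := by
    refine hmain.trans ?_
    set V := (n : ℝ)⁻¹ * (bs n)⁻¹ * ((bx n)⁻¹) ^ q with hV
    have hV0 : 0 ≤ V := by positivity
    have hk10 : k ^ 10 ≤ k ^ 11 := pow_le_pow_right₀ hk1 (by norm_num)
    calc _ ≤ 1056 * k ^ 10 * N ^ 5 * (θ + (bs n + bx n ^ 2)) +
          9 * tailConst u * k ^ 8 * (N / bx n * E) +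
          1056 * k ^ 10 * N ^ 5 * ((1 + θ⁻¹) * (bx n ^ q)⁻¹) *
            (4 * k * ((n : ℝ)⁻¹ * (bs n)⁻¹)) := by gcongr
      _ = 1056 * k ^ 10 * (N ^ 5 * (θ + (bs n + bx n ^ 2))) +
          9 * tailConst u * k ^ 8 * (N * (bx n)⁻¹ * E) +
          4224 * k ^ 11 * (N ^ 5 * ((1 + θ⁻¹) * V)) := by
          rw [hV, inv_pow]; ring
      _ ≤ 4224 * k ^ 11 * (N ^ 5 * (θ + (bs n + bx n ^ 2))) +
          (4224 * k ^ 11 * (N * (bx n)⁻¹ * E) + 9 * tailConst u * k ^ 8 *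
            (N ^ 5 * (θ + (1 + θ⁻¹) * V + (bs n + bx n ^ 2)) + N * (bx n)⁻¹ * E)) +
          4224 * k ^ 11 * (N ^ 5 * ((1 + θ⁻¹) * V)) := by
          have c1 : 1056 * k ^ 10 ≤ 4224 * k ^ 11 := by
            have : 0 ≤ k ^ 11 := by positivity
            linarith
          have c2 : 0 ≤ 4224 * k ^ 11 * (N * (bx n)⁻¹ * E) := by positivity
          have c3 : 9 * tailConst u * k ^ 8 * (N * (bx n)⁻¹ * E) ≤ 9 * tailConst u * k ^ 8 *
              (N ^ 5 * (θ + (1 + θ⁻¹) * V + (bs n + bx n ^ 2)) + N * (bx n)⁻¹ * E) :=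
            mul_le_mul_of_nonneg_left (le_add_of_nonneg_left (by positivity)) (by positivity)
          refine add_le_add (add_le_add ?_ (by linarith)) le_rfl
          exact mul_le_mul_of_nonneg_right c1 (by positivity)
      _ = _ := by rw [hK]; ring
  have hp : 0 < (tripleLaw (Gμ n) (Gσ n)).real {p | t < p.2.2} :=
    lt_of_lt_of_le (by positivity) h3
  have hpi : ((tripleLaw (Gμ n) (Gσ n)).real {p | t < p.2.2})⁻¹ ≤ N := by
    refine (inv_anti₀ (by positivity) h3).trans (le_of_eq ?_)
    rw [Real.rpow_neg hn0.le, inv_inv]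
  rw [integral_selectedLaw_eq hl (hσ n) i t, abs_mul, abs_of_pos (inv_pos.2 hp)]
  calc _ ≤ N * (K * (N ^ 5 * (θ + (1 + θ⁻¹) * ((n : ℝ)⁻¹ * (bs n)⁻¹ * ((bx n)⁻¹) ^ q) +
        (bs n + bx n ^ 2)) + N * (bx n)⁻¹ * E)) :=
        mul_le_mul hpi hfinal (abs_nonneg _) (by linarith)
    _ = _ := by ring
    _ < ε := h1

theorem abs_min_sub_min_le (v w τ : ℝ) : |min v τ - min w τ| ≤ |v - w| := by
  have := abs_min_sub_min_le_max v τ w τ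
  simpa using this

theorem abs_max_sub_max_le (v w τ : ℝ) : |max τ v - max τ w| ≤ |v - w| := by
  have := abs_max_sub_max_le_max τ v τ w
  simpa using this

end NEST

theorem theorem4p3
    (Gμ Gσ : ℕ → Measure ℝ)
    [∀ n, IsProbabilityMeasure (Gμ n)] [∀ n, IsProbabilityMeasure (Gσ n)]
    -- the means are bounded by a sequence that grows slower than every power of `n`
    (C : ℕ → ℝ)
    (hC : ∀ ε : ℝ, 0 < ε → C =o[atTop] fun n : ℕ => (n : ℝ) ^ ε)
    (hμ : ∀ n, ∀ᵐ m ∂(Gμ n), |m| ≤ C n)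
    -- the standard deviations are uniformly bounded above and away from zero
    (σl σu : ℝ) (hσl : 0 < σl)
    (hσ : ∀ n, ∀ᵐ s ∂(Gσ n), s ∈ Set.Icc σl σu)
    -- the bandwidths
    (ηx ηs : ℝ) (hηx : 0 < ηx) (hηs : 0 < ηs) (hη : ηx + ηs < 1)
    (bx bs : ℕ → ℝ) (hbx : ∀ n, 0 < bx n) (hbs : ∀ n, 0 < bs n)
    (hbx' : bx =Θ[atTop] fun n : ℕ => (n : ℝ) ^ (-ηx))
    (hbs' : bs =Θ[atTop] fun n : ℕ => (n : ℝ) ^ (-ηs))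
    -- the threshold; the last hypothesis holds by itself if the priors do not depend on `n`
    (t : ℝ)
    (ht : ∀ ε : ℝ, 0 < ε → ∀ᶠ n : ℕ in atTop,
      (n : ℝ) ^ (-ε) ≤ (NEST.tripleLaw (Gμ n) (Gσ n)).real {p | t < p.2.2}) :
    NEST.VanishingSelectionBias Gμ Gσ t
        (fun n x σ i => NEST.nest (bx n) (bs n) x σ i) ∧
    (3 * ηx + ηs < 1 → ∀ τ : ℕ → ℝ, (∀ᶠ n in atTop, C n ≤ τ n) →
      NEST.VanishingSelectionBias Gμ Gσ t
        (fun n x σ i => min (NEST.nest (bx n) (bs n) x σ i) (τ n)) ∧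
      NEST.VanishingSelectionBias Gμ Gσ t
        (fun n x σ i => max (-τ n) (min (NEST.nest (bx n) (bs n) x σ i) (τ n)))) := by
  have hmin : ∀ v τ : ℝ, |min v τ| ≤ |v| + |τ| := by
    intro v τ
    rcases min_choice v τ with h | h <;> rw [h] <;> linarith [abs_nonneg v, abs_nonneg τ]
  refine ⟨?_, fun hη3 τ hτ => ⟨?_, ?_⟩⟩
  · refine NEST.vanishingSelectionBias_of_bias_le hC hμ hσl hσ hηx hηs hbx hbs hbx' hbs' ht
      (q := 1) (by simpa using hη) (ψ := fun _ v => v) (fun _ => measurable_id) (T := fun _ => 0)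
      (fun n v => by simp) ?_
    exact Eventually.of_forall fun n N θ i σ hθ hσ' H _ => H.abs_bias_id_le i hσ' hθ
  · refine NEST.vanishingSelectionBias_of_bias_le hC hμ hσl hσ hηx hηs hbx hbs hbx' hbs' ht
      (q := 3) (by exact_mod_cast hη3) (ψ := fun n v => min v (τ n)) (fun _ => by fun_prop)
      (T := fun n => |τ n|) (fun n v => hmin _ _) ?_
    filter_upwards [hτ] with n hn N θ i σ hθ hσ' H hNb
    exact H.abs_bias_lipschitz_le i hσ' hθ hNb (fun v w => NEST.abs_min_sub_min_le v w (τ n))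
      fun v hv => min_eq_left ((le_abs_self v).trans (hv.trans hn))
  · refine NEST.vanishingSelectionBias_of_bias_le hC hμ hσl hσ hηx hηs hbx hbs hbx' hbs' ht
      (q := 3) (by exact_mod_cast hη3) (ψ := fun n v => max (-τ n) (min v (τ n)))
      (fun _ => by fun_prop) (T := fun n => |τ n|) (fun n v => ?_) ?_
    · rcases max_choice (-τ n) (min v (τ n)) with h | h <;> rw [h]
      · rw [abs_neg]; linarith [abs_nonneg v]
      · exact hmin _ _
    filter_upwards [hτ] with n hn N θ i σ hθ hσ' H hNb
    refine H.abs_bias_lipschitz_le i hσ' hθ hNb (fun v w =>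
      (NEST.abs_max_sub_max_le _ _ _).trans (NEST.abs_min_sub_min_le v w (τ n))) fun v hv => ?_
    -- From `|v| ≤ C n ≤ τ n`, neither of the two truncations acts on `v`.
    rw [min_eq_left ((le_abs_self v).trans (hv.trans hn)),
      max_eq_right (by linarith [(abs_le.1 (hv.trans hn)).1])]
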